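/- For integers $a_1,\dots,a_n$ let $(a_1,\dots,a_n)$ denote the rational tangle in continued fraction form, defined recursively by $(a)=[a]$, $(a,b)=[a]+\tfrac1{[b]}$ and $(a,b,c,\dots)=[a]+\bigl((c,\dots)\star\tfrac1{[b]}\bigr)$. Here $[a]$ is the horizontal twist with $a$ crossings (counted with sign), $\tfrac1{[b]}$ is the vertical twist with $b$ crossings (the mirror image of $[b]$ turned by ninety degrees), $T+S$ is the tangle obtained by placing $T$ to the left of $S$, and $T\star S$ the one obtained by placing $T$ above $S$. Write $-S$ for the mirror image of a tangle $S$ (all crossings switched), $T-S=T+(-S)$, and $N(T)$ for the numerator closure, in which the two top endpoints of $T$ are joined to each other and the two bottom endpoints are joined to each other. Let $n\ge 2$, let $T=(a_1,\dots,a_{n-1},a_n)$ with arbitrary integers $a_i$, and let $S=(a_1,\dots,a_{n-1})$ be its truncate. Then $N(T-S)$ is topologically the unknot, that is, it is ambient isotopic in $\mathbb R^3$ to the round circle. In particular, if $[[n]]=(1,1,\dots,1)$ with $n$ ones, then $U_n=[(n+1).n]=N([[n+1]]-[[n]])$ is topologically the unknot for every $n\ge 1$. -/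

import Mathlib

/-!
Knots, links and tangles are subsets of three-space.  A tangle is drawn in the cube
`[-1,1] × [-1,1] × [-1,1]`, its four endpoints NW, NE, SW, SE being the points `(±1, ±1, 0)`.
The diagram is the projection to the `(x, y)`-plane; `z` is the height, and the strand with
the larger `z` crosses over.
-/

noncomputable section

namespace Tangles

/-- Three-space, with coordinates `(x, y, z)`. -/
abbrev Space : Type := ℝ × ℝ × ℝ

/-- `K` and `L` are ambient isotopic: there is a continuous family of self-homeomorphisms of
three-space that starts at the identity and ends at one that carries `K` onto `L`. -/
def AmbientIsotopic (K L : Set Space) : Prop :=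
  ∃ H : unitInterval → (Space ≃ₜ Space),
    Continuous (fun p : unitInterval × Space => H p.1 p.2) ∧
    H 0 = Homeomorph.refl Space ∧
    H 1 '' K = L

/-- The round unit circle in the plane `z = 0`. -/
def unitCircle : Set Space := {p | p.1 ^ 2 + p.2.1 ^ 2 = 1 ∧ p.2.2 = 0}

/-- `K` is topologically the unknot. -/
def IsUnknot (K : Set Space) : Prop := AmbientIsotopic K unitCircle

/-- The mirror image of a tangle: all the crossings are switched. -/
def mirror (T : Set Space) : Set Space :=
  (fun p : Space => ((p.1, p.2.1, -p.2.2) : Space)) '' T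

/-- The rotation `T^rot`: a tangle is turned counterclockwise by ninety degrees in the plane. -/
def rot (T : Set Space) : Set Space :=
  (fun p : Space => ((-p.2.1, p.1, p.2.2) : Space)) '' T

/-- Addition of tangles: `T` is placed in the left half of the cube and `S` in the right half,
so that the endpoints NE, SE of `T` are the endpoints NW, SW of `S`. -/
def add (T S : Set Space) : Set Space :=
  (fun p : Space => (((p.1 - 1) / 2, p.2.1, p.2.2) : Space)) '' T ∪
    (fun p : Space => (((p.1 + 1) / 2, p.2.1, p.2.2) : Space)) '' S

/-- The star product of tangles: `T` is placed in the upper half of the cube and `S` in the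
lower half, so that the endpoints SW, SE of `T` are the endpoints NW, NE of `S`. -/
def star (T S : Set Space) : Set Space :=
  (fun p : Space => ((p.1, (p.2.1 + 1) / 2, p.2.2) : Space)) '' T ∪
    (fun p : Space => ((p.1, (p.2.1 - 1) / 2, p.2.2) : Space)) '' S

/-- The difference `T - S`: the sum of `T` and the mirror image of `S`. -/
def sub (T S : Set Space) : Set Space := add T (mirror S)

/-- The horizontal twist `[n]`: two strands that run from left to right and make `n` half turns
about each other (in the opposite sense if `n` is negative).  In `[1]` the overcrossing strand
runs from SW to NE, and `[0]` consists of the horizontal segments NW-NE and SW-SE. -/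
def hTwist (n : ℤ) : Set Space :=
  {p | ∃ x ∈ Set.Icc (-1 : ℝ) 1, ∃ s : ℝ, (s = 1 ∨ s = -1) ∧
    p = (x, s * Real.cos (n * Real.pi * (x + 1) / 2),
      -(s * Real.sin (n * Real.pi * (x + 1) / 2)))}

/-- The vertical twist `1/[n]`, with `1/[0] = [∞]` the two vertical segments. -/
def vTwist (n : ℤ) : Set Space := mirror (rot (hTwist n))

/-- The rational tangle `(a₁, a₂, …, aₙ)` in continued fraction form:
`(a) = [a]`, `(a, b) = [a] + 1/[b]`, `(a, b, c, …) = [a] + ((c, …) ⋆ 1/[b])`.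
The empty list is given the tangle `[∞]`. -/
def rational : List ℤ → Set Space
  | [] => vTwist 0
  | [a] => hTwist a
  | [a, b] => add (hTwist a) (vTwist b)
  | a :: b :: c :: l => add (hTwist a) (star (rational (c :: l)) (vTwist b))

/-- The two planar arcs outside the cube, one that joins NW to NE and one that joins SW to SE. -/
def closingArcs : Set Space :=
  {p | p.2.2 = 0 ∧
    ((1 ≤ |p.1| ∧ |p.1| ≤ 2 ∧ |p.2.1| = 1) ∨
     (|p.1| = 2 ∧ 1 ≤ |p.2.1| ∧ |p.2.1| ≤ 2) ∨
     (|p.1| ≤ 2 ∧ |p.2.1| = 2))}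

/-- The numerator `N(T)`: the top endpoints are joined to each other, and so are the bottom
endpoints. -/
def numerator (T : Set Space) : Set Space := T ∪ closingArcs

/-- The rational tangle `[[n]] = (1, 1, …, 1)` with `n` terms. -/
def ones (n : ℕ) : Set Space := rational (List.replicate n 1)

/-- `[n.m] = N([[n]] - [[m]])`. -/
def dotKnot (n m : ℕ) : Set Space := numerator (sub (ones n) (ones m))

end Tangles

end

/-!
Write `N(A, B)` for the link `N(A + B)`.  A flype cancels the outermost twists of a rational tangle
against those of the mirror image of its truncate.  If `A = [a] + X` and `B = [-a] + Y`, the part of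
the diagram between the twists, which consists of `X` and the two strands that lead to `Y`, is
rotated about the `x`-axis.  This undoes both twists and applies `a` half turns to `X`, so that
there remains `N(X', Y)` with `X' = X` or `X'` its image under a half turn about the `x`-axis.
If `A = X ⋆ 1/[b]` and `B = Y ⋆ 1/[-b]`, the numerator closure is drawn with all strands leaving
the two boxes vertically.  The lower ends of `A` and `B` are then joined by two parallel strands,
and a tube around these is turned about its bent core, which undoes `1/[b]` and `1/[-b]`.

The half turns about the three axes form the Klein four-group, which fixes every twist and maps
`[a] + X` to `[a] + X'` or to `X' + [a]`, where `X'` is the image of `X`, and `X ⋆ 1/[b]` to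
`X' ⋆ 1/[b]` or to `1/[b] ⋆ X'`.  In each position the twists still cancel: if they are adjacent in
the closure nothing else is turned, and otherwise there is a flype.  So the claim that `N(g A, B)`
is the unknot for all `g` in the group (`FlipUnknot A B`) is inherited by `[a] + X`, `[-a] + Y` and
by `X ⋆ 1/[b]`, `Y ⋆ 1/[-b]` from `X`, `Y` (`FlipUnknot.hTwist_add`, `FlipUnknot.star_vTwist`).
This reduces a rational tangle and the mirror image of its truncate to `1/[b]` and `[0]`, or to
`[c]` and `[∞]`, where the remaining twist is undone by turning a single strand of the trivial
tangle.  What is left is a planar polygon, which is isotopic to a rectangle and thus to the round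
circle (`isUnknot_closure₂_vTwist_hTwist_zero`).

The isotopies come from two sources: flows, which stretch space or turn planes or a tube by an
angle that is tapered off by a cutoff function (`ambientIsotopic_of_flow`), and maps that act on
each line parallel to an axis by an increasing bijection at bounded distance from the identity, to
which convex combinations give an isotopy (`ambientIsotopic_fiberX`, `ambientIsotopic_fiberY`).
-/

/-! ### Ambient isotopies -/

namespace Tangles

/-- The isotopies are composed time by time, so that no reparametrization is needed. -/
theorem AmbientIsotopic.trans {K L M : Set Space} (h₁ : AmbientIsotopic K L)
    (h₂ : AmbientIsotopic L M) : AmbientIsotopic K M := by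
  obtain ⟨F, hF, hF0, hF1⟩ := h₁
  obtain ⟨G, hG, hG0, hG1⟩ := h₂
  refine ⟨fun t => (F t).trans (G t), ?_, ?_, ?_⟩
  · exact hG.comp (continuous_fst.prodMk hF)
  · simp only [hF0, hG0]; rfl
  · rw [← hG1, ← hF1, Set.image_image]; rfl

/-- The isotopy is run backwards, after the inverse of its final homeomorphism. -/
theorem AmbientIsotopic.symm {K L : Set Space} (h : AmbientIsotopic K L) :
    AmbientIsotopic L K := by
  obtain ⟨F, hF, hF0, hF1⟩ := h
  refine ⟨fun t => (F 1).symm.trans (F (unitInterval.symm t)), ?_, ?_, ?_⟩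
  · exact hF.comp ((unitInterval.continuous_symm.comp continuous_fst).prodMk
      ((F 1).symm.continuous.comp continuous_snd))
  · ext1 x; simp
  · rw [← hF1, Set.image_image]; simp [hF0]

theorem AmbientIsotopic.conj {K L : Set Space} (h : AmbientIsotopic K L) (σ : Space ≃ₜ Space) :
    AmbientIsotopic (σ '' K) (σ '' L) := by
  obtain ⟨F, hF, hF0, hF1⟩ := h
  refine ⟨fun t => (σ.symm.trans (F t)).trans σ, ?_, ?_, ?_⟩
  · exact σ.continuous.comp
      (hF.comp (continuous_fst.prodMk (σ.symm.continuous.comp continuous_snd)))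
  · ext1 x; simp [hF0]
  · rw [← hF1, Set.image_image, Set.image_image]; simp

theorem IsUnknot.of_ambientIsotopic {K L : Set Space} (hL : IsUnknot L)
    (h : AmbientIsotopic K L) : IsUnknot K :=
  h.trans hL

/-- A one-parameter family of maps in which the time `-t` map undoes the time `t` map is an
ambient isotopy. -/
theorem ambientIsotopic_of_flow (F : ℝ → Space → Space)
    (hF : Continuous fun p : ℝ × Space => F p.1 p.2) (h0 : ∀ x, F 0 x = x)
    (hinv : ∀ t x, F (-t) (F t x) = x) (K : Set Space) : AmbientIsotopic K (F 1 '' K) := by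
  have hc : ∀ t, Continuous (F t) := fun t => hF.comp (continuous_const.prodMk continuous_id)
  refine ⟨fun t => ⟨⟨F t, F (-t), hinv t, fun x => ?_⟩, hc _, hc _⟩, ?_, ?_, ?_⟩
  · simpa using hinv (-(t : ℝ)) x
  · exact hF.comp ((continuous_subtype_val.comp continuous_fst).prodMk continuous_snd)
  · ext1 x; exact h0 x
  · simp

/-- A continuous family of increasing bijections of the line is a homeomorphism of the total
space. -/
noncomputable def fiberHomeo {W : Type*} [TopologicalSpace W] (p : W → ℝ → ℝ)
    (hp : Continuous fun q : W × ℝ => p q.1 q.2) (hm : ∀ w, StrictMono (p w))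
    (hs : ∀ w, Function.Surjective (p w)) : W × ℝ ≃ₜ W × ℝ where
  toFun q := (q.1, p q.1 q.2)
  invFun q := (q.1, ((hm q.1).orderIsoOfSurjective _ (hs q.1)).symm q.2)
  left_inv q := by
    ext1
    · rfl
    · exact ((hm q.1).orderIsoOfSurjective _ (hs q.1)).symm_apply_apply q.2
  right_inv q := by
    ext1
    · rfl
    · exact ((hm q.1).orderIsoOfSurjective _ (hs q.1)).apply_symm_apply q.2
  continuous_toFun := continuous_fst.prodMk hp
  continuous_invFun := by
    refine continuous_fst.prodMk (OrderTopology.continuous_iff.2 fun a => ⟨?_, ?_⟩)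
    · have : (fun q : W × ℝ => ((hm q.1).orderIsoOfSurjective _ (hs q.1)).symm q.2) ⁻¹' Set.Ioi a
          = {q | p q.1 a < q.2} := by
        ext q
        exact ((hm q.1).orderIsoOfSurjective _ (hs q.1)).lt_symm_apply
      rw [this]
      exact isOpen_lt (hp.comp (continuous_fst.prodMk continuous_const)) continuous_snd
    · have : (fun q : W × ℝ => ((hm q.1).orderIsoOfSurjective _ (hs q.1)).symm q.2) ⁻¹' Set.Iio a
          = {q | q.2 < p q.1 a} := by
        ext q
        exact ((hm q.1).orderIsoOfSurjective _ (hs q.1)).symm_apply_lt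
      rw [this]
      exact isOpen_lt continuous_snd (hp.comp (continuous_fst.prodMk continuous_const))

theorem surjective_of_bounded_displacement {f : ℝ → ℝ} (hf : Continuous f) {C : ℝ}
    (hC : ∀ y, |f y - y| ≤ C) : Function.Surjective f := by
  apply hf.surjective
  · exact Filter.tendsto_atTop_mono (fun y => by have := abs_le.1 (hC y); simp only [id]; linarith)
      (Filter.tendsto_atTop_add_const_right _ (-C) Filter.tendsto_id)
  · exact Filter.tendsto_atBot_mono (fun y => by have := abs_le.1 (hC y); simp only [id]; linarith)
      (Filter.tendsto_atBot_add_const_right _ C Filter.tendsto_id)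

/-- The coordinates `(x, y, z)` are regrouped as `((x, z), y)`. -/
def splitY : Space ≃ₜ (ℝ × ℝ) × ℝ where
  toFun q := ((q.1, q.2.2), q.2.1)
  invFun q := (q.1.1, q.2, q.1.2)
  left_inv _ := rfl
  right_inv _ := rfl
  continuous_toFun := by fun_prop
  continuous_invFun := by fun_prop

/-- The reflection that exchanges `x` and `y`. -/
def swapXY : Space ≃ₜ Space where
  toFun q := (q.2.1, q.1, q.2.2)
  invFun q := (q.2.1, q.1, q.2.2)
  left_inv _ := rfl
  right_inv _ := rfl
  continuous_toFun := by fun_prop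
  continuous_invFun := by fun_prop

/-- The map of space that applies `p x` to the coordinate `y` on each line parallel to the
`y`-axis. -/
def fiberY (p : ℝ → ℝ → ℝ) (q : Space) : Space := (q.1, p q.1 q.2.1, q.2.2)

/-- The map of space that applies `p y` to the coordinate `x` on each line parallel to the
`x`-axis. -/
def fiberX (p : ℝ → ℝ → ℝ) (q : Space) : Space := (p q.2.1 q.1, q.2.1, q.2.2)

/-- Convex combinations with the identity give the isotopy. -/
theorem ambientIsotopic_fiberY (p : ℝ → ℝ → ℝ) (hp : Continuous fun q : ℝ × ℝ => p q.1 q.2)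
    (hm : ∀ x, StrictMono (p x)) (hb : ∀ x, ∃ C, ∀ y, |p x y - y| ≤ C) (K : Set Space) :
    AmbientIsotopic K (fiberY p '' K) := by
  let P : unitInterval → ℝ × ℝ → ℝ → ℝ := fun t w y => (1 - (t : ℝ)) * y + t * p w.1 y
  have hpx : ∀ x, Continuous (p x) := fun x => hp.comp (continuous_const.prodMk continuous_id)
  have hP : Continuous fun q : unitInterval × ((ℝ × ℝ) × ℝ) => P q.1 q.2.1 q.2.2 := by
    have : Continuous fun q : unitInterval × ((ℝ × ℝ) × ℝ) => p q.2.1.1 q.2.2 :=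
      hp.comp (f := fun q : unitInterval × ((ℝ × ℝ) × ℝ) => (q.2.1.1, q.2.2)) (by fun_prop)
    simp only [P]; fun_prop
  have hPm : ∀ t w, StrictMono (P t w) := by
    intro t w y y' hy
    have h1 := hm w.1 hy
    have h2 := t.2.1
    have h3 := t.2.2
    rcases h2.eq_or_lt with h | h
    · simp only [P, ← h]; linarith
    · have := mul_lt_mul_of_pos_left h1 h
      have := mul_le_mul_of_nonneg_left hy.le (sub_nonneg.2 h3)
      simp only [P]; linarith
  have hPs : ∀ t w, Function.Surjective (P t w) := by
    intro t w
    obtain ⟨C, hC⟩ := hb w.1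
    refine surjective_of_bounded_displacement (C := C) ?_ fun y => ?_
    · exact hP.comp (continuous_const.prodMk (continuous_const.prodMk continuous_id))
    · have : P t w y - y = t * (p w.1 y - y) := by simp only [P]; ring
      rw [this, abs_mul, abs_of_nonneg t.2.1]
      exact (mul_le_of_le_one_left (abs_nonneg _) t.2.2).trans (hC y)
  have hPt : ∀ t, Continuous fun q : (ℝ × ℝ) × ℝ => P t q.1 q.2 := fun t =>
    hP.comp (continuous_const.prodMk continuous_id)
  refine ⟨fun t => (splitY.trans (fiberHomeo (P t) (hPt t) (hPm t) (hPs t))).trans splitY.symm,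
    ?_, ?_, ?_⟩
  · have h2 : Continuous fun q : unitInterval × Space => P q.1 (q.2.1, q.2.2.2) q.2.2.1 :=
      hP.comp (f := fun q : unitInterval × Space => (q.1, ((q.2.1, q.2.2.2), q.2.2.1)))
        (by fun_prop)
    have h3 : Continuous fun q : unitInterval × Space =>
        ((q.2.1, P q.1 (q.2.1, q.2.2.2) q.2.2.1, q.2.2.2) : Space) := by fun_prop
    exact h3
  · ext1 q
    simp [splitY, fiberHomeo, P]
  · apply Set.image_congr
    intro q _
    simp [splitY, fiberHomeo, P, fiberY]

theorem ambientIsotopic_fiberX (p : ℝ → ℝ → ℝ) (hp : Continuous fun q : ℝ × ℝ => p q.1 q.2)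
    (hm : ∀ y, StrictMono (p y)) (hb : ∀ y, ∃ C, ∀ x, |p y x - x| ≤ C) (K : Set Space) :
    AmbientIsotopic K (fiberX p '' K) := by
  have := (ambientIsotopic_fiberY p hp hm hb (swapXY '' K)).conj swapXY
  rw [Set.image_image, Set.image_image, Set.image_image] at this
  have h : (fun q => swapXY (swapXY q)) '' K = K := Set.image_id K
  rw [h] at this
  exact this

end Tangles

/-! ### Half turns and twists about the `x`-axis -/

namespace Tangles

/-- The cube `[-1,1]³` in which tangles are drawn. -/
def cube : Set Space := {p | |p.1| ≤ 1 ∧ |p.2.1| ≤ 1 ∧ |p.2.2| ≤ 1}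

/-- The Klein four-group of half turns about the coordinate axes: `flip (-1) 1`, `flip 1 (-1)` and
`flip (-1) (-1)` are the half turns about the `y`-, `x`- and `z`-axis. -/
def flip (e h : ℝ) (p : Space) : Space := (e * p.1, h * p.2.1, e * h * p.2.2)

/-- The cube is placed over the interval `[p, q]` of the `x`-axis. -/
noncomputable def hBox (p q : ℝ) (v : Space) : Space :=
  ((p + q) / 2 + (q - p) / 2 * v.1, v.2.1, v.2.2)

/-- The point at parameter `t` of the strand `s = ±1` of `[n]`. -/
noncomputable def hPoint (n : ℤ) (t s : ℝ) : Space :=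
  (t, s * Real.cos (n * Real.pi * (t + 1) / 2), -(s * Real.sin (n * Real.pi * (t + 1) / 2)))

/-- The point at parameter `t` of the strand `s = ±1` of `1/[n]`. -/
noncomputable def vPoint (n : ℤ) (t s : ℝ) : Space :=
  (s * Real.cos (n * Real.pi * (t + 1) / 2), t, -(s * Real.sin (n * Real.pi * (t + 1) / 2)))

theorem mem_hTwist {n : ℤ} {p : Space} :
    p ∈ hTwist n ↔ ∃ t ∈ Set.Icc (-1 : ℝ) 1, ∃ s : ℝ, (s = 1 ∨ s = -1) ∧ p = hPoint n t s :=
  Iff.rfl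

theorem mem_vTwist {n : ℤ} {p : Space} :
    p ∈ vTwist n ↔ ∃ t ∈ Set.Icc (-1 : ℝ) 1, ∃ s : ℝ, (s = 1 ∨ s = -1) ∧ p = vPoint n t s := by
  simp only [vTwist, mirror, rot, Set.image_image, Set.mem_image]
  constructor
  · rintro ⟨_, ⟨t, ht, s, hs, rfl⟩, rfl⟩
    exact ⟨t, ht, -s, by rcases hs with rfl | rfl <;> simp, by simp [vPoint]⟩
  · rintro ⟨t, ht, s, hs, rfl⟩
    exact ⟨_, ⟨t, ht, -s, by rcases hs with rfl | rfl <;> simp, rfl⟩, by simp [vPoint]⟩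

theorem sign_mul {c s : ℝ} (hc : c = 1 ∨ c = -1) (hs : s = 1 ∨ s = -1) :
    c * s = 1 ∨ c * s = -1 := by
  rcases hc with rfl | rfl <;> rcases hs with rfl | rfl <;> simp

theorem sign_mul_cancel {c s : ℝ} (hc : c = 1 ∨ c = -1) : c * (c * s) = s := by
  rcases hc with rfl | rfl <;> simp

/-- Two images of twists agree if the maps do, up to an exchange of the two strands when
`c = -1`. -/
theorem image_hTwist_congr {f g : Space → Space} {n m : ℤ} {c : ℝ} (hc : c = 1 ∨ c = -1)
    (h : ∀ t ∈ Set.Icc (-1 : ℝ) 1, ∀ s, (s = 1 ∨ s = -1) →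
      f (hPoint n t s) = g (hPoint m t (c * s))) : f '' hTwist n = g '' hTwist m := by
  ext x
  constructor
  · rintro ⟨_, ⟨t, ht, s, hs, rfl⟩, rfl⟩
    exact ⟨hPoint m t (c * s), ⟨t, ht, _, sign_mul hc hs, rfl⟩, (h t ht s hs).symm⟩
  · rintro ⟨_, ⟨t, ht, s, hs, rfl⟩, rfl⟩
    refine ⟨hPoint n t (c * s), ⟨t, ht, _, sign_mul hc hs, rfl⟩, ?_⟩
    rw [h t ht _ (sign_mul hc hs), sign_mul_cancel hc]; rfl

theorem image_vTwist_congr {f g : Space → Space} {n m : ℤ} {c : ℝ} (hc : c = 1 ∨ c = -1)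
    (h : ∀ t ∈ Set.Icc (-1 : ℝ) 1, ∀ s, (s = 1 ∨ s = -1) →
      f (vPoint n t s) = g (vPoint m t (c * s))) : f '' vTwist n = g '' vTwist m := by
  ext x
  simp only [Set.mem_image, mem_vTwist]
  constructor
  · rintro ⟨_, ⟨t, ht, s, hs, rfl⟩, rfl⟩
    exact ⟨vPoint m t (c * s), ⟨t, ht, _, sign_mul hc hs, rfl⟩, (h t ht s hs).symm⟩
  · rintro ⟨_, ⟨t, ht, s, hs, rfl⟩, rfl⟩
    refine ⟨vPoint n t (c * s), ⟨t, ht, _, sign_mul hc hs, rfl⟩, ?_⟩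
    rw [h t ht _ (sign_mul hc hs), sign_mul_cancel hc]

/-- The cutoff function of the twisting maps: it is `1` on a disc that contains the square
`[-1,1]²`, and it vanishes outside the disc of radius `2`. -/
noncomputable def cutoff (y z : ℝ) : ℝ := max 0 (min 1 (4 - 2 * Real.sqrt (y ^ 2 + z ^ 2)))

theorem continuous_cutoff : Continuous fun q : ℝ × ℝ => cutoff q.1 q.2 := by
  unfold cutoff; fun_prop

theorem cutoff_eq_one {y z : ℝ} (h : y ^ 2 + z ^ 2 ≤ 2) : cutoff y z = 1 := by
  have : Real.sqrt (y ^ 2 + z ^ 2) ≤ 3 / 2 := by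
    rw [Real.sqrt_le_left (by norm_num)]; linarith
  rw [cutoff, min_eq_left (by linarith), max_eq_right zero_le_one]

theorem cutoff_eq_zero {y z : ℝ} (h : 4 ≤ y ^ 2 + z ^ 2) : cutoff y z = 0 := by
  have : 2 ≤ Real.sqrt (y ^ 2 + z ^ 2) := Real.le_sqrt_of_sq_le (by linarith)
  rw [cutoff]
  exact max_eq_left ((min_le_right _ _).trans (by linarith))

theorem sq_add_sq_rotate (y z θ : ℝ) :
    (y * Real.cos θ - z * Real.sin θ) ^ 2 + (y * Real.sin θ + z * Real.cos θ) ^ 2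
      = y ^ 2 + z ^ 2 := by
  linear_combination (y ^ 2 + z ^ 2) * Real.sin_sq_add_cos_sq θ

theorem cutoff_rotate (y z θ : ℝ) :
    cutoff (y * Real.cos θ - z * Real.sin θ) (y * Real.sin θ + z * Real.cos θ) = cutoff y z := by
  simp only [cutoff, sq_add_sq_rotate]

theorem rotate_neg_fst (y z θ : ℝ) :
    (y * Real.cos θ - z * Real.sin θ) * Real.cos (-θ)
      - (y * Real.sin θ + z * Real.cos θ) * Real.sin (-θ) = y := by
  rw [Real.cos_neg, Real.sin_neg]
  linear_combination y * Real.sin_sq_add_cos_sq θ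

theorem rotate_neg_snd (y z θ : ℝ) :
    (y * Real.cos θ - z * Real.sin θ) * Real.sin (-θ)
      + (y * Real.sin θ + z * Real.cos θ) * Real.cos (-θ) = z := by
  rw [Real.cos_neg, Real.sin_neg]
  linear_combination z * Real.sin_sq_add_cos_sq θ

/-- The plane with first coordinate `x` is turned about the `x`-axis by the angle `α x`, tapered
off by the cutoff function. -/
noncomputable def twistX (α : ℝ → ℝ) (q : Space) : Space :=
  let θ := α q.1 * cutoff q.2.1 q.2.2
  (q.1, q.2.1 * Real.cos θ - q.2.2 * Real.sin θ, q.2.1 * Real.sin θ + q.2.2 * Real.cos θ)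

theorem ambientIsotopic_twistX {α : ℝ → ℝ} (hα : Continuous α) (K : Set Space) :
    AmbientIsotopic K (twistX α '' K) := by
  have := ambientIsotopic_of_flow (fun t => twistX fun x => t * α x) ?_ ?_ ?_ K
  · simpa using this
  · have h1 : Continuous fun q : ℝ × Space => cutoff q.2.2.1 q.2.2.2 :=
      continuous_cutoff.comp (f := fun q : ℝ × Space => (q.2.2.1, q.2.2.2)) (by fun_prop)
    simp only [twistX]
    fun_prop
  · intro q; simp [twistX]
  · intro t q
    simp only [twistX, cutoff_rotate, neg_mul, rotate_neg_fst, rotate_neg_snd]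

theorem twistX_of_eq_zero {α : ℝ → ℝ} {q : Space} (h : α q.1 = 0) : twistX α q = q := by
  simp [twistX, h]

theorem twistX_of_far {α : ℝ → ℝ} {q : Space} (h : 4 ≤ q.2.1 ^ 2 + q.2.2 ^ 2) :
    twistX α q = q := by
  simp [twistX, cutoff_eq_zero h]

theorem twistX_of_near {α : ℝ → ℝ} {q : Space} (h : q.2.1 ^ 2 + q.2.2 ^ 2 ≤ 2) :
    twistX α q = (q.1, q.2.1 * Real.cos (α q.1) - q.2.2 * Real.sin (α q.1),
      q.2.1 * Real.sin (α q.1) + q.2.2 * Real.cos (α q.1)) := by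
  simp [twistX, cutoff_eq_one h]

theorem cos_int_mul_pi_eq (i : ℤ) : Real.cos (i * Real.pi) = 1 ∨ Real.cos (i * Real.pi) = -1 := by
  have h := Real.sin_sq_add_cos_sq (i * Real.pi)
  rw [Real.sin_int_mul_pi] at h
  exact mul_self_eq_one_iff.1 (by linarith [sq (Real.cos (i * Real.pi))])

/-- A rotation by an angle that runs linearly from `iπ` to `jπ` undoes `j - i` half twists. -/
theorem cos_twist (n i j : ℤ) (t s : ℝ) :
    s * Real.cos (n * Real.pi * (t + 1) / 2) * Real.cos (Real.pi * (i + (j - i) * ((t + 1) / 2)))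
      - -(s * Real.sin (n * Real.pi * (t + 1) / 2))
        * Real.sin (Real.pi * (i + (j - i) * ((t + 1) / 2)))
      = Real.cos (i * Real.pi) * s
        * Real.cos ((n - j + i : ℤ) * Real.pi * (t + 1) / 2) := by
  have h : ((n - j + i : ℤ) : ℝ) * Real.pi * (t + 1) / 2 - i * Real.pi
      = n * Real.pi * (t + 1) / 2 - Real.pi * (i + (j - i) * ((t + 1) / 2)) := by
    push_cast; ring
  have h2 := congrArg Real.cos h
  rw [Real.cos_sub, Real.cos_sub, Real.sin_int_mul_pi] at h2
  linear_combination -s * h2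

theorem sin_twist (n i j : ℤ) (t s : ℝ) :
    s * Real.cos (n * Real.pi * (t + 1) / 2) * Real.sin (Real.pi * (i + (j - i) * ((t + 1) / 2)))
      + -(s * Real.sin (n * Real.pi * (t + 1) / 2))
        * Real.cos (Real.pi * (i + (j - i) * ((t + 1) / 2)))
      = -(Real.cos (i * Real.pi) * s
        * Real.sin ((n - j + i : ℤ) * Real.pi * (t + 1) / 2)) := by
  have h : ((n - j + i : ℤ) : ℝ) * Real.pi * (t + 1) / 2 - i * Real.pi
      = n * Real.pi * (t + 1) / 2 - Real.pi * (i + (j - i) * ((t + 1) / 2)) := by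
    push_cast; ring
  have h2 := congrArg Real.sin h
  rw [Real.sin_sub, Real.sin_sub, Real.sin_int_mul_pi] at h2
  linear_combination s * h2

theorem sq_add_sq_strand (s φ : ℝ) (hs : s = 1 ∨ s = -1) :
    (s * Real.cos φ) ^ 2 + (-(s * Real.sin φ)) ^ 2 = 1 := by
  have : s ^ 2 = 1 := by rcases hs with rfl | rfl <;> norm_num
  linear_combination (Real.sin φ ^ 2 + Real.cos φ ^ 2) * this + Real.sin_sq_add_cos_sq φ

theorem twistX_image_hTwist {α : ℝ → ℝ} {p q : ℝ} (n i j : ℤ)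
    (h : ∀ t ∈ Set.Icc (-1 : ℝ) 1,
      α ((p + q) / 2 + (q - p) / 2 * t) = Real.pi * (i + (j - i) * ((t + 1) / 2))) :
    twistX α '' (hBox p q '' hTwist n) = hBox p q '' hTwist (n - j + i) := by
  rw [Set.image_image]
  refine image_hTwist_congr (cos_int_mul_pi_eq i) fun t ht s hs => ?_
  rw [twistX_of_near]
  · simp only [hBox, hPoint, h t ht, cos_twist, sin_twist]
  · simp only [hBox, hPoint, sq_add_sq_strand s _ hs]
    norm_num

theorem sq_le_one_of_abs_le {x : ℝ} (h : |x| ≤ 1) : x ^ 2 ≤ 1 := by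
  rw [← sq_abs]; exact pow_le_one₀ (abs_nonneg x) h

theorem twistX_image_cube {α : ℝ → ℝ} {p q : ℝ} (i : ℤ) {X : Set Space} (hX : X ⊆ cube)
    (h : ∀ t ∈ Set.Icc (-1 : ℝ) 1, α ((p + q) / 2 + (q - p) / 2 * t) = i * Real.pi) :
    twistX α '' (hBox p q '' X) = hBox p q '' (flip 1 (Real.cos (i * Real.pi)) '' X) := by
  rw [Set.image_image, Set.image_image]
  refine Set.image_congr fun v hv => ?_
  obtain ⟨h1, h2, h3⟩ := hX hv
  rw [twistX_of_near]
  · simp only [hBox, flip, h _ (abs_le.1 h1), Real.sin_int_mul_pi]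
    ext <;> simp [mul_comm]
  · have := sq_le_one_of_abs_le h2
    have := sq_le_one_of_abs_le h3
    simp only [hBox]; linarith

theorem twistX_image_of_eq_zero {α : ℝ → ℝ} {K : Set Space} (h : ∀ q ∈ K, α q.1 = 0) :
    twistX α '' K = K := by
  rw [Set.image_congr fun q hq => twistX_of_eq_zero (h q hq)]
  exact Set.image_id K

end Tangles

/-! ### Two tangles in a row -/

namespace Tangles

/-- The hat function of height `1` at `b` that is supported in `[a, c]`. -/
noncomputable def hat (a b c x : ℝ) : ℝ := max 0 (min ((x - a) / (b - a)) ((c - x) / (c - b)))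

/-- The piecewise linear map of the line that fixes the points outside `[a, c]` and moves `b`
to `b'`. -/
noncomputable def hatMap (a b b' c x : ℝ) : ℝ := x + (b' - b) * hat a b c x

section hatMap

variable {a b b' c : ℝ}

theorem continuous_hatMap : Continuous (hatMap a b b' c) := by
  unfold hatMap hat
  simp only [div_eq_mul_inv]
  fun_prop

theorem hat_nonneg (a b c x : ℝ) : 0 ≤ hat a b c x := le_max_left _ _

theorem hat_of_le (h1 : a < b) {x : ℝ} (h : x ≤ a) : hat a b c x = 0 := by
  rw [hat]
  exact max_eq_left ((min_le_left _ _).trans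
    (div_nonpos_of_nonpos_of_nonneg (by linarith) (by linarith)))

theorem hat_of_ge (h2 : b < c) {x : ℝ} (h : c ≤ x) : hat a b c x = 0 := by
  rw [hat]
  exact max_eq_left ((min_le_right _ _).trans
    (div_nonpos_of_nonpos_of_nonneg (by linarith) (by linarith)))

theorem hat_left (h1 : a < b) (h2 : b < c) {x : ℝ} (ha : a ≤ x) (hb : x ≤ b) :
    hat a b c x = (x - a) / (b - a) := by
  have h3 : (x - a) / (b - a) ≤ 1 := by rw [div_le_one (by linarith)]; linarith
  have h4 : 1 ≤ (c - x) / (c - b) := by rw [one_le_div (by linarith)]; linarith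
  rw [hat, min_eq_left (h3.trans h4)]
  exact max_eq_right (div_nonneg (by linarith) (by linarith))

theorem hat_right (h1 : a < b) (h2 : b < c) {x : ℝ} (hb : b ≤ x) (hc : x ≤ c) :
    hat a b c x = (c - x) / (c - b) := by
  have h3 : (c - x) / (c - b) ≤ 1 := by rw [div_le_one (by linarith)]; linarith
  have h4 : 1 ≤ (x - a) / (b - a) := by rw [one_le_div (by linarith)]; linarith
  rw [hat, min_eq_right (h3.trans h4)]
  exact max_eq_right (div_nonneg (by linarith) (by linarith))

theorem hatMap_of_le (h1 : a < b) {x : ℝ} (h : x ≤ a) : hatMap a b b' c x = x := by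
  rw [hatMap, hat_of_le h1 h, mul_zero, add_zero]

theorem hatMap_of_ge (h2 : b < c) {x : ℝ} (h : c ≤ x) : hatMap a b b' c x = x := by
  rw [hatMap, hat_of_ge h2 h, mul_zero, add_zero]

theorem hatMap_self (h1 : a < b) (h2 : b < c) : hatMap a b b' c b = b' := by
  rw [hatMap, hat_left h1 h2 h1.le le_rfl, div_self (by linarith)]; ring

theorem strictMono_hatMap (h1 : a < b) (h2 : b < c) (h1' : a < b') (h2' : b' < c) :
    StrictMono (hatMap a b b' c) := by
  intro x y hxy
  have hab : 0 < b - a := by linarith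
  have hcb : 0 < c - b := by linarith
  -- The hat function has slope at most `1 / (b - a)` and at least `-1 / (c - b)`.
  have hu : hat a b c y ≤ hat a b c x + (y - x) / (b - a) := by
    have h0 : 0 ≤ (y - x) / (b - a) := div_nonneg (by linarith) hab.le
    have e : (y - a) / (b - a) = (x - a) / (b - a) + (y - x) / (b - a) := by field_simp; ring
    have e' : (c - y) / (c - b) ≤ (c - x) / (c - b) := by gcongr
    unfold hat
    rcases le_total ((x - a) / (b - a)) ((c - x) / (c - b)) with h | h
    · rw [min_eq_left h]
      exact max_le (by positivity) ((min_le_left _ _).trans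
        (by rw [e]; linarith [le_max_right 0 ((x - a) / (b - a))]))
    · rw [min_eq_right h]
      exact max_le (by positivity) ((min_le_right _ _).trans
        (by linarith [le_max_right 0 ((c - x) / (c - b))]))
  have hl : hat a b c x ≤ hat a b c y + (y - x) / (c - b) := by
    have h0 : 0 ≤ (y - x) / (c - b) := div_nonneg (by linarith) hcb.le
    have e : (c - x) / (c - b) = (c - y) / (c - b) + (y - x) / (c - b) := by field_simp; ring
    have e' : (x - a) / (b - a) ≤ (y - a) / (b - a) := by gcongr
    unfold hat
    rcases le_total ((y - a) / (b - a)) ((c - y) / (c - b)) with h | h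
    · rw [min_eq_left h]
      exact max_le (by positivity) ((min_le_left _ _).trans
        (by linarith [le_max_right 0 ((y - a) / (b - a))]))
    · rw [min_eq_right h]
      exact max_le (by positivity) ((min_le_right _ _).trans
        (by rw [e]; linarith [le_max_right 0 ((c - y) / (c - b))]))
  unfold hatMap
  rcases le_total b b' with h | h
  · have h3 : (b' - b) * ((y - x) / (c - b)) < y - x := by
      rw [mul_div_assoc', div_lt_iff₀ hcb]; nlinarith
    nlinarith
  · have h3 : (b - b') * ((y - x) / (b - a)) < y - x := by
      rw [mul_div_assoc', div_lt_iff₀ hab]; nlinarith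
    nlinarith

/-- An interval that contains none of the three nodes in its interior is mapped affinely. -/
theorem hatMap_affine (h1 : a < b) (h2 : b < c) {u v : ℝ}
    (h : v ≤ a ∨ (a ≤ u ∧ v ≤ b) ∨ (b ≤ u ∧ v ≤ c) ∨ c ≤ u) (huv : u ≤ v)
    {t : ℝ} (ht : t ∈ Set.Icc (-1 : ℝ) 1) :
    hatMap a b b' c ((u + v) / 2 + (v - u) / 2 * t)
      = (hatMap a b b' c u + hatMap a b b' c v) / 2
        + (hatMap a b b' c v - hatMap a b b' c u) / 2 * t := by
  have hx1 : u ≤ (u + v) / 2 + (v - u) / 2 * t := by nlinarith [ht.1]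
  have hx2 : (u + v) / 2 + (v - u) / 2 * t ≤ v := by nlinarith [ht.2]
  have hab : b - a ≠ 0 := by linarith
  have hcb : c - b ≠ 0 := by linarith
  rcases h with h | ⟨h, h'⟩ | ⟨h, h'⟩ | h
  · rw [hatMap_of_le h1 (hx2.trans h), hatMap_of_le h1 (huv.trans h), hatMap_of_le h1 h]
  · unfold hatMap
    rw [hat_left h1 h2 (h.trans hx1) (hx2.trans h'), hat_left h1 h2 h (huv.trans h'),
      hat_left h1 h2 (h.trans huv) h']
    field_simp
    ring
  · unfold hatMap
    rw [hat_right h1 h2 (h.trans hx1) (hx2.trans h'), hat_right h1 h2 h (huv.trans h'),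
      hat_right h1 h2 (h.trans huv) h']
    field_simp
    ring
  · rw [hatMap_of_ge h2 (h.trans hx1), hatMap_of_ge h2 h, hatMap_of_ge h2 (h.trans huv)]

end hatMap

/-- The increasing bijection of the line given by `hatMap`. -/
noncomputable def hatIso {a b b' c : ℝ} (h1 : a < b) (h2 : b < c) (h1' : a < b') (h2' : b' < c) :
    ℝ ≃o ℝ :=
  (strictMono_hatMap h1 h2 h1' h2').orderIsoOfSurjective _ <| by
    refine surjective_of_bounded_displacement continuous_hatMap (C := |b' - b|) fun y => ?_
    have h : hatMap a b b' c y - y = (b' - b) * hat a b c y := by unfold hatMap; ring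
    rw [h, abs_mul]
    refine mul_le_of_le_one_right (abs_nonneg _) ?_
    rw [abs_le]
    rcases le_total y b with hy | hy
    · have : (y - a) / (b - a) ≤ 1 := by rw [div_le_one (by linarith)]; linarith
      exact ⟨by linarith [hat_nonneg a b c y],
        max_le zero_le_one ((min_le_left _ _).trans this)⟩
    · have : (c - y) / (c - b) ≤ 1 := by rw [div_le_one (by linarith)]; linarith
      exact ⟨by linarith [hat_nonneg a b c y],
        max_le zero_le_one ((min_le_right _ _).trans this)⟩

theorem hatIso_apply {a b b' c : ℝ} (h1 : a < b) (h2 : b < c) (h1' : a < b') (h2' : b' < c)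
    (x : ℝ) : hatIso h1 h2 h1' h2' x = hatMap a b b' c x := rfl

/-- The horizontal lines `y = ±1` over the interval `[p, q]`. -/
def hLines (p q : ℝ) : Set Space := {v | p ≤ v.1 ∧ v.1 ≤ q ∧ |v.2.1| = 1 ∧ v.2.2 = 0}

/-- The outer part of a numerator closure, of width `12` and height `4`. -/
def rowArcs : Set Space :=
  {v | v.2.2 = 0 ∧ ((|v.1| = 6 ∧ 1 ≤ |v.2.1| ∧ |v.2.1| ≤ 2) ∨ (|v.1| ≤ 6 ∧ |v.2.1| = 2))}

/-- The numerator closure of two tangles in a row, drawn over the intervals `[p, q]` and `[r, s]`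
of the `x`-axis. -/
noncomputable def row (p q r s : ℝ) (A B : Set Space) : Set Space :=
  hBox p q '' A ∪ hBox r s '' B ∪ (hLines (-6) p ∪ hLines q r ∪ hLines s 6 ∪ rowArcs)

theorem hBox_image_hTwist_zero {p q : ℝ} (h : p ≤ q) : hBox p q '' hTwist 0 = hLines p q := by
  ext v
  constructor
  · rintro ⟨_, ⟨t, ⟨ht1, ht2⟩, s, hs, rfl⟩, rfl⟩
    refine ⟨?_, ?_, ?_, ?_⟩
    · simp only [hBox]; nlinarith
    · simp only [hBox]; nlinarith
    · rcases hs with rfl | rfl <;> simp [hBox]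
    · simp [hBox]
  · rintro ⟨h1, h2, h3, h4⟩
    refine ⟨hPoint 0 ((2 * v.1 - p - q) / (q - p)) v.2.1, ⟨_, ⟨?_, ?_⟩, v.2.1,
      eq_or_eq_neg_of_abs_eq h3, rfl⟩, ?_⟩
    · rcases h.eq_or_lt with h | h
      · simp [h]
      · rw [le_div_iff₀ (by linarith)]; linarith
    · rcases h.eq_or_lt with h | h
      · simp [h]
      · rw [div_le_iff₀ (by linarith)]; linarith
    · ext
      · rcases h.eq_or_lt with h | h
        · subst h; simp [hBox]; linarith
        · have : q - p ≠ 0 := by linarith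
          simp only [hBox, hPoint]; field_simp; ring
      · simp [hBox, hPoint]
      · simp [hBox, hPoint, h4]

theorem hBox_image_add (p q : ℝ) (T S : Set Space) :
    hBox p q '' add T S = hBox p ((p + q) / 2) '' T ∪ hBox ((p + q) / 2) q '' S := by
  rw [add, Set.image_union, Set.image_image, Set.image_image]
  congr 1 <;> refine Set.image_congr fun v _ => ?_ <;> simp only [hBox] <;> ext <;> simp <;> ring

theorem hLines_union {p q r : ℝ} (h1 : p ≤ q) (h2 : q ≤ r) :
    hLines p q ∪ hLines q r = hLines p r := by
  ext v
  simp only [hLines, Set.mem_union, Set.mem_ofPred_eq]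
  constructor
  · rintro (⟨a, b, c⟩ | ⟨a, b, c⟩)
    · exact ⟨a, b.trans h2, c⟩
    · exact ⟨h1.trans a, b, c⟩
  · rintro ⟨a, b, c⟩
    rcases le_total v.1 q with h | h
    · exact Or.inl ⟨a, h, c⟩
    · exact Or.inr ⟨h, b, c⟩

section absorb

variable {p q r s : ℝ} {A B : Set Space}

theorem row_zero_add_left (h0 : -6 ≤ p) (h : p ≤ q) :
    row p q r s (add (hTwist 0) A) B = row ((p + q) / 2) q r s A B := by
  rw [row, row, hBox_image_add, hBox_image_hTwist_zero (by linarith),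
    ← hLines_union h0 (by linarith : p ≤ (p + q) / 2)]
  ac_rfl

theorem row_add_zero_left (h : p ≤ q) (h0 : q ≤ r) :
    row p q r s (add A (hTwist 0)) B = row p ((p + q) / 2) r s A B := by
  rw [row, row, hBox_image_add, hBox_image_hTwist_zero (by linarith),
    ← hLines_union (by linarith : (p + q) / 2 ≤ q) h0]
  ac_rfl

theorem row_zero_add_right (h : r ≤ s) (h0 : q ≤ r) :
    row p q r s A (add (hTwist 0) B) = row p q ((r + s) / 2) s A B := by
  rw [row, row, hBox_image_add, hBox_image_hTwist_zero (by linarith),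
    ← hLines_union h0 (by linarith : r ≤ (r + s) / 2)]
  ac_rfl

theorem row_add_zero_right (h : r ≤ s) (h0 : s ≤ 6) :
    row p q r s A (add B (hTwist 0)) = row p q r ((r + s) / 2) A B := by
  rw [row, row, hBox_image_add, hBox_image_hTwist_zero (by linarith),
    ← hLines_union (by linarith : (r + s) / 2 ≤ s) h0]
  ac_rfl

end absorb

/-- The boxes of a row may be moved and stretched along the `x`-axis. -/
theorem ambientIsotopic_row_of_orderIso (f : ℝ ≃o ℝ) (hf : ∀ x, 6 ≤ |x| → f x = x)
    {p q r s : ℝ} {A B : Set Space} (hA : A ⊆ cube) (hB : B ⊆ cube)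
    (hpq : ∀ t ∈ Set.Icc (-1 : ℝ) 1,
      f ((p + q) / 2 + (q - p) / 2 * t) = (f p + f q) / 2 + (f q - f p) / 2 * t)
    (hrs : ∀ t ∈ Set.Icc (-1 : ℝ) 1,
      f ((r + s) / 2 + (s - r) / 2 * t) = (f r + f s) / 2 + (f s - f r) / 2 * t) :
    AmbientIsotopic (row p q r s A B) (row (f p) (f q) (f r) (f s) A B) := by
  have h6 : f 6 = 6 := hf 6 (by norm_num)
  have h6' : f (-6) = -6 := hf (-6) (by norm_num)
  have key : fiberX (fun _ => f) '' row p q r s A B = row (f p) (f q) (f r) (f s) A B := by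
    have hbox : ∀ {p q : ℝ} {A : Set Space}, A ⊆ cube → (∀ t ∈ Set.Icc (-1 : ℝ) 1,
        f ((p + q) / 2 + (q - p) / 2 * t) = (f p + f q) / 2 + (f q - f p) / 2 * t) →
        fiberX (fun _ => f) '' (hBox p q '' A) = hBox (f p) (f q) '' A := by
      intro p q A hA h
      rw [Set.image_image]
      refine Set.image_congr fun v hv => ?_
      simp only [fiberX, hBox, h v.1 (abs_le.1 (hA hv).1)]
    have hline : ∀ p q : ℝ, fiberX (fun _ => f) '' hLines p q = hLines (f p) (f q) := by
      intro p q
      ext v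
      constructor
      · rintro ⟨v, ⟨h1, h2, h3⟩, rfl⟩
        exact ⟨f.monotone h1, f.monotone h2, h3⟩
      · rintro ⟨h1, h2, h3⟩
        exact ⟨(f.symm v.1, v.2), ⟨f.le_symm_apply.2 h1, f.symm_apply_le.2 h2, h3⟩,
          by simp [fiberX]⟩
    have harcs : fiberX (fun _ => f) '' rowArcs = rowArcs := by
      have habs : ∀ x, |x| ≤ 6 ↔ |f x| ≤ 6 := by
        intro x
        rw [abs_le, abs_le, ← f.le_iff_le, h6', ← f.le_iff_le (x := x), h6]
      have habs' : ∀ x, |x| = 6 → |f x| = 6 := by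
        intro x hx
        rw [hf x hx.ge, hx]
      ext v
      constructor
      · rintro ⟨v, ⟨h1, ⟨h2, h3⟩ | ⟨h2, h3⟩⟩, rfl⟩
        · exact ⟨h1, Or.inl ⟨habs' _ h2, h3⟩⟩
        · exact ⟨h1, Or.inr ⟨(habs _).1 h2, h3⟩⟩
      · rintro ⟨h1, ⟨h2, h3⟩ | ⟨h2, h3⟩⟩
        · refine ⟨v, ⟨h1, Or.inl ⟨h2, h3⟩⟩, ?_⟩
          simp [fiberX, hf v.1 h2.ge]
        · exact ⟨(f.symm v.1, v.2), ⟨h1, Or.inr ⟨(habs _).2 (by simpa using h2), h3⟩⟩,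
            by simp [fiberX]⟩
    simp only [row, Set.image_union, hbox hA hpq, hbox hB hrs, hline, harcs, h6, h6']
  rw [← key]
  refine ambientIsotopic_fiberX _ (f.continuous.comp continuous_snd) (fun _ => f.strictMono)
    (fun _ => ⟨12, fun x => ?_⟩) _
  rcases le_total 6 |x| with h | h
  · simp [hf x h]
  · obtain ⟨h1, h2⟩ := abs_le.1 h
    have h1' := f.monotone h1
    have h2' := f.monotone h2
    rw [h6'] at h1'
    rw [h6] at h2'
    rw [abs_le]
    constructor <;> linarith

end Tangles

/-! ### Cancelling horizontal twists -/

namespace Tangles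

section moves

variable {p q r s : ℝ} {A B : Set Space}

theorem hatIso_of_outside {a b b' c : ℝ} (h1 : a < b) (h2 : b < c) (h1' : a < b') (h2' : b' < c)
    {R : ℝ} (ha : -R ≤ a) (hc : c ≤ R) (x : ℝ) (hx : R ≤ |x|) : hatIso h1 h2 h1' h2' x = x := by
  rw [hatIso_apply]
  rcases le_abs.1 hx with h | h
  · exact hatMap_of_ge h2 (hc.trans h)
  · exact hatMap_of_le h1 (by linarith)

theorem ambientIsotopic_row_hatIso {a b b' c : ℝ} (h1 : a < b) (h2 : b < c) (h1' : a < b')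
    (h2' : b' < c) (ha : -6 ≤ a) (hc : c ≤ 6) (hA : A ⊆ cube) (hB : B ⊆ cube)
    (hpq : p ≤ q) (hrs : r ≤ s)
    (hp : q ≤ a ∨ (a ≤ p ∧ q ≤ b) ∨ (b ≤ p ∧ q ≤ c) ∨ c ≤ p)
    (hr : s ≤ a ∨ (a ≤ r ∧ s ≤ b) ∨ (b ≤ r ∧ s ≤ c) ∨ c ≤ r) :
    AmbientIsotopic (row p q r s A B) (row (hatMap a b b' c p) (hatMap a b b' c q)
      (hatMap a b b' c r) (hatMap a b b' c s) A B) :=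
  ambientIsotopic_row_of_orderIso (hatIso h1 h2 h1' h2')
    (hatIso_of_outside h1 h2 h1' h2' ha hc) hA hB
    (fun _ ht => hatMap_affine h1 h2 hp hpq ht) (fun _ ht => hatMap_affine h1 h2 hr hrs ht)

theorem ambientIsotopic_row_fst (p' : ℝ) (hA : A ⊆ cube) (hB : B ⊆ cube) (h0 : -6 < p)
    (h1 : p < q) (h2 : q ≤ r) (h3 : r ≤ s) (h4 : s ≤ 6) (h0' : -6 < p') (h1' : p' < q) :
    AmbientIsotopic (row p q r s A B) (row p' q r s A B) := by
  have := ambientIsotopic_row_hatIso (b' := p') h0 h1 h0' h1' le_rfl (by linarith) hA hB h1.le h3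
    (by simp) (by simp [h2])
  rwa [hatMap_self h0 h1, hatMap_of_ge h1 le_rfl, hatMap_of_ge h1 h2,
    hatMap_of_ge h1 (h2.trans h3)] at this

theorem ambientIsotopic_row_snd (q' : ℝ) (hA : A ⊆ cube) (hB : B ⊆ cube) (h0 : -6 ≤ p)
    (h1 : p < q) (h2 : q < r) (h3 : r ≤ s) (h4 : s ≤ 6) (h1' : p < q') (h2' : q' < r) :
    AmbientIsotopic (row p q r s A B) (row p q' r s A B) := by
  have := ambientIsotopic_row_hatIso (b' := q') h1 h2 h1' h2' h0 (by linarith) hA hB h1.le h3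
    (by simp) (by simp)
  rwa [hatMap_self h1 h2, hatMap_of_le h1 le_rfl, hatMap_of_ge h2 le_rfl,
    hatMap_of_ge h2 h3] at this

theorem ambientIsotopic_row_thd (r' : ℝ) (hA : A ⊆ cube) (hB : B ⊆ cube) (h0 : -6 ≤ p)
    (h1 : p ≤ q) (h2 : q < r) (h3 : r < s) (h4 : s ≤ 6) (h2' : q < r') (h3' : r' < s) :
    AmbientIsotopic (row p q r s A B) (row p q r' s A B) := by
  have := ambientIsotopic_row_hatIso (b' := r') h2 h3 h2' h3' (by linarith) h4 hA hB h1 h3.le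
    (by simp) (by simp)
  rwa [hatMap_self h2 h3, hatMap_of_le h2 h1, hatMap_of_le h2 le_rfl,
    hatMap_of_ge h3 le_rfl] at this

theorem ambientIsotopic_row_fth (s' : ℝ) (hA : A ⊆ cube) (hB : B ⊆ cube) (h0 : -6 ≤ p)
    (h1 : p ≤ q) (h2 : q ≤ r) (h3 : r < s) (h4 : s < 6) (h3' : r < s') (h4' : s' < 6) :
    AmbientIsotopic (row p q r s A B) (row p q r s' A B) := by
  have := ambientIsotopic_row_hatIso (b' := s') h3 h4 h3' h4' (by linarith) le_rfl hA hB h1 h3.le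
    (by simp [h2]) (by simp)
  rwa [hatMap_self h3 h4, hatMap_of_le h3 (h1.trans h2), hatMap_of_le h3 h2,
    hatMap_of_le h3 le_rfl] at this

end moves

/-- The piecewise linear function that rises from `0` to `1` on the interval `[u, v]`. -/
noncomputable def ramp (u v x : ℝ) : ℝ := max 0 (min 1 ((x - u) / (v - u)))

section ramp

variable {u v : ℝ}

theorem continuous_ramp : Continuous (ramp u v) := by
  unfold ramp
  simp only [div_eq_mul_inv]
  fun_prop

theorem ramp_of_le (h : u < v) {x : ℝ} (hx : x ≤ u) : ramp u v x = 0 :=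
  max_eq_left ((min_le_right _ _).trans
    (div_nonpos_of_nonpos_of_nonneg (by linarith) (by linarith)))

theorem ramp_of_ge (h : u < v) {x : ℝ} (hx : v ≤ x) : ramp u v x = 1 := by
  have : 1 ≤ (x - u) / (v - u) := by rw [one_le_div (by linarith)]; linarith
  rw [ramp, min_eq_left this, max_eq_right zero_le_one]

theorem ramp_param (h : u < v) {t : ℝ} (ht : t ∈ Set.Icc (-1 : ℝ) 1) :
    ramp u v ((u + v) / 2 + (v - u) / 2 * t) = (t + 1) / 2 := by
  have h1 : ((u + v) / 2 + (v - u) / 2 * t - u) / (v - u) = (t + 1) / 2 := by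
    have : v - u ≠ 0 := by linarith
    field_simp; ring
  rw [ramp, h1, min_eq_right (by linarith [ht.2]), max_eq_right (by linarith [ht.1])]

end ramp

theorem mem_Icc_param {u v t : ℝ} (h : u ≤ v) (ht : t ∈ Set.Icc (-1 : ℝ) 1) :
    u ≤ (u + v) / 2 + (v - u) / 2 * t ∧ (u + v) / 2 + (v - u) / 2 * t ≤ v := by
  constructor <;> nlinarith [ht.1, ht.2]

theorem twistX_image_hLines {α : ℝ → ℝ} {p q : ℝ} (i : ℤ) (hpq : p ≤ q)
    (h : ∀ x, p ≤ x → x ≤ q → α x = i * Real.pi) : twistX α '' hLines p q = hLines p q := by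
  rw [← hBox_image_hTwist_zero hpq, twistX_image_hTwist 0 i i]
  · simp
  · intro t ht
    obtain ⟨h1, h2⟩ := mem_Icc_param hpq ht
    rw [h _ h1 h2]; ring

theorem twistX_image_box {α : ℝ → ℝ} {p q : ℝ} {X : Set Space} (hX : X ⊆ cube) (hpq : p ≤ q)
    (h : ∀ x, p ≤ x → x ≤ q → α x = 0) : twistX α '' (hBox p q '' X) = hBox p q '' X := by
  refine twistX_image_of_eq_zero ?_
  rintro _ ⟨v, hv, rfl⟩
  obtain ⟨h1, h2⟩ := mem_Icc_param hpq (abs_le.1 (hX hv).1)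
  exact h _ h1 h2

theorem twistX_image_rowArcs {α : ℝ → ℝ} (h6 : α 6 = 0) (h6' : α (-6) = 0) :
    twistX α '' rowArcs = rowArcs := by
  have : ∀ q ∈ rowArcs, twistX α q = q := by
    rintro q ⟨h1, ⟨h2, h3⟩ | ⟨h2, h3⟩⟩
    · rcases eq_or_eq_neg_of_abs_eq h2 with h | h
      · exact twistX_of_eq_zero (by rw [h, h6])
      · exact twistX_of_eq_zero (by rw [h, h6'])
    · refine twistX_of_far ?_
      rw [← sq_abs, h3, h1]; norm_num
  rw [Set.image_congr this]
  exact Set.image_id _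

/-- A row is twisted about the `x`-axis between the outer ends of its boxes, the part between the
boxes by a whole number of half turns. -/
theorem ambientIsotopic_row_twist {α : ℝ → ℝ} (hα : Continuous α) {p q r s : ℝ}
    {A B A' B' : Set Space} (i : ℤ) (hp6 : -6 ≤ p) (hs6 : s ≤ 6) (hqr : q ≤ r)
    (hp : ∀ x ≤ p, α x = 0) (hq : ∀ x, q ≤ x → x ≤ r → α x = i * Real.pi)
    (hs : ∀ x, s ≤ x → α x = 0) (hA : twistX α '' (hBox p q '' A) = hBox p q '' A')
    (hB : twistX α '' (hBox r s '' B) = hBox r s '' B') :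
    AmbientIsotopic (row p q r s A B) (row p q r s A' B') := by
  have key : twistX α '' row p q r s A B = row p q r s A' B' := by
    simp only [row, Set.image_union, hA, hB]
    rw [twistX_image_hLines i hqr hq,
      twistX_image_hLines 0 hp6 (fun x _ h => by simp [hp x h]),
      twistX_image_hLines 0 hs6 (fun x h _ => by simp [hs x h]),
      twistX_image_rowArcs (hs 6 hs6) (hp _ hp6)]
  rw [← key]
  exact ambientIsotopic_twistX hα _

/-- The angle of a twist that makes `a` half turns over `[u, v]` and takes them back over
`[u', v']`. -/
noncomputable def trapezoid (a : ℤ) (u v u' v' x : ℝ) : ℝ :=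
  a * Real.pi * (ramp u v x - ramp u' v' x)

section trapezoid

variable {a : ℤ} {u v u' v' : ℝ}

theorem continuous_trapezoid : Continuous (trapezoid a u v u' v') :=
  continuous_const.mul (continuous_ramp.sub continuous_ramp)

theorem trapezoid_of_le (h1 : u < v) (h2 : v ≤ u') (h3 : u' < v') {x : ℝ} (hx : x ≤ u) :
    trapezoid a u v u' v' x = 0 := by
  rw [trapezoid, ramp_of_le h1 hx, ramp_of_le h3 (by linarith)]; simp

theorem trapezoid_mid (h1 : u < v) (h3 : u' < v') {x : ℝ} (hx : v ≤ x) (hx' : x ≤ u') :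
    trapezoid a u v u' v' x = a * Real.pi := by
  rw [trapezoid, ramp_of_ge h1 hx, ramp_of_le h3 hx']; simp

theorem trapezoid_of_ge (h1 : u < v) (h2 : v ≤ u') (h3 : u' < v') {x : ℝ} (hx : v' ≤ x) :
    trapezoid a u v u' v' x = 0 := by
  rw [trapezoid, ramp_of_ge h3 hx, ramp_of_ge h1 (by linarith)]; simp

theorem trapezoid_up (h1 : u < v) (h2 : v ≤ u') (h3 : u' < v') {t : ℝ}
    (ht : t ∈ Set.Icc (-1 : ℝ) 1) : trapezoid a u v u' v' ((u + v) / 2 + (v - u) / 2 * t)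
      = Real.pi * (((0 : ℤ) : ℝ) + (a - ((0 : ℤ) : ℝ)) * ((t + 1) / 2)) := by
  rw [trapezoid, ramp_param h1 ht, ramp_of_le h3 ((mem_Icc_param h1.le ht).2.trans h2)]
  push_cast; ring

theorem trapezoid_down (h1 : u < v) (h2 : v ≤ u') (h3 : u' < v') {t : ℝ}
    (ht : t ∈ Set.Icc (-1 : ℝ) 1) : trapezoid a u v u' v' ((u' + v') / 2 + (v' - u') / 2 * t)
      = Real.pi * (a + (((0 : ℤ) : ℝ) - a) * ((t + 1) / 2)) := by
  rw [trapezoid, ramp_param h3 ht, ramp_of_ge h1 (h2.trans (mem_Icc_param h3.le ht).1)]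
  push_cast; ring

end trapezoid

section twists

variable {p q r s : ℝ} {X Y : Set Space}

/-- The twists `[a]` at the left of the first box and `[-a]` at the left of the second box
cancel each other, at the cost of `a` half turns of `X`. -/
theorem ambientIsotopic_row_flype (a : ℤ) (hX : X ⊆ cube) (hY : Y ⊆ cube) (hp6 : -6 ≤ p)
    (hpq : p < q) (hqr : q ≤ r) (hrs : r < s) (hs6 : s ≤ 6) :
    AmbientIsotopic (row p q r s (add (hTwist a) X) (add (hTwist (-a)) Y))
      (row ((p + q) / 2) q ((r + s) / 2) s (flip 1 (Real.cos (a * Real.pi)) '' X) Y) := by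
  have h1 : p < (p + q) / 2 := by linarith
  have h2 : (p + q) / 2 ≤ r := by linarith
  have h3 : r < (r + s) / 2 := by linarith
  rw [← row_zero_add_left hp6 hpq.le, ← row_zero_add_right hrs.le hqr]
  refine ambientIsotopic_row_twist (continuous_trapezoid (a := a) (u := p) (v := (p + q) / 2)
    (u' := r) (v' := (r + s) / 2)) a hp6 hs6 hqr (fun x hx => trapezoid_of_le h1 h2 h3 hx)
    (fun x hx hx' => trapezoid_mid h1 h3 (by linarith) hx')
    (fun x hx => trapezoid_of_ge h1 h2 h3 (by linarith)) ?_ ?_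
  · rw [hBox_image_add, hBox_image_add, Set.image_union,
      twistX_image_hTwist a 0 a (fun t ht => trapezoid_up h1 h2 h3 ht),
      twistX_image_cube a hX (fun t ht => ?_)]
    · simp
    · obtain ⟨h4, h5⟩ := mem_Icc_param (by linarith : (p + q) / 2 ≤ q) ht
      exact trapezoid_mid h1 h3 h4 (by linarith)
  · rw [hBox_image_add, hBox_image_add, Set.image_union,
      twistX_image_hTwist (-a) a 0 (fun t ht => trapezoid_down h1 h2 h3 ht),
      twistX_image_box (q := s) hY (by linarith)
        (fun x hx _ => trapezoid_of_ge h1 h2 h3 hx)]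
    simp

/-- The twists `[a]` and `[-a]` between two tangles cancel each other. -/
theorem ambientIsotopic_row_cancel (a : ℤ) (hX : X ⊆ cube) (hY : Y ⊆ cube) (hp6 : -6 ≤ p)
    (hpq : p < q) (hqr : q ≤ r) (hrs : r < s) (hs6 : s ≤ 6) :
    AmbientIsotopic (row p q r s (add X (hTwist a)) (add (hTwist (-a)) Y))
      (row p ((p + q) / 2) ((r + s) / 2) s X Y) := by
  have h1 : (p + q) / 2 < q := by linarith
  have h3 : r < (r + s) / 2 := by linarith
  rw [← row_add_zero_left hpq.le (by linarith), ← row_zero_add_right hrs.le hqr]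
  refine ambientIsotopic_row_twist (continuous_trapezoid (a := a) (u := (p + q) / 2) (v := q)
    (u' := r) (v' := (r + s) / 2)) a hp6 hs6 hqr
    (fun x hx => trapezoid_of_le h1 hqr h3 (by linarith))
    (fun x hx hx' => trapezoid_mid h1 h3 hx hx')
    (fun x hx => trapezoid_of_ge h1 hqr h3 (by linarith)) ?_ ?_
  · rw [hBox_image_add, hBox_image_add, Set.image_union,
      twistX_image_hTwist a 0 a (fun t ht => trapezoid_up h1 hqr h3 ht),
      twistX_image_box (p := p) hX (by linarith)
        (fun x _ hx => trapezoid_of_le h1 hqr h3 hx)]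
    simp
  · rw [hBox_image_add, hBox_image_add, Set.image_union,
      twistX_image_hTwist (-a) a 0 (fun t ht => trapezoid_down h1 hqr h3 ht),
      twistX_image_box (q := s) hY (by linarith)
        (fun x hx _ => trapezoid_of_ge h1 hqr h3 hx)]
    simp

/-- A horizontal twist is undone by half turns of the left strand of `[∞]`. -/
theorem ambientIsotopic_row_hTwist_vTwist_zero (a : ℤ) (hp6 : -6 ≤ p)
    (hpq : p < q) (hqr : q ≤ r) (hrs : r < s) (hs6 : s ≤ 6) :
    AmbientIsotopic (row p q r s (hTwist a) (vTwist 0)) (row p q r s (hTwist 0) (vTwist 0)) := by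
  refine ambientIsotopic_row_twist (continuous_trapezoid (a := a) (u := p) (v := q)
    (u' := r) (v' := s)) a hp6 hs6 hqr
    (fun x hx => trapezoid_of_le hpq hqr hrs hx)
    (fun x hx hx' => trapezoid_mid hpq hrs hx hx')
    (fun x hx => trapezoid_of_ge hpq hqr hrs hx) ?_ ?_
  · rw [twistX_image_hTwist a 0 a (fun t ht => trapezoid_up hpq hqr hrs ht)]
    simp
  · rw [Set.image_image]
    have hc := cos_int_mul_pi_eq a
    have hn : ∀ t ∈ Set.Icc (-1 : ℝ) 1, t ^ 2 ≤ 1 := fun t ht => by nlinarith [ht.1, ht.2]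
    have hv : ∀ t s, vPoint 0 t s = (s, t, 0) := fun t s => by simp [vPoint]
    have hl : ∀ t ∈ Set.Icc (-1 : ℝ) 1, twistX (trapezoid a p q r s) (hBox r s (-1, t, 0))
        = hBox r s (-1, Real.cos (a * Real.pi) * t, 0) := by
      intro t ht
      have hx : (r + s) / 2 + (s - r) / 2 * (-1) = r := by ring
      rw [twistX_of_near (by simp only [hBox]; linarith [hn t ht])]
      simp only [hBox, hx, trapezoid_mid hpq hrs hqr le_rfl, Real.sin_int_mul_pi]
      ext <;> simp [mul_comm]
    have hr : ∀ t, twistX (trapezoid a p q r s) (hBox r s (1, t, 0)) = hBox r s (1, t, 0) := by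
      intro t
      have hx : (r + s) / 2 + (s - r) / 2 * 1 = s := by ring
      refine twistX_of_eq_zero ?_
      simp only [hBox, hx, trapezoid_of_ge hpq hqr hrs le_rfl]
    have hI : ∀ t ∈ Set.Icc (-1 : ℝ) 1, Real.cos (a * Real.pi) * t ∈ Set.Icc (-1 : ℝ) 1 := by
      intro t ht
      rcases hc with h | h <;> rw [h] <;> constructor <;> linarith [ht.1, ht.2]
    ext v
    simp only [Set.mem_image, mem_vTwist]
    constructor
    · rintro ⟨_, ⟨t, ht, s, rfl | rfl, rfl⟩, rfl⟩
      · exact ⟨_, ⟨t, ht, 1, Or.inl rfl, rfl⟩, by rw [hv, hr]⟩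
      · exact ⟨_, ⟨_, hI t ht, -1, Or.inr rfl, rfl⟩, by rw [hv, hv, hl t ht]⟩
    · rintro ⟨_, ⟨t, ht, s, rfl | rfl, rfl⟩, rfl⟩
      · exact ⟨_, ⟨t, ht, 1, Or.inl rfl, rfl⟩, by rw [hv, hr]⟩
      · exact ⟨_, ⟨_, hI t ht, -1, Or.inr rfl, rfl⟩,
          by rw [hv, hv, hl _ (hI t ht), sign_mul_cancel hc]⟩

end twists

/-- The numerator closure of the tangles `A` and `B` in a row, in standard position. -/
noncomputable def closure₂ (A B : Set Space) : Set Space := row (-4) (-2) 2 4 A B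

section standardRow

variable {X Y A B : Set Space}

theorem flip_image_subset {e h : ℝ} (he : e = 1 ∨ e = -1) (hh : h = 1 ∨ h = -1)
    (hX : X ⊆ cube) : flip e h '' X ⊆ cube := by
  rintro _ ⟨v, hv, rfl⟩
  obtain ⟨h1, h2, h3⟩ := hX hv
  rcases he with rfl | rfl <;> rcases hh with rfl | rfl <;>
    simp [cube, flip, abs_neg, h1, h2, h3]

theorem isUnknot_closure₂_flype (a : ℤ) (hX : X ⊆ cube) (hY : Y ⊆ cube)
    (h : IsUnknot (closure₂ (flip 1 (Real.cos (a * Real.pi)) '' X) Y)) :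
    IsUnknot (closure₂ (add (hTwist a) X) (add (hTwist (-a)) Y)) := by
  have hX' := flip_image_subset (Or.inl rfl) (cos_int_mul_pi_eq a) hX
  refine h.of_ambientIsotopic ((ambientIsotopic_row_flype a hX hY (by norm_num) (by norm_num)
    (by norm_num) (by norm_num) (by norm_num)).trans ((ambientIsotopic_row_fst (-4) hX' hY
    ?_ ?_ ?_ ?_ ?_ ?_ ?_).trans (ambientIsotopic_row_thd 2 hX' hY ?_ ?_ ?_ ?_ ?_ ?_ ?_)))
  all_goals norm_num

theorem isUnknot_closure₂_cancel (a : ℤ) (hX : X ⊆ cube) (hY : Y ⊆ cube)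
    (h : IsUnknot (closure₂ X Y)) :
    IsUnknot (closure₂ (add X (hTwist a)) (add (hTwist (-a)) Y)) := by
  refine h.of_ambientIsotopic ((ambientIsotopic_row_cancel a hX hY (by norm_num) (by norm_num)
    (by norm_num) (by norm_num) (by norm_num)).trans ((ambientIsotopic_row_snd (-2) hX hY
    ?_ ?_ ?_ ?_ ?_ ?_ ?_).trans (ambientIsotopic_row_thd 2 hX hY ?_ ?_ ?_ ?_ ?_ ?_ ?_)))
  all_goals norm_num

theorem isUnknot_closure₂_of_add_zero (hA : A ⊆ cube) (hB : B ⊆ cube)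
    (h : IsUnknot (closure₂ A (add B (hTwist 0)))) : IsUnknot (closure₂ A B) := by
  rw [closure₂, row_add_zero_right (by norm_num) (by norm_num)] at h
  refine h.of_ambientIsotopic (ambientIsotopic_row_fth _ hA hB ?_ ?_ ?_ ?_ ?_ ?_ ?_)
  all_goals norm_num

theorem isUnknot_closure₂_hTwist_vTwist_zero (a : ℤ)
    (h : IsUnknot (closure₂ (hTwist 0) (vTwist 0))) :
    IsUnknot (closure₂ (hTwist a) (vTwist 0)) := by
  refine h.of_ambientIsotopic (ambientIsotopic_row_hTwist_vTwist_zero a ?_ ?_ ?_ ?_ ?_)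
  all_goals norm_num

end standardRow

/-- Space is stretched along the `x`-axis by the factor `a` and along the `y`-axis by `b`. -/
def stretch (a b : ℝ) (q : Space) : Space := (a * q.1, b * q.2.1, q.2.2)

theorem ambientIsotopic_stretch {a b : ℝ} (ha : 0 < a) (hb : 0 < b) (K : Set Space) :
    AmbientIsotopic K (stretch a b '' K) := by
  have := ambientIsotopic_of_flow (fun t => stretch (Real.exp (t * Real.log a))
    (Real.exp (t * Real.log b))) (by unfold stretch; fun_prop) (by simp [stretch])
    (fun t x => ?_) K
  · simpa only [one_mul, Real.exp_log ha, Real.exp_log hb] using this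
  · simp only [stretch, ← mul_assoc, ← Real.exp_add]
    simp

/-- The condition on `B` says that its left endpoints are `NW` and `SW`. -/
theorem stretch_image_numerator (T : Set Space) {B : Set Space}
    (hB : ∀ y : ℝ, |y| = 1 → ((-1, y, 0) : Space) ∈ B) :
    stretch 3 1 '' numerator (add T B) = row (-3) 0 0 3 T B := by
  have h1 : stretch 3 1 '' add T B = hBox (-3) 0 '' T ∪ hBox 0 3 '' B := by
    simp only [add, Set.image_union, Set.image_image]
    congr 1 <;> refine Set.image_congr fun v _ => ?_ <;> simp only [hBox, stretch] <;> ext <;>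
      simp <;> ring
  have h2 : stretch 3 1 '' closingArcs = hLines (-6) (-3) ∪ hLines 3 6 ∪ rowArcs := by
    ext v
    obtain ⟨x, y, z⟩ := v
    simp only [Set.mem_image, closingArcs, hLines, rowArcs, Set.mem_union, Set.mem_ofPred_eq]
    constructor
    · rintro ⟨⟨x', y', z'⟩, ⟨h1, h2⟩, h3⟩
      simp only [stretch, one_mul, Prod.mk.injEq] at h1 h2 h3
      obtain ⟨rfl, rfl, rfl⟩ := h3
      have habs : |3 * x'| = 3 * |x'| := by rw [abs_mul, abs_of_pos (by norm_num : (0 : ℝ) < 3)]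
      simp only [habs]
      rcases h2 with ⟨h2, h3, h4⟩ | ⟨h2, h3⟩ | ⟨h2, h3⟩
      · rcases le_total 0 x' with h | h
        · rw [abs_of_nonneg h] at h2 h3
          exact Or.inl (Or.inr ⟨by linarith, by linarith, h4, h1⟩)
        · rw [abs_of_nonpos h] at h2 h3
          exact Or.inl (Or.inl ⟨by linarith, by linarith, h4, h1⟩)
      · exact Or.inr ⟨h1, Or.inl ⟨by linarith, h3⟩⟩
      · exact Or.inr ⟨h1, Or.inr ⟨by linarith, h3⟩⟩
    · intro h
      have habs : |x / 3| = |x| / 3 := by rw [abs_div, abs_of_pos (by norm_num : (0 : ℝ) < 3)]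
      refine ⟨(x / 3, y, z), ?_, by simp only [stretch]; ext <;> simp; ring⟩
      simp only [habs]
      rcases h with (⟨h1, h2, h3, h4⟩ | ⟨h1, h2, h3, h4⟩) | ⟨h1, ⟨h2, h3⟩ | ⟨h2, h3⟩⟩
      · rw [abs_of_nonpos (by linarith)]
        exact ⟨h4, Or.inl ⟨by linarith, by linarith, h3⟩⟩
      · rw [abs_of_nonneg (by linarith)]
        exact ⟨h4, Or.inl ⟨by linarith, by linarith, h3⟩⟩
      · exact ⟨h1, Or.inr (Or.inl ⟨by linarith, h3⟩)⟩
      · exact ⟨h1, Or.inr (Or.inr ⟨by linarith, h3⟩)⟩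
  have h3 : hLines 0 0 ⊆ hBox 0 3 '' B := by
    rintro ⟨x, y, z⟩ ⟨h1, h2, h3, h4⟩
    refine ⟨(-1, y, 0), hB y h3, ?_⟩
    have : x = 0 := le_antisymm h2 h1
    simp only at h4
    simp [hBox, this, h4]
  rw [numerator, Set.image_union, h1, h2, row]
  ext v
  have := @h3 v
  simp only [Set.mem_union]
  tauto

theorem mem_hTwist_left (n : ℤ) (y : ℝ) (h : |y| = 1) : ((-1, y, 0) : Space) ∈ hTwist n :=
  ⟨-1, ⟨le_rfl, by norm_num⟩, y, eq_or_eq_neg_of_abs_eq h, by simp⟩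

theorem mem_add_left {T S : Set Space} {y : ℝ} (h : ((-1, y, 0) : Space) ∈ T) :
    ((-1, y, 0) : Space) ∈ add T S :=
  Or.inl ⟨_, h, by norm_num⟩

theorem isUnknot_numerator_flype (a : ℤ) {X Y : Set Space} (hX : X ⊆ cube) (hY : Y ⊆ cube)
    (h : IsUnknot (closure₂ (flip 1 (Real.cos (a * Real.pi)) '' X) Y)) :
    IsUnknot (numerator (add (add (hTwist a) X) (add (hTwist (-a)) Y))) := by
  have hX' := flip_image_subset (Or.inl rfl) (cos_int_mul_pi_eq a) hX
  refine IsUnknot.of_ambientIsotopic ?_ (ambientIsotopic_stretch three_pos one_pos _)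
  rw [stretch_image_numerator _ fun y hy => mem_add_left (mem_hTwist_left _ y hy)]
  refine h.of_ambientIsotopic ((ambientIsotopic_row_flype a hX hY ?_ ?_ ?_ ?_ ?_).trans
    ((ambientIsotopic_row_snd (-1) hX' hY ?_ ?_ ?_ ?_ ?_ ?_ ?_).trans
    ((ambientIsotopic_row_fst (-4) hX' hY ?_ ?_ ?_ ?_ ?_ ?_ ?_).trans
    ((ambientIsotopic_row_snd (-2) hX' hY ?_ ?_ ?_ ?_ ?_ ?_ ?_).trans
    ((ambientIsotopic_row_thd 2 hX' hY ?_ ?_ ?_ ?_ ?_ ?_ ?_).trans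
    (ambientIsotopic_row_fth 4 hX' hY ?_ ?_ ?_ ?_ ?_ ?_ ?_))))))
  all_goals norm_num

theorem isUnknot_numerator_of_add_zero {T : Set Space} (a : ℤ) (hT : T ⊆ cube)
    (ha : hTwist a ⊆ cube) (h : IsUnknot (numerator (add T (add (hTwist a) (hTwist 0))))) :
    IsUnknot (numerator (add T (hTwist a))) := by
  refine IsUnknot.of_ambientIsotopic ?_ (ambientIsotopic_stretch three_pos one_pos _)
  replace h := h.of_ambientIsotopic (ambientIsotopic_stretch three_pos one_pos _).symm
  rw [stretch_image_numerator _ fun y hy => mem_add_left (mem_hTwist_left _ y hy),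
    row_add_zero_right (by norm_num) (by norm_num)] at h
  rw [stretch_image_numerator _ (mem_hTwist_left a)]
  refine h.of_ambientIsotopic (ambientIsotopic_row_fth _ hT ha ?_ ?_ ?_ ?_ ?_ ?_ ?_)
  all_goals norm_num

end Tangles

/-! ### Twisting a tube along a bend -/

namespace Tangles

/-- The cube is placed over the interval `[u, v]` of the line `x = c`, `z = 0`. -/
noncomputable def vBox (c u v : ℝ) (w : Space) : Space :=
  (c + w.1, (u + v) / 2 + (v - u) / 2 * w.2.1, w.2.2)

/-- The depth of a point below the line `y = -2`. -/
def depth (y : ℝ) : ℝ := max 0 (-2 - y)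

/-- The radial coordinate of the lower bend: its level sets in the plane are pairs of vertical
half-lines, joined by a `V` below the line `y = -2`. -/
def bendRadius (x y : ℝ) : ℝ := |x| + 2 * depth y

/-- The angle that is `βA y` to the left and `βB y` to the right of the `y`-axis. -/
noncomputable def sideAngle (βA βB : ℝ → ℝ) (x y : ℝ) : ℝ :=
  βA y * (1 - ramp (-1) 1 x) + βB y * ramp (-1) 1 x

/-- A tube around the core curve `bendRadius = 3` of the lower bend, which consists of two vertical
half-lines and a `V` that joins them, is turned about its core by the angle `βA y` on the left
and `βB y` on the right, tapered off by the cutoff function.  In the plane a point moves parallel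
to the `x`-axis if it lies above the line `y = -2`, and along the ray from `(0, -2)` if it lies
below. -/
noncomputable def twistBend (βA βB : ℝ → ℝ) (q : Space) : Space :=
  let r := bendRadius q.1 q.2.1
  let θ := sideAngle βA βB q.1 q.2.1 * cutoff (r - 3) q.2.2
  let r' := 3 + ((r - 3) * Real.cos θ - q.2.2 * Real.sin θ)
  let k := 1 + (r' - r) / max r 1
  (k * q.1, q.2.1 + (1 - k) * depth q.2.1, (r - 3) * Real.sin θ + q.2.2 * Real.cos θ)

theorem depth_of_ge {y : ℝ} (h : -2 ≤ y) : depth y = 0 := max_eq_left (by linarith)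

theorem depth_of_le {y : ℝ} (h : y ≤ -2) : depth y = -2 - y := max_eq_right (by linarith)

theorem depth_scale {y k : ℝ} (hk : 0 < k) : depth (y + (1 - k) * depth y) = k * depth y := by
  rcases le_total (-2) y with h | h
  · rw [depth_of_ge h]; simp [depth_of_ge h]
  · rw [depth_of_le h, depth_of_le (by nlinarith)]; ring

theorem twistBend_of_angle_eq_zero {βA βB : ℝ → ℝ} {q : Space}
    (h : sideAngle βA βB q.1 q.2.1 * cutoff (bendRadius q.1 q.2.1 - 3) q.2.2 = 0) :
    twistBend βA βB q = q := by
  simp [twistBend, h]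

theorem abs_lt_two_of_cutoff_ne_zero {y z : ℝ} (h : cutoff y z ≠ 0) : -2 < y ∧ y < 2 := by
  rw [← abs_lt]
  by_contra h'
  refine h (cutoff_eq_zero ?_)
  have : (2 : ℝ) ^ 2 ≤ |y| ^ 2 := by gcongr; exact not_lt.1 h'
  rw [sq_abs] at this
  nlinarith [sq_nonneg z]

/-- The angle does not change when a point moves along its ray. -/
theorem sideAngle_scale {βA βB : ℝ → ℝ} {b : ℝ} (hA : ∀ y ≤ -2, βA y = b)
    (hB : ∀ y ≤ -2, βB y = b) {x y k : ℝ} (hk : 0 < k) (h1 : 1 < bendRadius x y)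
    (h2 : 1 < k * bendRadius x y) :
    sideAngle βA βB (k * x) (y + (1 - k) * depth y) = sideAngle βA βB x y := by
  have h11 : (-1 : ℝ) < 1 := by norm_num
  rcases le_total (-2) y with h | h
  · simp only [bendRadius, depth_of_ge h, mul_zero, add_zero] at *
    rcases le_total 0 x with hx | hx
    · rw [abs_of_nonneg hx] at h1 h2
      rw [sideAngle, sideAngle, ramp_of_ge h11 h1.le, ramp_of_ge h11 h2.le]
    · rw [abs_of_nonpos hx] at h1 h2
      rw [sideAngle, sideAngle, ramp_of_le h11 (by linarith), ramp_of_le h11 (by linarith)]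
  · have h3 : y + (1 - k) * depth y ≤ -2 := by rw [depth_of_le h]; nlinarith
    rw [sideAngle, sideAngle, hA _ h, hB _ h, hA _ h3, hB _ h3]; ring

theorem twistBend_neg {βA βB : ℝ → ℝ} {b : ℝ} (hA : ∀ y ≤ -2, βA y = b)
    (hB : ∀ y ≤ -2, βB y = b) (q : Space) :
    twistBend (fun y => -βA y) (fun y => -βB y) (twistBend βA βB q) = q := by
  have hneg : ∀ x y, sideAngle (fun y => -βA y) (fun y => -βB y) x y = -sideAngle βA βB x y := by
    intro x y; simp only [sideAngle]; ring
  by_cases hc : cutoff (bendRadius q.1 q.2.1 - 3) q.2.2 = 0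
  · have h : twistBend βA βB q = q := twistBend_of_angle_eq_zero (by rw [hc, mul_zero])
    rw [h, twistBend_of_angle_eq_zero (by rw [hc, mul_zero])]
  obtain ⟨x, y, z⟩ := q
  simp only at hc
  set r := bendRadius x y with hr
  set θ := sideAngle βA βB x y * cutoff (r - 3) z with hθ
  set r' := 3 + ((r - 3) * Real.cos θ - z * Real.sin θ) with hr'
  set z' := (r - 3) * Real.sin θ + z * Real.cos θ with hz'
  have hr1 : 1 < r := by linarith [(abs_lt_two_of_cutoff_ne_zero hc).1]
  have hcut : cutoff (r' - 3) z' = cutoff (r - 3) z := by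
    rw [← cutoff_rotate (r - 3) z θ]; congr 1; rw [hr']; ring
  have hr1' : 1 < r' := by
    rw [← hcut] at hc
    linarith [(abs_lt_two_of_cutoff_ne_zero hc).1]
  have hr0 : 0 < r := by linarith
  have hr0' : 0 < r' := by linarith
  set k := r' / r with hk
  have hk0 : 0 < k := div_pos hr0' hr0
  have hkr : k * r = r' := by rw [hk]; field_simp
  have h1 : twistBend βA βB (x, y, z) = (k * x, y + (1 - k) * depth y, z') := by
    have : 1 + (r' - r) / max r 1 = k := by
      rw [max_eq_left hr1.le, hk]; field_simp; ring
    simp only [twistBend, ← hr, ← hθ, ← hr', this, ← hz']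
  have h2 : bendRadius (k * x) (y + (1 - k) * depth y) = r' := by
    rw [bendRadius, depth_scale hk0, abs_mul, abs_of_pos hk0, ← hkr, hr, bendRadius]; ring
  have h3 : sideAngle βA βB (k * x) (y + (1 - k) * depth y) = sideAngle βA βB x y :=
    sideAngle_scale hA hB hk0 hr1 (by rw [← hr, hkr]; exact hr1')
  have h4 : (3 : ℝ) + ((r' - 3) * Real.cos (-θ) - z' * Real.sin (-θ)) = r := by
    have := rotate_neg_fst (r - 3) z θ
    rw [hr', hz']
    linarith
  have h5 : (r' - 3) * Real.sin (-θ) + z' * Real.cos (-θ) = z := by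
    have := rotate_neg_snd (r - 3) z θ
    rw [hr', hz']
    linarith
  have h6 : 1 + (r - r') / max r' 1 = 1 / k := by
    rw [max_eq_left hr1'.le, hk]; field_simp; ring
  rw [h1]
  simp only [twistBend, h2, hneg, h3, hcut, neg_mul, ← hθ, h4, h5, h6, depth_scale hk0]
  ext
  · simp only; field_simp
  · simp only; field_simp; ring
  · rfl

theorem ambientIsotopic_twistBend {βA βB : ℝ → ℝ} (hcA : Continuous βA) (hcB : Continuous βB)
    {b : ℝ} (hA : ∀ y ≤ -2, βA y = b) (hB : ∀ y ≤ -2, βB y = b) (K : Set Space) :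
    AmbientIsotopic K (twistBend βA βB '' K) := by
  have := ambientIsotopic_of_flow
    (fun t => twistBend (fun y => t * βA y) (fun y => t * βB y)) ?_ ?_ ?_ K
  · simpa using this
  · have hd : Continuous depth := by unfold depth; fun_prop
    have hr : Continuous fun q : ℝ × Space => bendRadius q.2.1 q.2.2.1 := by
      unfold bendRadius; fun_prop
    have h1 : Continuous fun q : ℝ × Space =>
        cutoff (bendRadius q.2.1 q.2.2.1 - 3) q.2.2.2 :=
      continuous_cutoff.comp
        (f := fun q : ℝ × Space => (bendRadius q.2.1 q.2.2.1 - 3, q.2.2.2)) (by fun_prop)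
    have h2 : Continuous (ramp (-1) 1) := continuous_ramp
    simp only [twistBend, sideAngle]
    have h3 : ∀ q : ℝ × Space, max (bendRadius q.2.1 q.2.2.1) 1 ≠ 0 := fun q =>
      (lt_of_lt_of_le one_pos (le_max_right _ _)).ne'
    fun_prop (disch := assumption)
  · intro q
    exact twistBend_of_angle_eq_zero (by simp [sideAngle])
  · intro t q
    simp only [neg_mul]
    exact twistBend_neg (b := t * b) (fun y hy => by rw [hA y hy]) (fun y hy => by rw [hB y hy]) q

/-- To the left of the `y`-axis the tube is a vertical cylinder, which is turned clockwise as seen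
in the `(x, z)`-plane. -/
theorem twistBend_left {βA βB : ℝ → ℝ} {w y z : ℝ} (hy : -2 ≤ y) (h : w ^ 2 + z ^ 2 ≤ 2)
    (hw : |w| ≤ 1) :
    twistBend βA βB (-3 + w, y, z) = (-3 + (w * Real.cos (-βA y) - z * Real.sin (-βA y)), y,
      w * Real.sin (-βA y) + z * Real.cos (-βA y)) := by
  obtain ⟨h1, h2⟩ := abs_le.1 hw
  have hr : bendRadius (-3 + w) y = 3 - w := by
    rw [bendRadius, depth_of_ge hy, abs_of_nonpos (by linarith)]; ring
  have hs : sideAngle βA βB (-3 + w) y = βA y := by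
    rw [sideAngle, ramp_of_le (by norm_num) (by linarith)]; ring
  have hc : cutoff (3 - w - 3) z = 1 := cutoff_eq_one (by nlinarith)
  simp only [twistBend, hr, hs, hc, mul_one, depth_of_ge hy, mul_zero, add_zero,
    max_eq_left (by linarith : (1 : ℝ) ≤ 3 - w), Real.cos_neg, Real.sin_neg]
  have h3 : 3 - w ≠ 0 := by linarith
  ext
  · simp only; field_simp; ring
  · rfl
  · simp only; ring

theorem twistBend_right {βA βB : ℝ → ℝ} {w y z : ℝ} (hy : -2 ≤ y) (h : w ^ 2 + z ^ 2 ≤ 2)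
    (hw : |w| ≤ 1) :
    twistBend βA βB (3 + w, y, z) = (3 + (w * Real.cos (βB y) - z * Real.sin (βB y)), y,
      w * Real.sin (βB y) + z * Real.cos (βB y)) := by
  obtain ⟨h1, h2⟩ := abs_le.1 hw
  have hr : bendRadius (3 + w) y = 3 + w := by
    rw [bendRadius, depth_of_ge hy, abs_of_nonneg (by linarith)]; ring
  have hs : sideAngle βA βB (3 + w) y = βB y := by
    rw [sideAngle, ramp_of_ge (by norm_num) (by linarith)]; ring
  have hc : cutoff (3 + w - 3) z = 1 := cutoff_eq_one (by nlinarith)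
  simp only [twistBend, hr, hs, hc, mul_one, depth_of_ge hy, mul_zero, add_zero,
    max_eq_left (by linarith : (1 : ℝ) ≤ 3 + w)]
  have h3 : 3 + w ≠ 0 := by linarith
  ext
  · simp only; field_simp; ring
  · rfl
  · simp only; ring

end Tangles

/-! ### Two tangles with vertical ends -/

namespace Tangles

/-- The vertical lines `x = c ± 1` over the interval `[u, v]`. -/
def vLines (c u v : ℝ) : Set Space := {p | u ≤ p.2.1 ∧ p.2.1 ≤ v ∧ |p.1 - c| = 1 ∧ p.2.2 = 0}

/-- Two concentric `V`s below the line `y = -2` and their mirror images above `y = 2`. -/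
def bendArcs : Set Space :=
  {p | p.2.2 = 0 ∧ 2 ≤ |p.2.1| ∧
    (|p.1| + 2 * (|p.2.1| - 2) = 2 ∨ |p.1| + 2 * (|p.2.1| - 2) = 4)}

/-- The numerator closure of two tangles in a row, drawn in such a way that all strands leave the
boxes in the vertical direction.  The tangles are drawn over the intervals `[u, v]` and
`[u', v']` of the lines `x = -3` and `x = 3`. -/
noncomputable def bendRow (u v u' v' : ℝ) (A B : Set Space) : Set Space :=
  vBox (-3) u v '' A ∪ vBox 3 u' v' '' B ∪ (vLines (-3) (-2) u ∪ vLines (-3) v 2 ∪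
    vLines 3 (-2) u' ∪ vLines 3 v' 2 ∪ bendArcs)

theorem vBox_image_vTwist_zero {c u v : ℝ} (h : u ≤ v) : vBox c u v '' vTwist 0 = vLines c u v := by
  ext p
  simp only [Set.mem_image, mem_vTwist]
  constructor
  · rintro ⟨_, ⟨t, ht, s, hs, rfl⟩, rfl⟩
    obtain ⟨h1, h2⟩ := mem_Icc_param h ht
    refine ⟨h1, h2, ?_, ?_⟩
    · rcases hs with rfl | rfl <;> simp [vBox, vPoint]
    · simp [vBox, vPoint]
  · rintro ⟨h1, h2, h3, h4⟩
    refine ⟨vPoint 0 ((2 * p.2.1 - u - v) / (v - u)) (p.1 - c), ⟨_, ⟨?_, ?_⟩, p.1 - c,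
      eq_or_eq_neg_of_abs_eq h3, rfl⟩, ?_⟩
    · rcases h.eq_or_lt with h | h
      · simp [h]
      · rw [le_div_iff₀ (by linarith)]; linarith
    · rcases h.eq_or_lt with h | h
      · simp [h]
      · rw [div_le_iff₀ (by linarith)]; linarith
    · ext
      · simp [vBox, vPoint]
      · rcases h.eq_or_lt with h | h
        · subst h; simp [vBox]; linarith
        · have : v - u ≠ 0 := by linarith
          simp only [vBox, vPoint]; field_simp; ring
      · simp [vBox, vPoint, h4]

theorem vBox_image_star (c u v : ℝ) (T S : Set Space) :
    vBox c u v '' star T S = vBox c ((u + v) / 2) v '' T ∪ vBox c u ((u + v) / 2) '' S := by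
  rw [star, Set.image_union, Set.image_image, Set.image_image]
  congr 1 <;> refine Set.image_congr fun v _ => ?_ <;> simp only [vBox] <;> ext <;> simp <;> ring

theorem vLines_union {c p q r : ℝ} (h1 : p ≤ q) (h2 : q ≤ r) :
    vLines c p q ∪ vLines c q r = vLines c p r := by
  ext v
  simp only [vLines, Set.mem_union, Set.mem_ofPred_eq]
  constructor
  · rintro (⟨a, b, c⟩ | ⟨a, b, c⟩)
    · exact ⟨a, b.trans h2, c⟩
    · exact ⟨h1.trans a, b, c⟩
  · rintro ⟨a, b, c⟩
    rcases le_total v.2.1 q with h | h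
    · exact Or.inl ⟨a, h, c⟩
    · exact Or.inr ⟨h, b, c⟩

section absorb

variable {u v u' v' : ℝ} {A B : Set Space}

theorem bendRow_star_left (h0 : -2 ≤ u) (h : u ≤ v) :
    bendRow u v u' v' (star A (vTwist 0)) B = bendRow ((u + v) / 2) v u' v' A B := by
  rw [bendRow, bendRow, vBox_image_star, vBox_image_vTwist_zero (by linarith),
    ← vLines_union h0 (by linarith : u ≤ (u + v) / 2)]
  ac_rfl

theorem bendRow_star_left' (h : u ≤ v) (h0 : v ≤ 2) :
    bendRow u v u' v' (star (vTwist 0) A) B = bendRow u ((u + v) / 2) u' v' A B := by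
  rw [bendRow, bendRow, vBox_image_star, vBox_image_vTwist_zero (by linarith),
    ← vLines_union (by linarith : (u + v) / 2 ≤ v) h0]
  ac_rfl

theorem bendRow_star_right (h0 : -2 ≤ u') (h : u' ≤ v') :
    bendRow u v u' v' A (star B (vTwist 0)) = bendRow u v ((u' + v') / 2) v' A B := by
  rw [bendRow, bendRow, vBox_image_star, vBox_image_vTwist_zero (by linarith),
    ← vLines_union h0 (by linarith : u' ≤ (u' + v') / 2)]
  ac_rfl

theorem bendRow_star_right' (h : u' ≤ v') (h0 : v' ≤ 2) :
    bendRow u v u' v' A (star (vTwist 0) B) = bendRow u v u' ((u' + v') / 2) A B := by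
  rw [bendRow, bendRow, vBox_image_star, vBox_image_vTwist_zero (by linarith),
    ← vLines_union (by linarith : (u' + v') / 2 ≤ v') h0]
  ac_rfl

end absorb

/-- Above the line `y = -2` the map `F` turns the cylinder of radius `√2` around the line `x = c`,
`z = 0` about its axis, by the angle `γ y` at height `y`. -/
def TurnsCylinder (F : Space → Space) (c : ℝ) (γ : ℝ → ℝ) : Prop :=
  ∀ w y z : ℝ, -2 ≤ y → w ^ 2 + z ^ 2 ≤ 2 → |w| ≤ 1 → F (c + w, y, z)
    = (c + (w * Real.cos (γ y) - z * Real.sin (γ y)), y, w * Real.sin (γ y) + z * Real.cos (γ y))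

theorem turnsCylinder_left (βA βB : ℝ → ℝ) :
    TurnsCylinder (twistBend βA βB) (-3) (fun y => -βA y) :=
  fun _ _ _ hy h hw => twistBend_left hy h hw

theorem turnsCylinder_right (βA βB : ℝ → ℝ) : TurnsCylinder (twistBend βA βB) 3 βB :=
  fun _ _ _ hy h hw => twistBend_right hy h hw

section turns

variable {F : Space → Space} {c : ℝ} {γ : ℝ → ℝ} {u v : ℝ}

theorem TurnsCylinder.image_vTwist (hF : TurnsCylinder F c γ) (hu : -2 ≤ u) (huv : u ≤ v)
    (n i j : ℤ)
    (h : ∀ t ∈ Set.Icc (-1 : ℝ) 1,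
      γ ((u + v) / 2 + (v - u) / 2 * t) = Real.pi * (i + (j - i) * ((t + 1) / 2))) :
    F '' (vBox c u v '' vTwist n) = vBox c u v '' vTwist (n - j + i) := by
  rw [Set.image_image]
  refine image_vTwist_congr (cos_int_mul_pi_eq i) fun t ht s hs => ?_
  have hsq := sq_add_sq_strand s (n * Real.pi * (t + 1) / 2) hs
  simp only [vBox, vPoint]
  rw [hF _ _ _ (hu.trans (mem_Icc_param huv ht).1) (by rw [hsq]; norm_num)]
  · simp only [h t ht, cos_twist, sin_twist]
  · rw [abs_le_one_iff_mul_self_le_one]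
    nlinarith [sq_nonneg (s * Real.sin (n * Real.pi * (t + 1) / 2))]

theorem TurnsCylinder.image_cube (hF : TurnsCylinder F c γ) (hu : -2 ≤ u) (huv : u ≤ v)
    (i : ℤ) {X : Set Space} (hX : X ⊆ cube) (h : ∀ y, u ≤ y → y ≤ v → γ y = i * Real.pi) :
    F '' (vBox c u v '' X) = vBox c u v '' (flip (Real.cos (i * Real.pi)) 1 '' X) := by
  rw [Set.image_image, Set.image_image]
  refine Set.image_congr fun p hp => ?_
  obtain ⟨h1, h2, h3⟩ := hX hp
  obtain ⟨h4, h5⟩ := mem_Icc_param huv (abs_le.1 h2)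
  have := sq_le_one_of_abs_le h1
  have := sq_le_one_of_abs_le h3
  simp only [vBox]
  rw [hF _ _ _ (hu.trans h4) (by linarith) h1]
  simp only [flip, h _ h4 h5, Real.sin_int_mul_pi]
  ext <;> simp [mul_comm]

theorem TurnsCylinder.image_cube_of_eq_zero (hF : TurnsCylinder F c γ) (hu : -2 ≤ u)
    (huv : u ≤ v) {X : Set Space} (hX : X ⊆ cube) (h : ∀ y, u ≤ y → y ≤ v → γ y = 0) :
    F '' (vBox c u v '' X) = vBox c u v '' X := by
  rw [hF.image_cube hu huv 0 hX (by simpa using h)]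
  have : flip (Real.cos ((0 : ℤ) * Real.pi)) 1 = id := by
    funext p; simp [flip]
  rw [this, Set.image_id]

theorem TurnsCylinder.image_vLines (hF : TurnsCylinder F c γ) (hu : -2 ≤ u) (huv : u ≤ v) (i : ℤ)
    (h : ∀ y, u ≤ y → y ≤ v → γ y = i * Real.pi) : F '' vLines c u v = vLines c u v := by
  rw [← vBox_image_vTwist_zero huv, hF.image_vTwist hu huv 0 i i]
  · simp
  · intro t ht
    obtain ⟨h1, h2⟩ := mem_Icc_param huv ht
    rw [h _ h1 h2]; ring

end turns

/-- Below the line `y = -2` the tube is turned by a whole number of half turns, so the two `V`s,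
which lie at the same distance from its core, are either fixed or exchanged. -/
theorem twistBend_mem_bendArcs {βA βB : ℝ → ℝ} (b : ℤ) (hA : ∀ y ≤ -2, βA y = b * Real.pi)
    (hB : ∀ y ≤ -2, βB y = b * Real.pi) (hA' : ∀ y, 2 ≤ y → βA y = 0)
    (hB' : ∀ y, 2 ≤ y → βB y = 0) {p : Space} (hp : p ∈ bendArcs) :
    twistBend βA βB p ∈ bendArcs := by
  obtain ⟨h1, h2, h3⟩ := hp
  rcases le_abs.1 h2 with h | h
  · rw [twistBend_of_angle_eq_zero (by simp [sideAngle, hA' _ h, hB' _ h])]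
    exact ⟨h1, h2, h3⟩
  have hy : p.2.1 ≤ -2 := by linarith
  have hr : bendRadius p.1 p.2.1 = |p.1| + 2 * (|p.2.1| - 2) := by
    rw [bendRadius, depth_of_le hy, abs_of_nonpos (by linarith : p.2.1 ≤ 0)]; ring
  rw [← hr] at h3
  set r := bendRadius p.1 p.2.1 with hr0
  have hs : sideAngle βA βB p.1 p.2.1 = b * Real.pi := by
    rw [sideAngle, hA _ hy, hB _ hy]; ring
  have hcut : cutoff (r - 3) 0 = 1 := by
    apply cutoff_eq_one
    rcases h3 with h3 | h3 <;> rw [h3] <;> norm_num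
  -- The half turns of the tube exchange the two strands of the bend or fix both.
  have hr' : 3 + (r - 3) * Real.cos (b * Real.pi) = 2 ∨
      3 + (r - 3) * Real.cos (b * Real.pi) = 4 := by
    rcases h3 with h3 | h3 <;> rcases cos_int_mul_pi_eq b with hc | hc <;> rw [h3, hc] <;> norm_num
  have hmax : max r 1 = r := max_eq_left (by rcases h3 with h3 | h3 <;> rw [h3] <;> norm_num)
  have hrpos : 0 < r := by rcases h3 with h3 | h3 <;> rw [h3] <;> norm_num
  set r' := 3 + (r - 3) * Real.cos (b * Real.pi) with hr'0
  have hr'pos : 0 < r' := by rcases hr' with h | h <;> rw [h] <;> norm_num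
  have hk : 1 + (r' - r) / r = r' / r := by field_simp; ring
  have hk0 : 0 < r' / r := div_pos hr'pos hrpos
  have e : twistBend βA βB p = (r' / r * p.1, p.2.1 + (1 - r' / r) * depth p.2.1, 0) := by
    simp only [twistBend, ← hr0, h1, hs, hcut, mul_one, zero_mul, sub_zero, add_zero, ← hr'0,
      hmax, hk, Real.sin_int_mul_pi, mul_zero]
  have hd := depth_scale (y := p.2.1) hk0
  have hy' : p.2.1 + (1 - r' / r) * depth p.2.1 ≤ -2 := by
    rw [depth_of_le hy]; nlinarith
  have hR : |r' / r * p.1| + 2 * (|p.2.1 + (1 - r' / r) * depth p.2.1| - 2) = r' := by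
    have : |p.2.1 + (1 - r' / r) * depth p.2.1| - 2 = r' / r * depth p.2.1 := by
      rw [← hd, depth_of_le hy', abs_of_nonpos (by linarith)]; ring
    rw [this, abs_mul, abs_of_pos hk0]
    have hsum : r' / r * |p.1| + 2 * (r' / r * depth p.2.1)
        = r' / r * (|p.1| + 2 * depth p.2.1) := by ring
    have hrr : |p.1| + 2 * depth p.2.1 = r := hr0.symm
    rw [hsum, hrr, div_mul_cancel₀ _ hrpos.ne']
  rw [e]
  refine ⟨rfl, ?_, ?_⟩
  · exact le_abs.2 (Or.inr (by simp only; linarith))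
  · simp only [hR]; exact hr'

theorem twistBend_image_bendArcs {βA βB : ℝ → ℝ} (b : ℤ) (hA : ∀ y ≤ -2, βA y = b * Real.pi)
    (hB : ∀ y ≤ -2, βB y = b * Real.pi) (hA' : ∀ y, 2 ≤ y → βA y = 0)
    (hB' : ∀ y, 2 ≤ y → βB y = 0) : twistBend βA βB '' bendArcs = bendArcs := by
  apply Set.Subset.antisymm
  · rintro _ ⟨p, hp, rfl⟩
    exact twistBend_mem_bendArcs b hA hB hA' hB' hp
  · intro p hp
    refine ⟨twistBend (fun y => -βA y) (fun y => -βB y) p,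
      twistBend_mem_bendArcs (-b) (fun y hy => by simp [hA y hy]) (fun y hy => by simp [hB y hy])
        (fun y hy => by simp [hA' y hy]) (fun y hy => by simp [hB' y hy]) hp, ?_⟩
    simpa using twistBend_neg (βA := fun y => -βA y) (βB := fun y => -βB y)
      (b := -(b * Real.pi)) (fun y hy => by rw [hA y hy]) (fun y hy => by rw [hB y hy]) p

/-- The strands below the two boxes are twisted about the core of the lower bend. -/
theorem ambientIsotopic_bendRow_twist {βA βB : ℝ → ℝ} (hcA : Continuous βA) (hcB : Continuous βB)
    (b : ℤ) {u v u' v' : ℝ} {A B A' B' : Set Space} (hu : -2 ≤ u) (huv : u ≤ v) (hv : v ≤ 2)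
    (hu' : -2 ≤ u') (huv' : u' ≤ v') (hv' : v' ≤ 2)
    (hA0 : ∀ y ≤ u, βA y = b * Real.pi) (hB0 : ∀ y ≤ u', βB y = b * Real.pi)
    (hA1 : ∀ y, v ≤ y → βA y = 0) (hB1 : ∀ y, v' ≤ y → βB y = 0)
    (hA : twistBend βA βB '' (vBox (-3) u v '' A) = vBox (-3) u v '' A')
    (hB : twistBend βA βB '' (vBox 3 u' v' '' B) = vBox 3 u' v' '' B') :
    AmbientIsotopic (bendRow u v u' v' A B) (bendRow u v u' v' A' B') := by
  have key : twistBend βA βB '' bendRow u v u' v' A B = bendRow u v u' v' A' B' := by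
    simp only [bendRow, Set.image_union, hA, hB]
    rw [(turnsCylinder_left βA βB).image_vLines le_rfl hu (-b)
        (fun y _ h => by rw [hA0 y h]; push_cast; ring),
      (turnsCylinder_right βA βB).image_vLines le_rfl hu' b (fun y _ h => hB0 y h),
      (turnsCylinder_left βA βB).image_vLines (by linarith) hv 0
        (fun y h _ => by rw [hA1 y h]; simp),
      (turnsCylinder_right βA βB).image_vLines (by linarith) hv' 0
        (fun y h _ => by rw [hB1 y h]; simp),
      twistBend_image_bendArcs b (fun y hy => hA0 y (by linarith)) (fun y hy => hB0 y (by linarith))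
        (fun y hy => hA1 y (by linarith)) (fun y hy => hB1 y (by linarith))]
  rw [← key]
  exact ambientIsotopic_twistBend hcA hcB (fun y hy => hA0 y (by linarith))
    (fun y hy => hB0 y (by linarith)) _

end Tangles

/-! ### Cancelling vertical twists -/

namespace Tangles

/-- The angle that falls from `b` half turns to `0` over the interval `[u, v]`. -/
noncomputable def descent (b : ℤ) (u v y : ℝ) : ℝ := b * Real.pi * (1 - ramp u v y)

section descent

variable {b : ℤ} {u v : ℝ}

theorem continuous_descent : Continuous (descent b u v) :=
  continuous_const.mul (continuous_const.sub continuous_ramp)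

theorem descent_of_le (h : u < v) {y : ℝ} (hy : y ≤ u) : descent b u v y = b * Real.pi := by
  rw [descent, ramp_of_le h hy]; simp

theorem descent_of_ge (h : u < v) {y : ℝ} (hy : v ≤ y) : descent b u v y = 0 := by
  rw [descent, ramp_of_ge h hy]; simp

theorem descent_param (h : u < v) {t : ℝ} (ht : t ∈ Set.Icc (-1 : ℝ) 1) :
    descent b u v ((u + v) / 2 + (v - u) / 2 * t)
      = Real.pi * (b + (((0 : ℤ) : ℝ) - b) * ((t + 1) / 2)) := by
  rw [descent, ramp_param h ht]; push_cast; ring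

theorem neg_descent_param (h : u < v) {t : ℝ} (ht : t ∈ Set.Icc (-1 : ℝ) 1) :
    -descent b u v ((u + v) / 2 + (v - u) / 2 * t)
      = Real.pi * ((-b : ℤ) + (((0 : ℤ) : ℝ) - (-b : ℤ)) * ((t + 1) / 2)) := by
  rw [descent_param h ht]; push_cast; ring

end descent

section twists

variable {u v u' v' : ℝ} {X Y : Set Space}

/-- A tangle over `[u', v']` that ends with the twist `1/[-b]` at its bottom loses it. -/
theorem twistBend_image_right (b : ℤ) (β : ℝ → ℝ) (hY : Y ⊆ cube) (hu' : -2 ≤ u')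
    (huv' : u' < v') :
    twistBend β (descent b u' ((u' + v') / 2)) '' (vBox 3 u' v' '' star Y (vTwist (-b)))
      = vBox 3 u' v' '' star Y (vTwist 0) := by
  have h1 : u' < (u' + v') / 2 := by linarith
  have hR := turnsCylinder_right β (descent b u' ((u' + v') / 2))
  rw [vBox_image_star, vBox_image_star, Set.image_union,
    hR.image_cube_of_eq_zero (by linarith) (by linarith) hY (fun y hy _ => descent_of_ge h1 hy),
    hR.image_vTwist hu' h1.le (-b) b 0 (fun t ht => descent_param h1 ht)]
  simp

/-- The twists `1/[b]` and `1/[-b]` at the bottom of two tangles cancel each other. -/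
theorem ambientIsotopic_bendRow_cancel (b : ℤ) (hX : X ⊆ cube) (hY : Y ⊆ cube) (hu : -2 ≤ u)
    (huv : u < v) (hv : v ≤ 2) (hu' : -2 ≤ u') (huv' : u' < v') (hv' : v' ≤ 2) :
    AmbientIsotopic (bendRow u v u' v' (star X (vTwist b)) (star Y (vTwist (-b))))
      (bendRow ((u + v) / 2) v ((u' + v') / 2) v' X Y) := by
  have h1 : u < (u + v) / 2 := by linarith
  have h1' : u' < (u' + v') / 2 := by linarith
  rw [← bendRow_star_left hu huv.le, ← bendRow_star_right hu' huv'.le]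
  refine ambientIsotopic_bendRow_twist (βA := descent b u ((u + v) / 2))
    (βB := descent b u' ((u' + v') / 2)) continuous_descent
    continuous_descent b hu huv.le hv hu' huv'.le hv'
    (fun y hy => descent_of_le h1 hy) (fun y hy => descent_of_le h1' hy)
    (fun y hy => descent_of_ge h1 (by linarith)) (fun y hy => descent_of_ge h1' (by linarith)) ?_
    (twistBend_image_right b _ hY hu' huv')
  have hL := turnsCylinder_left (descent b u ((u + v) / 2)) (descent b u' ((u' + v') / 2))
  rw [vBox_image_star, vBox_image_star, Set.image_union,
    hL.image_cube_of_eq_zero (by linarith) (by linarith) hX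
      (fun y hy _ => by rw [descent_of_ge h1 hy, neg_zero]),
    hL.image_vTwist hu h1.le b (-b) 0 (fun t ht => neg_descent_param h1 ht)]
  simp

/-- The twist `1/[b]` at the top of the first tangle and the twist `1/[-b]` at the bottom of the
second one cancel each other, at the cost of `b` half turns of the first tangle. -/
theorem ambientIsotopic_bendRow_flype (b : ℤ) (hX : X ⊆ cube) (hY : Y ⊆ cube) (hu : -2 ≤ u)
    (huv : u < v) (hv : v ≤ 2) (hu' : -2 ≤ u') (huv' : u' < v') (hv' : v' ≤ 2) :
    AmbientIsotopic (bendRow u v u' v' (star (vTwist b) X) (star Y (vTwist (-b))))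
      (bendRow u ((u + v) / 2) ((u' + v') / 2) v'
        (flip (Real.cos (b * Real.pi)) 1 '' X) Y) := by
  have h1 : (u + v) / 2 < v := by linarith
  have h1' : u' < (u' + v') / 2 := by linarith
  rw [← bendRow_star_left' huv.le hv, ← bendRow_star_right hu' huv'.le]
  refine ambientIsotopic_bendRow_twist (βA := descent b ((u + v) / 2) v)
    (βB := descent b u' ((u' + v') / 2)) continuous_descent
    continuous_descent b hu huv.le hv hu' huv'.le hv'
    (fun y hy => descent_of_le h1 (by linarith)) (fun y hy => descent_of_le h1' hy)
    (fun y hy => descent_of_ge h1 hy) (fun y hy => descent_of_ge h1' (by linarith)) ?_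
    (twistBend_image_right b _ hY hu' huv')
  have hL := turnsCylinder_left (descent b ((u + v) / 2) v) (descent b u' ((u' + v') / 2))
  have hcos : Real.cos ((-b : ℤ) * Real.pi) = Real.cos (b * Real.pi) := by
    rw [← Real.cos_neg]; push_cast; ring_nf
  rw [vBox_image_star, vBox_image_star, Set.image_union,
    hL.image_cube hu (by linarith) (-b) hX
      (fun y _ hy => by rw [descent_of_le h1 hy]; push_cast; ring),
    hL.image_vTwist (by linarith) h1.le b (-b) 0 (fun t ht => neg_descent_param h1 ht), hcos]
  simp

/-- A vertical twist is undone by half turns of the lower strand of `[0]`. -/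
theorem ambientIsotopic_bendRow_vTwist_hTwist_zero (b : ℤ) (hu : -2 ≤ u)
    (huv : u < v) (hv : v ≤ 2) (hu' : -2 ≤ u') (huv' : u' < v') (hv' : v' ≤ 2) :
    AmbientIsotopic (bendRow u v u' v' (vTwist b) (hTwist 0))
      (bendRow u v u' v' (vTwist 0) (hTwist 0)) := by
  have hL := turnsCylinder_left (descent b u v) (descent b u' v')
  have hR := turnsCylinder_right (descent b u v) (descent b u' v')
  refine ambientIsotopic_bendRow_twist (βA := descent b u v)
    (βB := descent b u' v') continuous_descent continuous_descent b hu huv.le hv hu' huv'.le hv'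
    (fun y hy => descent_of_le huv hy) (fun y hy => descent_of_le huv' hy)
    (fun y hy => descent_of_ge huv hy) (fun y hy => descent_of_ge huv' hy) ?_ ?_
  · rw [hL.image_vTwist hu huv.le b (-b) 0 (fun t ht => neg_descent_param huv ht)]
    simp
  · rw [Set.image_image]
    have hc := cos_int_mul_pi_eq b
    have hv0 : ∀ t s, hPoint 0 t s = (t, s, 0) := fun t s => by simp [hPoint]
    have hn : ∀ t ∈ Set.Icc (-1 : ℝ) 1, t ^ 2 + 0 ^ 2 ≤ 2 ∧ |t| ≤ 1 := fun t ht =>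
      ⟨by nlinarith [ht.1, ht.2], abs_le.2 ht⟩
    have hl : ∀ t ∈ Set.Icc (-1 : ℝ) 1,
        twistBend (descent b u v) (descent b u' v') (vBox 3 u' v' (t, -1, 0))
          = vBox 3 u' v' (Real.cos (b * Real.pi) * t, -1, 0) := by
      intro t ht
      have hx : (u' + v') / 2 + (v' - u') / 2 * (-1) = u' := by ring
      simp only [vBox, hx]
      rw [hR _ _ _ hu' (hn t ht).1 (hn t ht).2]
      simp only [descent_of_le huv' le_rfl, Real.sin_int_mul_pi]
      ext <;> simp [mul_comm]
    have hr : ∀ t ∈ Set.Icc (-1 : ℝ) 1,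
        twistBend (descent b u v) (descent b u' v') (vBox 3 u' v' (t, 1, 0))
          = vBox 3 u' v' (t, 1, 0) := by
      intro t ht
      have hx : (u' + v') / 2 + (v' - u') / 2 * 1 = v' := by ring
      simp only [vBox, hx]
      rw [hR _ _ _ (by linarith) (hn t ht).1 (hn t ht).2]
      simp [descent_of_ge huv' le_rfl]
    have hI : ∀ t ∈ Set.Icc (-1 : ℝ) 1, Real.cos (b * Real.pi) * t ∈ Set.Icc (-1 : ℝ) 1 := by
      intro t ht
      rcases hc with h | h <;> rw [h] <;> constructor <;> linarith [ht.1, ht.2]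
    ext p
    simp only [Set.mem_image, mem_hTwist]
    constructor
    · rintro ⟨_, ⟨t, ht, s, rfl | rfl, rfl⟩, rfl⟩
      · exact ⟨_, ⟨t, ht, 1, Or.inl rfl, rfl⟩, by rw [hv0, hr t ht]⟩
      · exact ⟨_, ⟨_, hI t ht, -1, Or.inr rfl, rfl⟩, by rw [hv0, hv0, hl t ht]⟩
    · rintro ⟨_, ⟨t, ht, s, rfl | rfl, rfl⟩, rfl⟩
      · exact ⟨_, ⟨t, ht, 1, Or.inl rfl, rfl⟩, by rw [hv0, hr t ht]⟩
      · exact ⟨_, ⟨_, hI t ht, -1, Or.inr rfl, rfl⟩,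
          by rw [hv0, hv0, hl _ (hI t ht), sign_mul_cancel hc]⟩

end twists

/-- The boxes may be moved and stretched along their vertical lines, independently of each
other. -/
theorem ambientIsotopic_bendRow_of_orderIso (f g : ℝ ≃o ℝ) (hf : ∀ y, 2 ≤ |y| → f y = y)
    (hg : ∀ y, 2 ≤ |y| → g y = y) {u v u' v' : ℝ} {A B : Set Space} (hA : A ⊆ cube) (hB : B ⊆ cube)
    (huv : ∀ t ∈ Set.Icc (-1 : ℝ) 1,
      f ((u + v) / 2 + (v - u) / 2 * t) = (f u + f v) / 2 + (f v - f u) / 2 * t)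
    (huv' : ∀ t ∈ Set.Icc (-1 : ℝ) 1,
      g ((u' + v') / 2 + (v' - u') / 2 * t) = (g u' + g v') / 2 + (g v' - g u') / 2 * t) :
    AmbientIsotopic (bendRow u v u' v' A B) (bendRow (f u) (f v) (g u') (g v') A B) := by
  let P : ℝ → ℝ → ℝ := fun x y => f y * (1 - ramp (-1) 1 x) + g y * ramp (-1) 1 x
  have h11 : (-1 : ℝ) < 1 := by norm_num
  have hPl : ∀ x y, x ≤ -1 → P x y = f y := fun x y h => by simp [P, ramp_of_le h11 h]
  have hPr : ∀ x y, 1 ≤ x → P x y = g y := fun x y h => by simp [P, ramp_of_ge h11 h]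
  have hP2 : ∀ x y, 2 ≤ |y| → P x y = y := fun x y h => by
    simp only [P, hf y h, hg y h]; ring
  have habs2 : (2 : ℝ) ≤ |2| ∧ (2 : ℝ) ≤ |(-2 : ℝ)| := by constructor <;> norm_num
  have key : fiberY P '' bendRow u v u' v' A B = bendRow (f u) (f v) (g u') (g v') A B := by
    have hboxA : fiberY P '' (vBox (-3) u v '' A) = vBox (-3) (f u) (f v) '' A := by
      rw [Set.image_image]
      refine Set.image_congr fun w hw => ?_
      obtain ⟨h1, h2, _⟩ := hA hw
      simp only [fiberY, vBox, huv w.2.1 (abs_le.1 h2),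
        hPl (-3 + w.1) _ (by linarith [(abs_le.1 h1).2])]
    have hboxB : fiberY P '' (vBox 3 u' v' '' B) = vBox 3 (g u') (g v') '' B := by
      rw [Set.image_image]
      refine Set.image_congr fun w hw => ?_
      obtain ⟨h1, h2, _⟩ := hB hw
      simp only [fiberY, vBox, huv' w.2.1 (abs_le.1 h2),
        hPr (3 + w.1) _ (by linarith [(abs_le.1 h1).1])]
    have hlineA : ∀ a b, fiberY P '' vLines (-3) a b = vLines (-3) (f a) (f b) := by
      have hx : ∀ x : ℝ, |x - -3| = 1 → x ≤ -1 := fun x h => by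
        have := (abs_le.1 h.le).2; linarith
      intro a b
      ext p
      constructor
      · rintro ⟨p, ⟨h1, h2, h3, h4⟩, rfl⟩
        refine ⟨?_, ?_, h3, h4⟩ <;> simp only [fiberY, hPl _ _ (hx _ h3)]
        exacts [f.monotone h1, f.monotone h2]
      · rintro ⟨h1, h2, h3, h4⟩
        exact ⟨(p.1, f.symm p.2.1, p.2.2), ⟨f.le_symm_apply.2 h1, f.symm_apply_le.2 h2, h3, h4⟩,
          by simp [fiberY, hPl _ _ (hx _ h3)]⟩
    have hlineB : ∀ a b, fiberY P '' vLines 3 a b = vLines 3 (g a) (g b) := by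
      have hx : ∀ x : ℝ, |x - 3| = 1 → 1 ≤ x := fun x h => by
        have := (abs_le.1 h.le).1; linarith
      intro a b
      ext p
      constructor
      · rintro ⟨p, ⟨h1, h2, h3, h4⟩, rfl⟩
        refine ⟨?_, ?_, h3, h4⟩ <;> simp only [fiberY, hPr _ _ (hx _ h3)]
        exacts [g.monotone h1, g.monotone h2]
      · rintro ⟨h1, h2, h3, h4⟩
        exact ⟨(p.1, g.symm p.2.1, p.2.2), ⟨g.le_symm_apply.2 h1, g.symm_apply_le.2 h2, h3, h4⟩,
          by simp [fiberY, hPr _ _ (hx _ h3)]⟩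
    have harcs : fiberY P '' bendArcs = bendArcs := by
      have : ∀ p ∈ bendArcs, fiberY P p = p := fun p hp => by simp [fiberY, hP2 _ _ hp.2.1]
      rw [Set.image_congr this]
      exact Set.image_id _
    simp only [bendRow, Set.image_union, hboxA, hboxB, hlineA, hlineB, harcs, hf _ habs2.1,
      hf _ habs2.2, hg _ habs2.1, hg _ habs2.2]
  rw [← key]
  refine ambientIsotopic_fiberY _ ?_ (fun x => ?_) (fun x => ⟨4, fun y => ?_⟩) _
  · have h1 : Continuous (ramp (-1) 1) := continuous_ramp
    have h2 := f.continuous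
    have h3 := g.continuous
    simp only [P]; fun_prop
  · intro y y' h
    have hf' := f.strictMono h
    have hg' := g.strictMono h
    have h0 : 0 ≤ ramp (-1) 1 x := le_max_left _ _
    have h1 : ramp (-1) 1 x ≤ 1 := max_le zero_le_one (min_le_left _ _)
    simp only [P]
    rcases h0.eq_or_lt with h0 | h0
    · rw [← h0]; linarith
    · nlinarith
  · rcases le_total 2 |y| with h | h
    · simp [hP2 x y h]
    · obtain ⟨h1, h2⟩ := abs_le.1 h
      have hf1 := f.monotone h1
      have hf2 := f.monotone h2
      have hg1 := g.monotone h1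
      have hg2 := g.monotone h2
      rw [hf _ habs2.2] at hf1
      rw [hf _ habs2.1] at hf2
      rw [hg _ habs2.2] at hg1
      rw [hg _ habs2.1] at hg2
      have h0 : 0 ≤ ramp (-1) 1 x := le_max_left _ _
      have h1 : ramp (-1) 1 x ≤ 1 := max_le zero_le_one (min_le_left _ _)
      simp only [P]
      rw [abs_le]
      constructor <;> nlinarith

/-- The numerator closure of two tangles with vertical ends, in standard position. -/
noncomputable def bendClosure (A B : Set Space) : Set Space := bendRow (-1) 1 (-1) 1 A B

section standardBendRow

variable {X Y A B : Set Space}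

theorem isUnknot_bendClosure_cancel (b : ℤ) (hX : X ⊆ cube) (hY : Y ⊆ cube)
    (h : IsUnknot (bendClosure X Y)) :
    IsUnknot (bendClosure (star X (vTwist b)) (star Y (vTwist (-b)))) := by
  have h1 : (-2 : ℝ) < 0 := by norm_num
  have h2 : (0 : ℝ) < 1 := by norm_num
  have h3 : (-2 : ℝ) < -1 := by norm_num
  have h4 : (-1 : ℝ) < 1 := by norm_num
  have m := ambientIsotopic_bendRow_of_orderIso (u := 0) (v := 1) (u' := 0) (v' := 1)
    (hatIso h1 h2 h3 h4) (hatIso h1 h2 h3 h4)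
    (hatIso_of_outside h1 h2 h3 h4 le_rfl (by norm_num))
    (hatIso_of_outside h1 h2 h3 h4 le_rfl (by norm_num)) hX hY
    (fun t ht => hatMap_affine h1 h2 (by simp) h2.le ht)
    (fun t ht => hatMap_affine h1 h2 (by simp) h2.le ht)
  simp only [hatIso_apply, hatMap_self h1 h2, hatMap_of_ge h2 le_rfl] at m
  have c := ambientIsotopic_bendRow_cancel b hX hY (u := -1) (v := 1) (u' := -1) (v' := 1)
    (by norm_num) (by norm_num) (by norm_num) (by norm_num) (by norm_num) (by norm_num)
  norm_num at c
  exact h.of_ambientIsotopic (c.trans m)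

theorem isUnknot_bendClosure_flype (b : ℤ) (hX : X ⊆ cube) (hY : Y ⊆ cube)
    (h : IsUnknot (bendClosure (flip (Real.cos (b * Real.pi)) 1 '' X) Y)) :
    IsUnknot (bendClosure (star (vTwist b) X) (star Y (vTwist (-b)))) := by
  have hX' := flip_image_subset (cos_int_mul_pi_eq b) (Or.inl rfl) hX
  have h1 : (-2 : ℝ) < 0 := by norm_num
  have h2 : (0 : ℝ) < 1 := by norm_num
  have h3 : (-2 : ℝ) < -1 := by norm_num
  have h4 : (-1 : ℝ) < 1 := by norm_num
  have h5 : (-1 : ℝ) < 0 := by norm_num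
  have h6 : (0 : ℝ) < 2 := by norm_num
  have h7 : (1 : ℝ) < 2 := by norm_num
  have m := ambientIsotopic_bendRow_of_orderIso (u := -1) (v := 0) (u' := 0) (v' := 1)
    (hatIso h5 h6 h4 h7) (hatIso h1 h2 h3 h4)
    (hatIso_of_outside h5 h6 h4 h7 (by norm_num) le_rfl)
    (hatIso_of_outside h1 h2 h3 h4 le_rfl (by norm_num)) hX' hY
    (fun t ht => hatMap_affine h5 h6 (by simp) h5.le ht)
    (fun t ht => hatMap_affine h1 h2 (by simp) h2.le ht)
  simp only [hatIso_apply, hatMap_self h1 h2, hatMap_of_ge h2 le_rfl, hatMap_self h5 h6,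
    hatMap_of_le h5 le_rfl] at m
  have c := ambientIsotopic_bendRow_flype b hX hY (u := -1) (v := 1) (u' := -1) (v' := 1)
    (by norm_num) (by norm_num) (by norm_num) (by norm_num) (by norm_num) (by norm_num)
  norm_num at c
  exact h.of_ambientIsotopic (c.trans m)

theorem isUnknot_bendClosure_of_zero_star (hA : A ⊆ cube) (hB : B ⊆ cube)
    (h : IsUnknot (bendClosure A (star (vTwist 0) B))) : IsUnknot (bendClosure A B) := by
  have h4 : (-1 : ℝ) < 1 := by norm_num
  have h5 : (-1 : ℝ) < 0 := by norm_num
  have h6 : (0 : ℝ) < 2 := by norm_num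
  have h7 : (1 : ℝ) < 2 := by norm_num
  have m := ambientIsotopic_bendRow_of_orderIso (u := -1) (v := 1) (u' := -1) (v' := 0)
    (OrderIso.refl ℝ) (hatIso h5 h6 h4 h7) (fun _ _ => rfl)
    (hatIso_of_outside h5 h6 h4 h7 (by norm_num) le_rfl) hA hB
    (fun t ht => rfl)
    (fun t ht => hatMap_affine h5 h6 (by simp) h5.le ht)
  simp only [hatIso_apply, hatMap_self h5 h6, hatMap_of_le h5 le_rfl, OrderIso.refl_apply] at m
  rw [bendClosure, bendRow_star_right' (by norm_num) (by norm_num)] at h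
  norm_num at h
  exact h.of_ambientIsotopic m.symm

theorem isUnknot_bendClosure_vTwist_hTwist_zero (b : ℤ)
    (h : IsUnknot (bendClosure (vTwist 0) (hTwist 0))) :
    IsUnknot (bendClosure (vTwist b) (hTwist 0)) := by
  refine h.of_ambientIsotopic (ambientIsotopic_bendRow_vTwist_hTwist_zero b ?_ ?_ ?_ ?_ ?_ ?_)
  all_goals norm_num

end standardBendRow

end Tangles

/-! ### The two standard positions are isotopic -/

namespace Tangles

/-- The truncation of `x` to the interval `[-d, d]`. -/
noncomputable def clip (d x : ℝ) : ℝ := max (-d) (min d x)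

section clip

variable {d x y : ℝ}

theorem clip_mono (h : x ≤ y) : clip d x ≤ clip d y :=
  max_le_max le_rfl (min_le_min le_rfl h)

theorem clip_neg (hd : 0 ≤ d) : clip d (-x) = -clip d x := by
  unfold clip
  rcases le_total d x with h | h <;> rcases le_total (-d) x with h' | h' <;>
    simp [max_def, min_def] <;> split_ifs <;> linarith

theorem clip_of_nonneg (hd : 0 ≤ d) (hx : 0 ≤ x) : clip d x = min d x :=
  max_eq_right (le_min (by linarith) (by linarith))

theorem abs_clip_le (hd : 0 ≤ d) : |clip d x| ≤ d :=
  abs_le.2 ⟨le_max_left _ _, max_le (by linarith) (min_le_left _ _)⟩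

theorem clip_sub_le (h : x ≤ y) : clip d y - clip d x ≤ y - x := by
  unfold clip
  have h1 : min d y ≤ min d x + (y - x) := by
    rcases le_total d x with h' | h'
    · rw [min_eq_left h']; linarith [min_le_left d y]
    · rw [min_eq_right h']; linarith [min_le_right d y]
  have h2 : max (-d) (min d y) ≤ max (-d) (min d x) + (y - x) :=
    max_le (by linarith [le_max_left (-d) (min d x)])
      (by linarith [le_max_right (-d) (min d x)])
  linarith

end clip

/-- The part of the plane `z = 0` that is symmetric with respect to both coordinate axes and is
described by the relation `Q` in the quadrant `x, y ≥ 0`. -/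
def quad (Q : ℝ → ℝ → Prop) : Set Space := {p | p.2.2 = 0 ∧ Q |p.1| |p.2.1|}

/-- The part of the plane `z = 0` that is symmetric with respect to the `x`-axis and is described
by the relation `R` in the half-plane `y ≥ 0`. -/
def half (R : ℝ → ℝ → Prop) : Set Space := {p | p.2.2 = 0 ∧ R p.1 |p.2.1|}

theorem fiberY_image_half {p : ℝ → ℝ → ℝ} {R R' : ℝ → ℝ → Prop}
    (hodd : ∀ x y, p x (-y) = -p x y) (hpos : ∀ x y, 0 ≤ y → 0 ≤ p x y)
    (h1 : ∀ x b, 0 ≤ b → R x b → R' x (p x b))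
    (h2 : ∀ x b, 0 ≤ b → R' x b → ∃ b', 0 ≤ b' ∧ R x b' ∧ p x b' = b) :
    fiberY p '' half R = half R' := by
  have habs : ∀ x y, |p x y| = p x |y| := by
    intro x y
    rcases le_total 0 y with h | h
    · rw [abs_of_nonneg h, abs_of_nonneg (hpos x y h)]
    · rw [abs_of_nonpos h, hodd, abs_of_nonpos]
      have := hpos x (-y) (by linarith)
      rw [hodd] at this
      linarith
  ext v
  constructor
  · rintro ⟨v, ⟨hz, hQ⟩, rfl⟩
    refine ⟨hz, ?_⟩
    simp only [fiberY, habs]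
    exact h1 _ _ (abs_nonneg _) hQ
  · rintro ⟨hz, hQ⟩
    obtain ⟨b, hb, hQb, hpb⟩ := h2 _ _ (abs_nonneg _) hQ
    rcases le_total 0 v.2.1 with h | h
    · refine ⟨(v.1, b, v.2.2), ⟨hz, by simpa only [abs_of_nonneg hb] using hQb⟩, ?_⟩
      simp only [fiberY, hpb, abs_of_nonneg h]
    · refine ⟨(v.1, -b, v.2.2), ⟨hz, by simpa only [abs_neg, abs_of_nonneg hb] using hQb⟩, ?_⟩
      simp only [fiberY, hodd, hpb, abs_of_nonpos h, neg_neg]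

theorem fiberX_image_half {p : ℝ → ℝ → ℝ} {R R' : ℝ → ℝ → Prop} (hy : ∀ y x, p |y| x = p y x)
    (h1 : ∀ x b, 0 ≤ b → R x b → R' (p b x) b)
    (h2 : ∀ x b, 0 ≤ b → R' x b → ∃ x', R x' b ∧ p b x' = x) :
    fiberX p '' half R = half R' := by
  ext v
  constructor
  · rintro ⟨v, ⟨hz, hR⟩, rfl⟩
    refine ⟨hz, ?_⟩
    simp only [fiberX]
    rw [← hy]
    exact h1 _ _ (abs_nonneg _) hR
  · rintro ⟨hz, hR⟩
    obtain ⟨x, hx, hpx⟩ := h2 _ _ (abs_nonneg _) hR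
    rw [hy] at hpx
    refine ⟨(x, v.2), ⟨hz, hx⟩, ?_⟩
    simp only [fiberX, hpx]

theorem fiberY_image_quad {p : ℝ → ℝ → ℝ} {Q Q' : ℝ → ℝ → Prop} (hx : ∀ x y, p |x| y = p x y)
    (hodd : ∀ x y, p x (-y) = -p x y) (hpos : ∀ x y, 0 ≤ y → 0 ≤ p x y)
    (h1 : ∀ a b, 0 ≤ a → 0 ≤ b → Q a b → Q' a (p a b))
    (h2 : ∀ a b, 0 ≤ a → 0 ≤ b → Q' a b → ∃ b', 0 ≤ b' ∧ Q a b' ∧ p a b' = b) :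
    fiberY p '' quad Q = quad Q' :=
  fiberY_image_half (R := fun x b => Q |x| b) (R' := fun x b => Q' |x| b) hodd hpos
    (fun x b hb h => by rw [← hx]; exact h1 _ _ (abs_nonneg _) hb h)
    (fun x b hb h => by simpa only [hx] using h2 _ _ (abs_nonneg x) hb h)

theorem fiberX_image_quad {p : ℝ → ℝ → ℝ} {Q Q' : ℝ → ℝ → Prop} (hy : ∀ y x, p |y| x = p y x)
    (hodd : ∀ y x, p y (-x) = -p y x) (hpos : ∀ y x, 0 ≤ x → 0 ≤ p y x)
    (h1 : ∀ a b, 0 ≤ a → 0 ≤ b → Q a b → Q' (p b a) b)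
    (h2 : ∀ a b, 0 ≤ a → 0 ≤ b → Q' a b → ∃ a', 0 ≤ a' ∧ Q a' b ∧ p b a' = a) :
    fiberX p '' quad Q = quad Q' := by
  have h := fiberY_image_quad (Q := fun a b => Q b a) (Q' := fun a b => Q' b a) hy hodd hpos
    (fun a b ha hb => h1 b a hb ha) (fun a b ha hb => h2 b a hb ha)
  have hs : ∀ R : ℝ → ℝ → Prop, swapXY '' quad (fun a b => R b a) = quad R := by
    intro R
    ext v
    constructor
    · rintro ⟨v, hv, rfl⟩; exact hv
    · intro hv; exact ⟨swapXY v, hv, rfl⟩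
  rw [← hs Q, ← hs Q', ← h, Set.image_image, Set.image_image]
  rfl

/-- The height to which the strands at `y = 1` are moved. -/
noncomputable def innerHeight (x : ℝ) : ℝ := 1 + max 0 (2 - |x|) + max 0 (min |x| 6 - 4) / 2

/-- The height to which the strands at `y = 2` are moved. -/
noncomputable def outerHeight (x : ℝ) : ℝ := 4 - min |x| 6 / 4

/-- The map that raises the height `1` to `innerHeight` and the height `2` to `outerHeight`. -/
noncomputable def raise (x y : ℝ) : ℝ :=
  innerHeight x * clip 1 y + (outerHeight x - innerHeight x) * (clip 2 y - clip 1 y)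
    + (y - clip 2 y)

theorem one_le_innerHeight (x : ℝ) : 1 ≤ innerHeight x := by
  have h1 := le_max_left 0 (2 - |x|)
  have h2 := le_max_left 0 (min |x| 6 - 4)
  unfold innerHeight; linarith

theorem innerHeight_lt (x : ℝ) : 1 / 2 ≤ outerHeight x - innerHeight x := by
  have h0 := abs_nonneg x
  unfold outerHeight innerHeight
  rcases le_total |x| 2 with h | h
  · rw [max_eq_right (by linarith), min_eq_left (by linarith), max_eq_left (by linarith)]; linarith
  rw [max_eq_left (by linarith)]
  rcases le_total |x| 4 with h | h
  · rw [min_eq_left (by linarith), max_eq_left (by linarith)]; linarith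
  rcases le_total |x| 6 with h | h
  · rw [min_eq_left (by linarith), max_eq_right (by linarith)]; linarith
  · rw [min_eq_right h]; norm_num

theorem clip_two_sub_mono {x y : ℝ} (h : x ≤ y) :
    clip 2 x - clip 1 x ≤ clip 2 y - clip 1 y := by
  have hc : ∀ z, clip 1 (clip 2 z) = clip 1 z := by
    intro z
    unfold clip
    rcases le_total 2 z with h | h
    · rw [min_eq_left h, min_eq_left (by linarith : (1 : ℝ) ≤ z)]; norm_num
    · rw [min_eq_right h]
      rcases le_total (-2) z with h' | h'
      · rw [max_eq_right h']
      · rw [max_eq_left h', min_eq_right (by linarith : z ≤ (1 : ℝ)),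
          max_eq_left (by linarith : z ≤ -1)]; norm_num
  have := clip_sub_le (d := 1) (clip_mono (d := 2) h)
  rw [hc, hc] at this
  linarith

theorem ambientIsotopic_raise (K : Set Space) : AmbientIsotopic K (fiberY raise '' K) := by
  refine ambientIsotopic_fiberY _ ?_ (fun x y y' h => ?_) (fun x => ⟨|innerHeight x - 1| * 1 +
    |outerHeight x - innerHeight x - 1| * (2 + 1), fun y => ?_⟩) _
  · unfold raise innerHeight outerHeight clip; fun_prop
  · have h1 := one_le_innerHeight x
    have h2 := innerHeight_lt x
    have h3 := clip_mono (d := 1) h.le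
    have h4 := clip_two_sub_mono h.le
    have h5 := clip_sub_le (d := 2) h.le
    have h6 : 1 / 2 * (clip 1 y' - clip 1 y) ≤ innerHeight x * (clip 1 y' - clip 1 y) :=
      mul_le_mul_of_nonneg_right (by linarith) (by linarith)
    have h7 := mul_le_mul_of_nonneg_right h2
      (by linarith : 0 ≤ (clip 2 y' - clip 1 y') - (clip 2 y - clip 1 y))
    unfold raise
    linarith
  · have h1 : raise x y - y = (innerHeight x - 1) * clip 1 y
        + (outerHeight x - innerHeight x - 1) * (clip 2 y - clip 1 y) := by unfold raise; ring
    have h2 : |clip 2 y - clip 1 y| ≤ 2 + 1 :=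
      (abs_sub _ _).trans (add_le_add (abs_clip_le (by norm_num)) (abs_clip_le (by norm_num)))
    rw [h1]
    refine (abs_add_le _ _).trans ?_
    rw [abs_mul, abs_mul]
    gcongr
    exact abs_clip_le (by norm_num)

/-- The distance by which the strands are moved away from the `y`-axis at height `y`. -/
noncomputable def spread (y : ℝ) : ℝ := max 0 (min (|y| - 1) (3 - |y|))

/-- The width that is left fixed at height `y` when the outer strands are moved. -/
noncomputable def fixedWidth (y : ℝ) : ℝ := max 0 (min 2 (6 - 2 * |y|))

/-- The distance by which the outer strands are moved away from the `y`-axis at height `y`. -/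
noncomputable def outerSpread (y : ℝ) : ℝ :=
  max 0 (min (3 * |y| - 3) (min (1 + |y|) (max (11 - 3 * |y|) (8 - 2 * |y|))))

theorem ambientIsotopic_spread (K : Set Space) :
    AmbientIsotopic K (fiberX (fun y x => x + clip (spread y) x) '' K) := by
  refine ambientIsotopic_fiberX _ ?_ (fun x y y' h => ?_) (fun y => ⟨spread y, fun x => ?_⟩) _
  · unfold spread clip; fun_prop
  · have := clip_mono (d := spread x) h.le
    linarith
  · rw [add_sub_cancel_left]
    exact abs_clip_le (le_max_left _ _)

theorem ambientIsotopic_outerSpread (K : Set Space) : AmbientIsotopic K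
    (fiberX (fun y x => x + clip (outerSpread y) (2 * (x - clip (fixedWidth y) x))) '' K) := by
  refine ambientIsotopic_fiberX _ ?_ (fun x y y' h => ?_) (fun y => ⟨outerSpread y, fun x => ?_⟩) _
  · unfold outerSpread fixedWidth clip; fun_prop
  · have h1 := clip_sub_le (d := fixedWidth x) h.le
    have := clip_mono (d := outerSpread x)
      (by linarith : 2 * (y - clip (fixedWidth x) y) ≤ 2 * (y' - clip (fixedWidth x) y'))
    linarith
  · rw [add_sub_cancel_left]
    exact abs_clip_le (le_max_left _ _)

/-- The strands of `closure₂` outside the boxes. -/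
def rowShape (a b : ℝ) : Prop :=
  (b = 1 ∧ (a ≤ 2 ∨ 4 ≤ a ∧ a ≤ 6)) ∨ (a = 6 ∧ 1 ≤ b ∧ b ≤ 2) ∨ (a ≤ 6 ∧ b = 2)

/-- The image of `rowShape` under `raise`. -/
def raisedShape (a b : ℝ) : Prop :=
  (a ≤ 2 ∧ b = 3 - a) ∨ (4 ≤ a ∧ a ≤ 6 ∧ b = a / 2 - 1) ∨ (a = 6 ∧ 2 ≤ b ∧ b ≤ 5 / 2) ∨
    (a ≤ 6 ∧ b = 4 - a / 4)

/-- The image of `raisedShape` after it was spread. -/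
def spreadShape (a b : ℝ) : Prop :=
  (1 ≤ b ∧ b ≤ 2 ∧ (a = 2 ∨ a = 1 + 3 * b)) ∨ (2 ≤ b ∧ b ≤ 3 ∧ a = 6 - 2 * b) ∨
    (2 ≤ b ∧ b ≤ 5 / 2 ∧ a = 9 - b) ∨ (5 / 2 ≤ b ∧ b ≤ 3 ∧ a = 19 - 5 * b) ∨
    (3 ≤ b ∧ b ≤ 4 ∧ a = 16 - 4 * b)

/-- The strands of `bendClosure` outside the boxes. -/
def bendShape (a b : ℝ) : Prop :=
  (1 ≤ b ∧ b ≤ 2 ∧ (a = 2 ∨ a = 4)) ∨ (2 ≤ b ∧ (a + 2 * (b - 2) = 2 ∨ a + 2 * (b - 2) = 4))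

theorem raise_apply {a b : ℝ} (hb : 0 ≤ b) : raise a b = innerHeight a * min 1 b
    + (outerHeight a - innerHeight a) * (min 2 b - min 1 b) + (b - min 2 b) := by
  rw [raise, clip_of_nonneg zero_le_one hb, clip_of_nonneg zero_le_two hb]

theorem innerHeight_inner {a : ℝ} (h0 : 0 ≤ a) (h : a ≤ 2) : innerHeight a = 3 - a := by
  rw [innerHeight, abs_of_nonneg h0, max_eq_right (by linarith), min_eq_left (by linarith),
    max_eq_left (by linarith)]; ring

theorem innerHeight_box {a : ℝ} (h0 : 2 ≤ |a|) (h : |a| ≤ 4) : innerHeight a = 1 := by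
  rw [innerHeight, max_eq_left (by linarith), min_eq_left (by linarith),
    max_eq_left (by linarith)]; ring

theorem innerHeight_outer {a : ℝ} (h0 : 4 ≤ a) (h : a ≤ 6) : innerHeight a = a / 2 - 1 := by
  rw [innerHeight, abs_of_nonneg (by linarith), max_eq_left (by linarith),
    min_eq_left (by linarith), max_eq_right (by linarith)]; ring

theorem outerHeight_apply {a : ℝ} (h0 : 0 ≤ a) (h : a ≤ 6) : outerHeight a = 4 - a / 4 := by
  rw [outerHeight, abs_of_nonneg h0, min_eq_left h]

theorem raise_image_rowShape : fiberY raise '' quad rowShape = quad raisedShape := by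
  have e1 : ∀ a, raise a 1 = innerHeight a := fun a => by
    rw [raise_apply zero_le_one]; norm_num
  have e2 : ∀ a, raise a 2 = outerHeight a := fun a => by
    rw [raise_apply zero_le_two]; norm_num
  have e6 : ∀ b, 1 ≤ b → b ≤ 2 → raise 6 b = b / 2 + 3 / 2 := by
    intro b h1 h2
    rw [raise_apply (by linarith), innerHeight_outer (by norm_num) le_rfl,
      outerHeight_apply (by norm_num) le_rfl, min_eq_left h1, min_eq_right h2]
    ring
  apply fiberY_image_quad
  · intro x y; simp [raise, innerHeight, outerHeight]
  · intro x y
    simp only [raise, clip_neg zero_le_one, clip_neg zero_le_two]; ring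
  · intro x y hy
    rw [raise_apply hy]
    have h1 := one_le_innerHeight x
    have h2 := innerHeight_lt x
    have h3 : 0 ≤ min 1 y := le_min zero_le_one hy
    have h4 : min 1 y ≤ min 2 y := min_le_min (by norm_num) le_rfl
    have h5 : min 2 y ≤ y := min_le_right _ _
    have := mul_nonneg (by linarith : 0 ≤ innerHeight x) h3
    have := mul_nonneg (by linarith : 0 ≤ outerHeight x - innerHeight x) (sub_nonneg.2 h4)
    linarith
  · rintro a b ha hb (⟨rfl, h | ⟨h, h'⟩⟩ | ⟨rfl, h, h'⟩ | ⟨h, rfl⟩)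
    · exact Or.inl ⟨h, by rw [e1, innerHeight_inner ha h]⟩
    · exact Or.inr (Or.inl ⟨h, h', by rw [e1, innerHeight_outer h h']⟩)
    · refine Or.inr (Or.inr (Or.inl ⟨rfl, ?_, ?_⟩)) <;> rw [e6 b h h'] <;> linarith
    · exact Or.inr (Or.inr (Or.inr ⟨h, by rw [e2, outerHeight_apply ha h]⟩))
  · rintro a b ha hb (⟨h, rfl⟩ | ⟨h, h', rfl⟩ | ⟨rfl, h, h'⟩ | ⟨h, rfl⟩)
    · exact ⟨1, zero_le_one, Or.inl ⟨rfl, Or.inl h⟩, by rw [e1, innerHeight_inner ha h]⟩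
    · exact ⟨1, zero_le_one, Or.inl ⟨rfl, Or.inr ⟨h, h'⟩⟩, by rw [e1, innerHeight_outer h h']⟩
    · refine ⟨2 * b - 3, by linarith, Or.inr (Or.inl ⟨rfl, by linarith, by linarith⟩), ?_⟩
      rw [e6 _ (by linarith) (by linarith)]; ring
    · exact ⟨2, zero_le_two, Or.inr (Or.inr ⟨h, rfl⟩), by rw [e2, outerHeight_apply ha h]⟩

theorem spread_of_le_two {b : ℝ} (h : 1 ≤ b) (h' : b ≤ 2) : spread b = b - 1 := by
  rw [spread, abs_of_nonneg (by linarith), min_eq_left (by linarith), max_eq_right (by linarith)]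

theorem spread_of_le_three {b : ℝ} (h : 2 ≤ b) (h' : b ≤ 3) : spread b = 3 - b := by
  rw [spread, abs_of_nonneg (by linarith), min_eq_right (by linarith), max_eq_right (by linarith)]

theorem spread_of_ge {b : ℝ} (h : 3 ≤ b) : spread b = 0 := by
  rw [spread, abs_of_nonneg (by linarith), min_eq_right (by linarith), max_eq_left (by linarith)]

theorem spread_image_raisedShape :
    fiberX (fun y x => x + clip (spread y) x) '' quad raisedShape = quad spreadShape := by
  have hs : ∀ y, 0 ≤ spread y := fun y => le_max_left _ _
  apply fiberX_image_quad
  · intro y x; simp [spread]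
  · intro y x; rw [clip_neg (hs y)]; ring
  · intro y x hx
    rw [clip_of_nonneg (hs y) hx]
    linarith [le_min (hs y) hx]
  · intro a b ha hb h
    simp only [clip_of_nonneg (hs b) ha]
    rcases h with ⟨h, h1⟩ | ⟨h, h', h1⟩ | ⟨h1, h, h'⟩ | ⟨h, h1⟩
    · rcases le_total b 2 with h2 | h2
      · refine Or.inl ⟨by linarith, h2, Or.inl ?_⟩
        rw [spread_of_le_two (by linarith) h2, min_eq_left (by linarith)]; linarith
      · refine Or.inr (Or.inl ⟨h2, by linarith, ?_⟩)
        rw [spread_of_le_three h2 (by linarith), min_eq_left (by linarith)]; linarith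
    · refine Or.inl ⟨by linarith, by linarith, Or.inr ?_⟩
      rw [spread_of_le_two (by linarith) (by linarith), min_eq_left (by linarith)]; linarith
    · refine Or.inr (Or.inr (Or.inl ⟨h, h', ?_⟩))
      rw [spread_of_le_three h (by linarith), min_eq_left (by linarith)]; linarith
    · rcases le_total b 3 with h2 | h2
      · refine Or.inr (Or.inr (Or.inr (Or.inl ⟨by linarith, h2, ?_⟩)))
        rw [spread_of_le_three (by linarith) h2, min_eq_left (by linarith)]; linarith
      · refine Or.inr (Or.inr (Or.inr (Or.inr ⟨h2, by linarith, ?_⟩)))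
        rw [spread_of_ge h2, min_eq_left ha]; linarith
  · intro a b ha hb h
    rcases h with ⟨h, h', h1 | h1⟩ | ⟨h, h', h1⟩ | ⟨h, h', h1⟩ | ⟨h, h', h1⟩ | ⟨h, h', h1⟩
    · refine ⟨3 - b, by linarith, Or.inl ⟨by linarith, by ring⟩, ?_⟩
      rw [clip_of_nonneg (hs b) (by linarith), spread_of_le_two h h', min_eq_left (by linarith)]
      linarith
    · refine ⟨2 * b + 2, by linarith,
        Or.inr (Or.inl ⟨by linarith, by linarith, by ring⟩), ?_⟩
      rw [clip_of_nonneg (hs b) (by linarith), spread_of_le_two h h', min_eq_left (by linarith)]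
      linarith
    · refine ⟨3 - b, by linarith, Or.inl ⟨by linarith, by ring⟩, ?_⟩
      rw [clip_of_nonneg (hs b) (by linarith), spread_of_le_three h h', min_eq_left (by linarith)]
      linarith
    · refine ⟨6, by norm_num, Or.inr (Or.inr (Or.inl ⟨rfl, h, h'⟩)), ?_⟩
      rw [clip_of_nonneg (hs b) (by linarith), spread_of_le_three h (by linarith),
        min_eq_left (by linarith)]
      linarith
    · refine ⟨16 - 4 * b, by linarith,
        Or.inr (Or.inr (Or.inr ⟨by linarith, by ring⟩)), ?_⟩
      rw [clip_of_nonneg (hs b) (by linarith), spread_of_le_three (by linarith) h',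
        min_eq_left (by linarith)]
      linarith
    · refine ⟨16 - 4 * b, by linarith,
        Or.inr (Or.inr (Or.inr ⟨by linarith, by ring⟩)), ?_⟩
      rw [clip_of_nonneg (hs b) (by linarith), spread_of_ge h, min_eq_left (by linarith)]
      linarith

theorem fixedWidth_of_le_two {b : ℝ} (h0 : 0 ≤ b) (h' : b ≤ 2) : fixedWidth b = 2 := by
  rw [fixedWidth, abs_of_nonneg h0, min_eq_left (by linarith), max_eq_right (by linarith)]

theorem fixedWidth_of_le_three {b : ℝ} (h : 2 ≤ b) (h' : b ≤ 3) : fixedWidth b = 6 - 2 * b := by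
  rw [fixedWidth, abs_of_nonneg (by linarith), min_eq_right (by linarith),
    max_eq_right (by linarith)]

theorem fixedWidth_of_ge {b : ℝ} (h : 3 ≤ b) : fixedWidth b = 0 := by
  rw [fixedWidth, abs_of_nonneg (by linarith), min_eq_right (by linarith),
    max_eq_left (by linarith)]

theorem outerSpread_of_le_two {b : ℝ} (h : 1 ≤ b) (h' : b ≤ 2) : outerSpread b = 3 * b - 3 := by
  rw [outerSpread, abs_of_nonneg (by linarith), max_eq_left (by linarith : 8 - 2 * b ≤ _),
    min_eq_left (by linarith : 1 + b ≤ _), min_eq_left (by linarith), max_eq_right (by linarith)]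

theorem outerSpread_of_le {b : ℝ} (h : 2 ≤ b) (h' : b ≤ 5 / 2) : outerSpread b = 1 + b := by
  rw [outerSpread, abs_of_nonneg (by linarith), max_eq_left (by linarith : 8 - 2 * b ≤ _),
    min_eq_left (by linarith : 1 + b ≤ _), min_eq_right (by linarith), max_eq_right (by linarith)]

theorem outerSpread_of_le_three {b : ℝ} (h : 5 / 2 ≤ b) (h' : b ≤ 3) :
    outerSpread b = 11 - 3 * b := by
  rw [outerSpread, abs_of_nonneg (by linarith), max_eq_left (by linarith : 8 - 2 * b ≤ _),
    min_eq_right (by linarith : _ ≤ 1 + b), min_eq_right (by linarith), max_eq_right (by linarith)]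

theorem outerSpread_of_le_four {b : ℝ} (h : 3 ≤ b) (h' : b ≤ 4) :
    outerSpread b = 8 - 2 * b := by
  rw [outerSpread, abs_of_nonneg (by linarith), max_eq_right (by linarith : _ ≤ 8 - 2 * b),
    min_eq_right (by linarith : _ ≤ 1 + b), min_eq_right (by linarith), max_eq_right (by linarith)]

theorem outerSpread_image_bendShape :
    fiberX (fun y x => x + clip (outerSpread y) (2 * (x - clip (fixedWidth y) x)))
      '' quad bendShape = quad spreadShape := by
  have hs : ∀ y, 0 ≤ outerSpread y := fun y => le_max_left _ _
  have hw : ∀ y, 0 ≤ fixedWidth y := fun y => le_max_left _ _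
  have hin : ∀ y x, 0 ≤ x → x ≤ fixedWidth y →
      x + clip (outerSpread y) (2 * (x - clip (fixedWidth y) x)) = x := by
    intro y x h0 hx
    rw [clip_of_nonneg (hw y) h0, min_eq_right hx, sub_self, mul_zero,
      clip_of_nonneg (hs y) le_rfl, min_eq_right (hs y), add_zero]
  have hout : ∀ y x, fixedWidth y ≤ x → outerSpread y ≤ 2 * (x - fixedWidth y) →
      x + clip (outerSpread y) (2 * (x - clip (fixedWidth y) x)) = x + outerSpread y := by
    intro y x h0 hx
    rw [clip_of_nonneg (hw y) ((hw y).trans h0), min_eq_left h0,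
      clip_of_nonneg (hs y) (by linarith), min_eq_left hx]
  apply fiberX_image_quad
  · intro y x; simp [outerSpread, fixedWidth]
  · intro y x
    have : 2 * (-x - -clip (fixedWidth y) x) = -(2 * (x - clip (fixedWidth y) x)) := by ring
    rw [clip_neg (hw y), this, clip_neg (hs y)]; ring
  · intro y x hx
    have h1 : 0 ≤ 2 * (x - clip (fixedWidth y) x) := by
      rw [clip_of_nonneg (hw y) hx]; linarith [min_le_right (fixedWidth y) x]
    rw [clip_of_nonneg (hs y) h1]
    linarith [le_min (hs y) h1]
  · rintro a b ha hb (⟨h, h', rfl | rfl⟩ | ⟨h, h1 | h1⟩)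
    · rw [hin b _ ha (fixedWidth_of_le_two hb h').ge]
      exact Or.inl ⟨h, h', Or.inl rfl⟩
    · rw [hout b _, outerSpread_of_le_two h h']
      · exact Or.inl ⟨h, h', Or.inr (by ring)⟩
      · rw [fixedWidth_of_le_two hb h']; norm_num
      · rw [fixedWidth_of_le_two hb h', outerSpread_of_le_two h h']; linarith
    · have h3 : b ≤ 3 := by linarith
      rw [hin b _ ha (by rw [fixedWidth_of_le_three h h3]; linarith)]
      exact Or.inr (Or.inl ⟨h, h3, by linarith⟩)
    · rcases le_total b (5 / 2) with h2 | h2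
      · rw [hout b _, outerSpread_of_le h h2]
        · exact Or.inr (Or.inr (Or.inl ⟨h, h2, by linarith⟩))
        · rw [fixedWidth_of_le_three h (by linarith)]; linarith
        · rw [fixedWidth_of_le_three h (by linarith), outerSpread_of_le h h2]; linarith
      rcases le_total b 3 with h3 | h3
      · rw [hout b _, outerSpread_of_le_three h2 h3]
        · exact Or.inr (Or.inr (Or.inr (Or.inl ⟨h2, h3, by linarith⟩)))
        · rw [fixedWidth_of_le_three h h3]; linarith
        · rw [fixedWidth_of_le_three h h3, outerSpread_of_le_three h2 h3]; linarith
      · rw [hout b _, outerSpread_of_le_four h3 (by linarith)]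
        · exact Or.inr (Or.inr (Or.inr (Or.inr ⟨h3, by linarith, by linarith⟩)))
        · rw [fixedWidth_of_ge h3]; exact ha
        · rw [fixedWidth_of_ge h3, outerSpread_of_le_four h3 (by linarith)]; linarith
  · rintro a b ha hb (⟨h, h', h1 | h1⟩ | ⟨h, h', h1⟩ | ⟨h, h', h1⟩ | ⟨h, h', h1⟩ | ⟨h, h', h1⟩)
    · refine ⟨2, by norm_num, Or.inl ⟨h, h', Or.inl rfl⟩, ?_⟩
      rw [hin b _ (by norm_num) (fixedWidth_of_le_two hb h').ge, h1]
    · refine ⟨4, by norm_num, Or.inl ⟨h, h', Or.inr rfl⟩, ?_⟩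
      rw [hout b _, outerSpread_of_le_two h h']
      · linarith
      · rw [fixedWidth_of_le_two hb h']; norm_num
      · rw [fixedWidth_of_le_two hb h', outerSpread_of_le_two h h']; linarith
    · refine ⟨6 - 2 * b, by linarith, Or.inr ⟨h, Or.inl (by ring)⟩, ?_⟩
      rw [hin b _ (by linarith) (fixedWidth_of_le_three h h').ge, h1]
    · refine ⟨8 - 2 * b, by linarith, Or.inr ⟨h, Or.inr (by ring)⟩, ?_⟩
      rw [hout b _, outerSpread_of_le h h']
      · linarith
      · rw [fixedWidth_of_le_three h (by linarith)]; linarith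
      · rw [fixedWidth_of_le_three h (by linarith), outerSpread_of_le h h']; linarith
    · refine ⟨8 - 2 * b, by linarith, Or.inr ⟨by linarith, Or.inr (by ring)⟩, ?_⟩
      rw [hout b _, outerSpread_of_le_three h h']
      · linarith
      · rw [fixedWidth_of_le_three (by linarith) h']; linarith
      · rw [fixedWidth_of_le_three (by linarith) h', outerSpread_of_le_three h h']; linarith
    · refine ⟨8 - 2 * b, by linarith, Or.inr ⟨by linarith, Or.inr (by ring)⟩, ?_⟩
      rw [hout b _, outerSpread_of_le_four h h']
      · linarith
      · rw [fixedWidth_of_ge h]; linarith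
      · rw [fixedWidth_of_ge h, outerSpread_of_le_four h h']; linarith

theorem closure₂_eq (A B : Set Space) :
    closure₂ A B = vBox (-3) (-1) 1 '' A ∪ vBox 3 (-1) 1 '' B ∪ quad rowShape := by
  have h1 : hBox (-4) (-2) = vBox (-3) (-1) 1 := by
    funext w; simp only [hBox, vBox]; norm_num
  have h2 : hBox 2 4 = vBox 3 (-1) 1 := by
    funext w; simp only [hBox, vBox]; norm_num
  rw [closure₂, row, h1, h2]
  congr 1
  ext ⟨x, y, z⟩
  simp only [hLines, rowArcs, quad, rowShape, Set.mem_union, Set.mem_ofPred_eq]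
  constructor
  · rintro (((⟨h1, h2, h3, h4⟩ | ⟨h1, h2, h3, h4⟩) | ⟨h1, h2, h3, h4⟩) | ⟨h4, ⟨h1, h2, h3⟩ | h1⟩)
    · refine ⟨h4, Or.inl ⟨h3, Or.inr ?_⟩⟩
      rw [abs_of_nonpos (by linarith)]; constructor <;> linarith
    · exact ⟨h4, Or.inl ⟨h3, Or.inl (abs_le.2 ⟨h1, h2⟩)⟩⟩
    · refine ⟨h4, Or.inl ⟨h3, Or.inr ?_⟩⟩
      rw [abs_of_nonneg (by linarith)]; constructor <;> linarith
    · exact ⟨h4, Or.inr (Or.inl ⟨h1, h2, h3⟩)⟩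
    · exact ⟨h4, Or.inr (Or.inr h1)⟩
  · rintro ⟨h4, ⟨h3, h | ⟨h, h'⟩⟩ | h | h⟩
    · obtain ⟨h1, h2⟩ := abs_le.1 h
      exact Or.inl (Or.inl (Or.inr ⟨h1, h2, h3, h4⟩))
    · rcases le_total 0 x with hx | hx
      · rw [abs_of_nonneg hx] at h h'
        exact Or.inl (Or.inr ⟨h, h', h3, h4⟩)
      · rw [abs_of_nonpos hx] at h h'
        exact Or.inl (Or.inl (Or.inl ⟨by linarith, by linarith, h3, h4⟩))
    · exact Or.inr ⟨h4, Or.inl h⟩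
    · exact Or.inr ⟨h4, Or.inr h⟩

theorem bendClosure_eq (A B : Set Space) :
    bendClosure A B = vBox (-3) (-1) 1 '' A ∪ vBox 3 (-1) 1 '' B ∪ quad bendShape := by
  rw [bendClosure, bendRow]
  congr 1
  have hl : ∀ x : ℝ, |x - -3| = 1 ↔ x = -2 ∨ x = -4 := by
    intro x
    rw [abs_eq zero_le_one]
    constructor <;> rintro (h | h)
    exacts [Or.inl (by linarith), Or.inr (by linarith), Or.inl (by linarith), Or.inr (by linarith)]
  have hr : ∀ x : ℝ, |x - 3| = 1 ↔ x = 4 ∨ x = 2 := by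
    intro x
    rw [abs_eq zero_le_one]
    constructor <;> rintro (h | h)
    exacts [Or.inl (by linarith), Or.inr (by linarith), Or.inl (by linarith), Or.inr (by linarith)]
  ext ⟨x, y, z⟩
  simp only [vLines, bendArcs, quad, bendShape, Set.mem_union, Set.mem_ofPred_eq, hl, hr]
  constructor
  · rintro ((((⟨h1, h2, h3, h4⟩ | ⟨h1, h2, h3, h4⟩) | ⟨h1, h2, h3, h4⟩) | ⟨h1, h2, h3, h4⟩) |
      ⟨h4, h1⟩)
    · rw [abs_of_nonpos (by linarith : y ≤ 0)]
      refine ⟨h4, Or.inl ⟨by linarith, by linarith, ?_⟩⟩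
      rcases h3 with rfl | rfl <;> norm_num
    · rw [abs_of_nonneg (by linarith : 0 ≤ y)]
      refine ⟨h4, Or.inl ⟨by linarith, by linarith, ?_⟩⟩
      rcases h3 with rfl | rfl <;> norm_num
    · rw [abs_of_nonpos (by linarith : y ≤ 0)]
      refine ⟨h4, Or.inl ⟨by linarith, by linarith, ?_⟩⟩
      rcases h3 with rfl | rfl <;> norm_num
    · rw [abs_of_nonneg (by linarith : 0 ≤ y)]
      refine ⟨h4, Or.inl ⟨by linarith, by linarith, ?_⟩⟩
      rcases h3 with rfl | rfl <;> norm_num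
    · exact ⟨h4, Or.inr h1⟩
  · rintro ⟨h4, ⟨h1, h2, h3⟩ | h⟩
    · have hx : (x = -2 ∨ x = -4) ∨ (x = 4 ∨ x = 2) := by
        rcases h3 with h | h <;> rcases eq_or_eq_neg_of_abs_eq h with h | h <;> simp [h]
      rcases le_total 0 y with hy | hy
      · rw [abs_of_nonneg hy] at h1 h2
        rcases hx with hx | hx
        · exact Or.inl (Or.inl (Or.inl (Or.inr ⟨h1, h2, hx, h4⟩)))
        · exact Or.inl (Or.inr ⟨h1, h2, hx, h4⟩)
      · rw [abs_of_nonpos hy] at h1 h2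
        rcases hx with hx | hx
        · exact Or.inl (Or.inl (Or.inl (Or.inl ⟨by linarith, by linarith, hx, h4⟩)))
        · exact Or.inl (Or.inl (Or.inr ⟨by linarith, by linarith, hx, h4⟩))
    · exact Or.inr ⟨h4, h⟩

/-- The two standard positions of a numerator closure differ by an isotopy of the plane that is
fixed on the boxes. -/
theorem ambientIsotopic_closure₂_bendClosure {A B : Set Space} (hA : A ⊆ cube) (hB : B ⊆ cube) :
    AmbientIsotopic (closure₂ A B) (bendClosure A B) := by
  set C := vBox (-3) (-1) 1 '' A ∪ vBox 3 (-1) 1 '' B with hC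
  have hCbox : ∀ q ∈ C, 2 ≤ |q.1| ∧ |q.1| ≤ 4 ∧ |q.2.1| ≤ 1 := by
    rintro _ (⟨w, hw, rfl⟩ | ⟨w, hw, rfl⟩)
    · obtain ⟨h1, h2, _⟩ := hA hw
      obtain ⟨h3, h4⟩ := abs_le.1 h1
      simp only [vBox]
      rw [abs_of_nonpos (by linarith : -3 + w.1 ≤ 0)]
      refine ⟨by linarith, by linarith, ?_⟩
      norm_num
      exact h2
    · obtain ⟨h1, h2, _⟩ := hB hw
      obtain ⟨h3, h4⟩ := abs_le.1 h1
      simp only [vBox]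
      rw [abs_of_nonneg (by linarith : 0 ≤ 3 + w.1)]
      refine ⟨by linarith, by linarith, ?_⟩
      norm_num
      exact h2
  have hfix : ∀ F : Space → Space, (∀ q : Space, 2 ≤ |q.1| → |q.1| ≤ 4 → |q.2.1| ≤ 1 → F q = q) →
      F '' C = C := by
    intro F hF
    rw [Set.image_congr fun q hq => hF q (hCbox q hq).1 (hCbox q hq).2.1 (hCbox q hq).2.2]
    exact Set.image_id _
  have hcl : ∀ {d x : ℝ}, |x| ≤ d → clip d x = x := by
    intro d x h
    obtain ⟨h1, h2⟩ := abs_le.1 h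
    rw [clip, min_eq_right h2, max_eq_right h1]
  have hcl0 : ∀ x, clip 0 x = 0 := fun x => by
    have := abs_clip_le (d := 0) (x := x) le_rfl
    exact abs_nonpos_iff.1 this
  have f1 : fiberY raise '' C = C := by
    refine hfix _ fun q h1 h2 h3 => ?_
    simp only [fiberY, raise, hcl h3, hcl (h3.trans one_le_two), innerHeight_box h1 h2]
    ext <;> simp
  have f2 : fiberX (fun y x => x + clip (spread y) x) '' C = C := by
    refine hfix _ fun q h1 h2 h3 => ?_
    have : spread q.2.1 = 0 := max_eq_left ((min_le_left _ _).trans (by linarith))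
    simp [fiberX, this, hcl0]
  have f3 : fiberX (fun y x => x + clip (outerSpread y) (2 * (x - clip (fixedWidth y) x))) '' C
      = C := by
    refine hfix _ fun q h1 h2 h3 => ?_
    have : outerSpread q.2.1 = 0 := max_eq_left ((min_le_left _ _).trans (by linarith))
    simp [fiberX, this, hcl0]
  have g1 := ambientIsotopic_raise (closure₂ A B)
  rw [closure₂_eq, Set.image_union, ← hC, f1, raise_image_rowShape] at g1
  have g2 := ambientIsotopic_spread (C ∪ quad raisedShape)
  rw [Set.image_union, f2, spread_image_raisedShape] at g2
  have g3 := ambientIsotopic_outerSpread (bendClosure A B)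
  rw [bendClosure_eq, Set.image_union, ← hC, f3, outerSpread_image_bendShape] at g3
  rw [closure₂_eq, bendClosure_eq, ← hC]
  exact g1.trans (g2.trans g3.symm)

end Tangles

/-! ### A rectangle is unknotted -/

namespace Tangles

theorem unitCircle_eq_quad : unitCircle = quad fun a b => a ^ 2 + b ^ 2 = 1 := by
  ext p
  simp only [unitCircle, quad, Set.mem_ofPred_eq, sq_abs]
  exact and_comm

/-- The factor by which the elliptical grid mapping shrinks a line at distance `x` from its axis. -/
noncomputable def gridFactor (x : ℝ) : ℝ := Real.sqrt (1 - min (x ^ 2) 1 / 2)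

theorem gridFactor_sq (x : ℝ) : gridFactor x ^ 2 = 1 - min (x ^ 2) 1 / 2 :=
  Real.sq_sqrt (by linarith [min_le_right (x ^ 2) 1])

theorem gridFactor_pos (x : ℝ) : 0 < gridFactor x :=
  Real.sqrt_pos.2 (by linarith [min_le_right (x ^ 2) 1])

theorem continuous_gridFactor : Continuous gridFactor := by unfold gridFactor; fun_prop

/-- The part of a line in `[-1, 1]` is scaled by the factor `k`. -/
noncomputable def shrink (k y : ℝ) : ℝ := k * clip 1 y + (y - clip 1 y)

theorem shrink_of_le {k y : ℝ} (h0 : 0 ≤ y) (h : y ≤ 1) : shrink k y = k * y := by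
  rw [shrink, clip_of_nonneg zero_le_one h0, min_eq_right h]; ring

theorem shrink_neg {k y : ℝ} : shrink k (-y) = -shrink k y := by
  rw [shrink, shrink, clip_neg zero_le_one]; ring

theorem shrink_nonneg {k y : ℝ} (hk : 0 < k) (h : 0 ≤ y) : 0 ≤ shrink k y := by
  rw [shrink, clip_of_nonneg zero_le_one h]
  have := mul_nonneg hk.le (le_min zero_le_one h)
  linarith [min_le_right 1 y]

theorem strictMono_shrink {k : ℝ} (hk : 0 < k) : StrictMono (shrink k) := by
  intro x y h
  have h1 := clip_mono (d := 1) h.le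
  have h2 := clip_sub_le (d := 1) h.le
  unfold shrink
  rcases h1.eq_or_lt with h1 | h1
  · rw [h1]; linarith
  · nlinarith

theorem shrink_bounded (k y : ℝ) : |shrink k y - y| ≤ |k - 1| * 1 := by
  have : shrink k y - y = (k - 1) * clip 1 y := by unfold shrink; ring
  rw [this, abs_mul]
  gcongr
  exact abs_clip_le zero_le_one

theorem continuous_shrink {k : ℝ → ℝ} (hk : Continuous k) :
    Continuous fun q : ℝ × ℝ => shrink (k q.1) q.2 := by
  unfold shrink clip; fun_prop

/-- The square is mapped to the disc by the elliptical grid mapping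
`(x, y) ↦ (x √(1 - y² / 2), y √(1 - x² / 2))`, which is carried out one coordinate at a time. -/
theorem isUnknot_square : IsUnknot (quad fun a b => (a = 1 ∧ b ≤ 1) ∨ (a ≤ 1 ∧ b = 1)) := by
  have hg : ∀ a, 0 ≤ a → a ≤ 1 → gridFactor a ^ 2 = 1 - a ^ 2 / 2 := fun a h0 h => by
    rw [gridFactor_sq, min_eq_left (pow_le_one₀ h0 h)]
  have i1 := ambientIsotopic_fiberY (fun x => shrink (gridFactor x))
    (continuous_shrink continuous_gridFactor) (fun x => strictMono_shrink (gridFactor_pos x))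
    (fun x => ⟨_, shrink_bounded _⟩) (quad fun a b => (a = 1 ∧ b ≤ 1) ∨ (a ≤ 1 ∧ b = 1))
  have e1 : fiberY (fun x => shrink (gridFactor x))
      '' quad (fun a b => (a = 1 ∧ b ≤ 1) ∨ (a ≤ 1 ∧ b = 1))
      = quad fun a b => (a = 1 ∧ b ^ 2 ≤ 1 / 2) ∨ (a ≤ 1 ∧ b ^ 2 = 1 - a ^ 2 / 2) := by
    apply fiberY_image_quad
    · intro x y; simp [gridFactor]
    · intro x y; exact shrink_neg
    · intro x y; exact shrink_nonneg (gridFactor_pos x)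
    · rintro a b ha hb (⟨rfl, h⟩ | ⟨h, rfl⟩)
      · refine Or.inl ⟨rfl, ?_⟩
        rw [shrink_of_le hb h, mul_pow, hg 1 zero_le_one le_rfl]
        have := pow_le_one₀ hb h (n := 2)
        linarith
      · exact Or.inr ⟨h, by rw [shrink_of_le hb le_rfl, mul_one, hg a ha h]⟩
    · rintro a b ha hb (⟨rfl, h⟩ | ⟨h, h'⟩)
      · have h0 := gridFactor_pos 1
        have h1 := hg 1 zero_le_one le_rfl
        have h2 : b / gridFactor 1 ≤ 1 := by
          rw [div_le_one h0]
          exact abs_le_of_sq_le_sq' (by linarith) h0.le |>.2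
        refine ⟨b / gridFactor 1, by positivity, Or.inl ⟨rfl, h2⟩, ?_⟩
        rw [shrink_of_le (by positivity) h2]; field_simp
      · refine ⟨1, zero_le_one, Or.inr ⟨h, rfl⟩, ?_⟩
        rw [shrink_of_le zero_le_one le_rfl, mul_one]
        exact (pow_left_inj₀ (gridFactor_pos a).le hb two_ne_zero).1 (by rw [hg a ha h, h'])
  -- After the first step the factor depends on `y` through `min (y ^ 2) (1 / 2)`.
  set κ : ℝ → ℝ := fun y => Real.sqrt (1 - min (y ^ 2) (1 / 2)) with hκ
  have hκ0 : ∀ y, 0 < κ y := fun y => Real.sqrt_pos.2 (by linarith [min_le_right (y ^ 2) (1 / 2)])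
  have hκ2 : ∀ y, κ y ^ 2 = 1 - min (y ^ 2) (1 / 2) := fun y =>
    Real.sq_sqrt (by linarith [min_le_right (y ^ 2) (1 / 2)])
  have i2 := ambientIsotopic_fiberX (fun y => shrink (κ y))
    (continuous_shrink (by fun_prop)) (fun x => strictMono_shrink (hκ0 x))
    (fun x => ⟨_, shrink_bounded _⟩)
    (quad fun a b => (a = 1 ∧ b ^ 2 ≤ 1 / 2) ∨ (a ≤ 1 ∧ b ^ 2 = 1 - a ^ 2 / 2))
  have e2 : fiberX (fun y => shrink (κ y))
      '' quad (fun a b => (a = 1 ∧ b ^ 2 ≤ 1 / 2) ∨ (a ≤ 1 ∧ b ^ 2 = 1 - a ^ 2 / 2))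
      = quad fun a b => a ^ 2 + b ^ 2 = 1 := by
    apply fiberX_image_quad
    · intro x y; simp [hκ]
    · intro x y; exact shrink_neg
    · intro x y; exact shrink_nonneg (hκ0 x)
    · rintro a b ha hb (⟨rfl, h⟩ | ⟨h, h'⟩)
      · rw [shrink_of_le zero_le_one le_rfl, mul_one, hκ2, min_eq_left h]; ring
      · have h2 := pow_le_one₀ ha h (n := 2)
        rw [shrink_of_le ha h, mul_pow, hκ2, min_eq_right (by linarith), h']; ring
    · intro a b ha hb h
      rcases le_total (b ^ 2) (1 / 2) with hb2 | hb2
      · refine ⟨1, zero_le_one, Or.inl ⟨rfl, hb2⟩, ?_⟩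
        rw [shrink_of_le zero_le_one le_rfl, mul_one]
        refine (pow_left_inj₀ (hκ0 b).le ha two_ne_zero).1 ?_
        rw [hκ2, min_eq_left hb2]; linarith
      · have h1 := hκ2 b
        rw [min_eq_right hb2] at h1
        have h0 := hκ0 b
        have h2 : a / κ b ≤ 1 := by
          rw [div_le_one h0]
          exact abs_le_of_sq_le_sq' (by linarith) h0.le |>.2
        refine ⟨a / κ b, by positivity, Or.inr ⟨h2, ?_⟩, ?_⟩
        · rw [div_pow, h1]
          have : a ^ 2 / (1 - 1 / 2) / 2 = a ^ 2 := by ring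
          linarith
        · rw [shrink_of_le (by positivity) h2]; field_simp
  rw [e1] at i1
  rw [e2, ← unitCircle_eq_quad] at i2
  exact i1.trans i2

theorem isUnknot_rectangle : IsUnknot (quad fun a b => (a = 6 ∧ b ≤ 2) ∨ (a ≤ 6 ∧ b = 2)) := by
  have h : AmbientIsotopic (quad fun a b => (a = 1 ∧ b ≤ 1) ∨ (a ≤ 1 ∧ b = 1)) _ :=
    ambientIsotopic_stretch (a := 6) (b := 2) (by norm_num) (by norm_num) _
  have e : stretch 6 2 '' quad (fun a b => (a = 1 ∧ b ≤ 1) ∨ (a ≤ 1 ∧ b = 1))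
      = quad fun a b => (a = 6 ∧ b ≤ 2) ∨ (a ≤ 6 ∧ b = 2) := by
    ext ⟨x, y, z⟩
    constructor
    · rintro ⟨⟨x', y', z'⟩, ⟨h1, h2⟩, h3⟩
      simp only [stretch, Prod.mk.injEq] at h1 h2 h3
      obtain ⟨rfl, rfl, rfl⟩ := h3
      refine ⟨h1, ?_⟩
      simp only [abs_mul, abs_of_pos (by norm_num : (0 : ℝ) < 6),
        abs_of_pos (by norm_num : (0 : ℝ) < 2)]
      rcases h2 with ⟨h, h'⟩ | ⟨h, h'⟩
      · exact Or.inl ⟨by linarith, by linarith⟩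
      · exact Or.inr ⟨by linarith, by linarith⟩
    · rintro ⟨h1, h2⟩
      refine ⟨(x / 6, y / 2, z), ⟨h1, ?_⟩, by simp only [stretch]; ext <;> simp <;> ring⟩
      simp only [abs_div, abs_of_pos (by norm_num : (0 : ℝ) < 6),
        abs_of_pos (by norm_num : (0 : ℝ) < 2)] at h2 ⊢
      rcases h2 with ⟨h, h'⟩ | ⟨h, h'⟩
      · exact Or.inl ⟨by linarith, by linarith⟩
      · exact Or.inr ⟨by linarith, by linarith⟩
  rw [e] at h
  exact isUnknot_square.of_ambientIsotopic h.symm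

end Tangles

/-! ### The closure of `[∞]` and `[0]` -/

namespace Tangles

/-- The height to which the strands at `y = 1` are moved: it is `1` for `-4 ≤ x ≤ -2` and grows
linearly to `3 / 2` at `x = ±6`. -/
noncomputable def finHeight (x : ℝ) : ℝ :=
  1 + max 0 (min (1 / 2) ((x + 2) / 16)) + max 0 (min (1 / 2) ((-4 - x) / 4))

/-- The map that raises the height `1` to `finHeight` and fixes the height `2`. -/
noncomputable def raiseFin (x y : ℝ) : ℝ :=
  finHeight x * clip 1 y + (2 - finHeight x) * (clip 2 y - clip 1 y) + (y - clip 2 y)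

theorem finHeight_of_left {x : ℝ} (h : -6 ≤ x) (h' : x ≤ -4) : finHeight x = -x / 4 := by
  rw [finHeight, min_eq_right (by linarith : (x + 2) / 16 ≤ _), max_eq_left (by linarith),
    min_eq_right (by linarith), max_eq_right (by linarith)]
  ring

theorem finHeight_of_mid {x : ℝ} (h : -4 ≤ x) (h' : x ≤ -2) : finHeight x = 1 := by
  rw [finHeight, min_eq_right (by linarith : (x + 2) / 16 ≤ _), max_eq_left (by linarith),
    min_eq_right (by linarith), max_eq_left (by linarith)]
  ring

theorem finHeight_of_right {x : ℝ} (h : -2 ≤ x) (h' : x ≤ 6) : finHeight x = 1 + (x + 2) / 16 := by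
  rw [finHeight, min_eq_right (by linarith : (x + 2) / 16 ≤ _), max_eq_right (by linarith),
    min_eq_right (by linarith), max_eq_left (by linarith)]
  ring

theorem finHeight_mem (x : ℝ) : 1 ≤ finHeight x ∧ finHeight x ≤ 3 / 2 := by
  have h1 := le_max_left 0 (min (1 / 2) ((x + 2) / 16))
  have h2 := le_max_left 0 (min (1 / 2) ((-4 - x) / 4))
  refine ⟨by unfold finHeight; linarith, ?_⟩
  unfold finHeight
  rcases le_total x (-2) with h | h
  · rw [min_eq_right (by linarith : (x + 2) / 16 ≤ _), max_eq_left (by linarith)]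
    have : max 0 (min (1 / 2) ((-4 - x) / 4)) ≤ 1 / 2 :=
      max_le (by norm_num) (min_le_left _ _)
    linarith
  · have h0 : max 0 (min (1 / 2) ((-4 - x) / 4)) = 0 :=
      max_eq_left ((min_le_right _ _).trans (by linarith))
    rw [h0]
    have : max 0 (min (1 / 2) ((x + 2) / 16)) ≤ 1 / 2 :=
      max_le (by norm_num) (min_le_left _ _)
    linarith

theorem raiseFin_of_le_one {x y : ℝ} (h : 0 ≤ y) (h' : y ≤ 1) :
    raiseFin x y = finHeight x * y := by
  rw [raiseFin, clip_of_nonneg zero_le_one h, clip_of_nonneg zero_le_two h, min_eq_right h',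
    min_eq_right (by linarith)]
  ring

theorem raiseFin_of_le_two {x y : ℝ} (h : 1 ≤ y) (h' : y ≤ 2) :
    raiseFin x y = finHeight x + (2 - finHeight x) * (y - 1) := by
  rw [raiseFin, clip_of_nonneg zero_le_one (by linarith), clip_of_nonneg zero_le_two (by linarith),
    min_eq_left h, min_eq_right h']
  ring

theorem strictMono_raiseFin (x : ℝ) : StrictMono (raiseFin x) := by
  intro y y' h
  obtain ⟨h1, h2⟩ := finHeight_mem x
  have h3 := clip_mono (d := 1) h.le
  have h4 := clip_two_sub_mono h.le
  have h5 := clip_sub_le (d := 2) h.le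
  have h6 : 1 / 2 * (clip 1 y' - clip 1 y) ≤ finHeight x * (clip 1 y' - clip 1 y) :=
    mul_le_mul_of_nonneg_right (by linarith) (by linarith)
  have h7 : 1 / 2 * ((clip 2 y' - clip 1 y') - (clip 2 y - clip 1 y)) ≤ _ :=
    mul_le_mul_of_nonneg_right (by linarith : 1 / 2 ≤ 2 - finHeight x)
      (by linarith : 0 ≤ (clip 2 y' - clip 1 y') - (clip 2 y - clip 1 y))
  unfold raiseFin
  linarith

theorem ambientIsotopic_raiseFin (K : Set Space) : AmbientIsotopic K (fiberY raiseFin '' K) := by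
  refine ambientIsotopic_fiberY _ ?_ strictMono_raiseFin (fun x => ⟨|finHeight x - 1| * 1 +
    |1 - finHeight x| * (2 + 1), fun y => ?_⟩) _
  · unfold raiseFin finHeight clip; fun_prop
  · have h1 : raiseFin x y - y = (finHeight x - 1) * clip 1 y
        + (1 - finHeight x) * (clip 2 y - clip 1 y) := by unfold raiseFin; ring
    have h2 : |clip 2 y - clip 1 y| ≤ 2 + 1 :=
      (abs_sub _ _).trans (add_le_add (abs_clip_le (by norm_num)) (abs_clip_le (by norm_num)))
    rw [h1]
    refine (abs_add_le _ _).trans ?_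
    rw [abs_mul, abs_mul]
    gcongr
    exact abs_clip_le (by norm_num)

/-- The part of the closure of `[∞]` and `[0]` in the half-plane `y ≥ 0`. -/
def finShape (x b : ℝ) : Prop :=
  (b = 1 ∧ (-6 ≤ x ∧ x ≤ -4 ∨ -2 ≤ x ∧ x ≤ 6)) ∨ (b ≤ 1 ∧ (x = -4 ∨ x = -2)) ∨
    ((x = -6 ∨ x = 6) ∧ 1 ≤ b ∧ b ≤ 2) ∨ (|x| ≤ 6 ∧ b = 2)

/-- The left end of the segment at height `b` inside the raised curve. -/
noncomputable def leftEnd (b : ℝ) : ℝ := max (-6) (min (-4) (-4 * b))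

/-- The right end of the segment at height `b` inside the raised curve. -/
noncomputable def rightEnd (b : ℝ) : ℝ := max (-2) (min 6 (16 * b - 18))

theorem leftEnd_of_le {b : ℝ} (h : b ≤ 1) : leftEnd b = -4 := by
  rw [leftEnd, min_eq_left (by linarith), max_eq_right (by norm_num)]

theorem leftEnd_of_mid {b : ℝ} (h : 1 ≤ b) (h' : b ≤ 3 / 2) : leftEnd b = -4 * b := by
  rw [leftEnd, min_eq_right (by linarith), max_eq_right (by linarith)]

theorem leftEnd_of_ge {b : ℝ} (h : 3 / 2 ≤ b) : leftEnd b = -6 := by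
  rw [leftEnd, min_eq_right (by linarith), max_eq_left (by linarith)]

theorem rightEnd_of_le {b : ℝ} (h : b ≤ 1) : rightEnd b = -2 := by
  rw [rightEnd, min_eq_right (by linarith), max_eq_left (by linarith)]

theorem rightEnd_of_mid {b : ℝ} (h : 1 ≤ b) (h' : b ≤ 3 / 2) : rightEnd b = 16 * b - 18 := by
  rw [rightEnd, min_eq_right (by linarith), max_eq_right (by linarith)]

theorem rightEnd_of_ge {b : ℝ} (h : 3 / 2 ≤ b) : rightEnd b = 6 := by
  rw [rightEnd, min_eq_left (by linarith), max_eq_right (by norm_num)]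

theorem leftEnd_mem (b : ℝ) : -6 ≤ leftEnd b ∧ leftEnd b ≤ -4 :=
  ⟨le_max_left _ _, max_le (by norm_num) (min_le_left _ _)⟩

theorem rightEnd_mem (b : ℝ) : -2 ≤ rightEnd b ∧ rightEnd b ≤ 6 :=
  ⟨le_max_left _ _, max_le (by norm_num) (min_le_left _ _)⟩

/-- The image of `finShape` under `raiseFin`. -/
def wedgeShape (x b : ℝ) : Prop :=
  (b ≤ 2 ∧ (x = leftEnd b ∨ x = rightEnd b)) ∨ (|x| ≤ 6 ∧ b = 2)

theorem raiseFin_image_finShape : fiberY raiseFin '' half finShape = half wedgeShape := by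
  apply fiberY_image_half
  · intro x y
    rw [raiseFin, raiseFin, clip_neg zero_le_one, clip_neg zero_le_two]; ring
  · intro x y hy
    have h := (strictMono_raiseFin x).monotone hy
    rwa [raiseFin_of_le_one le_rfl zero_le_one, mul_zero] at h
  · rintro x b hb (⟨rfl, ⟨h, h'⟩ | ⟨h, h'⟩⟩ | ⟨h, rfl | rfl⟩ | ⟨rfl | rfl, h, h'⟩ | ⟨h, rfl⟩)
    · rw [raiseFin_of_le_one hb le_rfl, finHeight_of_left h h']
      refine Or.inl ⟨by linarith, Or.inl ?_⟩
      rw [leftEnd_of_mid (by linarith) (by linarith)]; ring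
    · rw [raiseFin_of_le_one hb le_rfl, finHeight_of_right h h']
      refine Or.inl ⟨by linarith, Or.inr ?_⟩
      rw [rightEnd_of_mid (by linarith) (by linarith)]; ring
    · rw [raiseFin_of_le_one hb h, finHeight_of_mid le_rfl (by norm_num), one_mul]
      exact Or.inl ⟨by linarith, Or.inl (leftEnd_of_le h).symm⟩
    · rw [raiseFin_of_le_one hb h, finHeight_of_mid (by norm_num) le_rfl, one_mul]
      exact Or.inl ⟨by linarith, Or.inr (rightEnd_of_le h).symm⟩
    · rw [raiseFin_of_le_two h h', finHeight_of_left le_rfl (by norm_num)]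
      exact Or.inl ⟨by linarith, Or.inl (leftEnd_of_ge (by linarith)).symm⟩
    · rw [raiseFin_of_le_two h h', finHeight_of_right (by norm_num) le_rfl]
      exact Or.inl ⟨by linarith, Or.inr (rightEnd_of_ge (by linarith)).symm⟩
    · rw [raiseFin_of_le_two one_le_two le_rfl]
      exact Or.inr ⟨h, by ring⟩
  · rintro x b hb (⟨h, rfl | rfl⟩ | ⟨h, rfl⟩)
    · rcases le_total b 1 with h1 | h1
      · rw [leftEnd_of_le h1]
        refine ⟨b, hb, Or.inr (Or.inl ⟨h1, Or.inl rfl⟩), ?_⟩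
        rw [raiseFin_of_le_one hb h1, finHeight_of_mid le_rfl (by norm_num), one_mul]
      rcases le_total b (3 / 2) with h2 | h2
      · rw [leftEnd_of_mid h1 h2]
        refine ⟨1, zero_le_one, Or.inl ⟨rfl, Or.inl ⟨by linarith, by linarith⟩⟩, ?_⟩
        rw [raiseFin_of_le_one zero_le_one le_rfl, finHeight_of_left (by linarith) (by linarith)]
        ring
      · rw [leftEnd_of_ge h2]
        refine ⟨2 * b - 2, by linarith,
          Or.inr (Or.inr (Or.inl ⟨Or.inl rfl, by linarith, by linarith⟩)), ?_⟩
        rw [raiseFin_of_le_two (by linarith) (by linarith),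
          finHeight_of_left le_rfl (by norm_num)]
        ring
    · rcases le_total b 1 with h1 | h1
      · rw [rightEnd_of_le h1]
        refine ⟨b, hb, Or.inr (Or.inl ⟨h1, Or.inr rfl⟩), ?_⟩
        rw [raiseFin_of_le_one hb h1, finHeight_of_mid (by norm_num) le_rfl, one_mul]
      rcases le_total b (3 / 2) with h2 | h2
      · rw [rightEnd_of_mid h1 h2]
        refine ⟨1, zero_le_one, Or.inl ⟨rfl, Or.inr ⟨by linarith, by linarith⟩⟩, ?_⟩
        rw [raiseFin_of_le_one zero_le_one le_rfl, finHeight_of_right (by linarith) (by linarith)]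
        ring
      · rw [rightEnd_of_ge h2]
        refine ⟨2 * b - 2, by linarith,
          Or.inr (Or.inr (Or.inl ⟨Or.inr rfl, by linarith, by linarith⟩)), ?_⟩
        rw [raiseFin_of_le_two (by linarith) (by linarith),
          finHeight_of_right (by norm_num) le_rfl]
        ring
    · refine ⟨2, zero_le_two, Or.inr (Or.inr (Or.inr ⟨h, rfl⟩)), ?_⟩
      rw [raiseFin_of_le_two one_le_two le_rfl]; ring

/-- The truncation of `x` to the segment between `leftEnd b` and `rightEnd b`. -/
noncomputable def chop (b x : ℝ) : ℝ := max (leftEnd b) (min x (rightEnd b))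

/-- The map that stretches the segment between `leftEnd b` and `rightEnd b` to `[-6, 6]`. -/
noncomputable def widen (b x : ℝ) : ℝ :=
  -6 + 12 * (chop b x - leftEnd b) / (rightEnd b - leftEnd b) + (x - chop b x)

theorem ambientIsotopic_widen (K : Set Space) :
    AmbientIsotopic K (fiberX (fun y => widen |y|) '' K) := by
  have hd : ∀ b, 0 < rightEnd b - leftEnd b := fun b => by
    linarith [(leftEnd_mem b).2, (rightEnd_mem b).1]
  refine ambientIsotopic_fiberX _ ?_ (fun y x x' h => ?_) (fun y => ⟨12, fun x => ?_⟩) K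
  · have h : ∀ q : ℝ × ℝ, rightEnd |q.1| - leftEnd |q.1| ≠ 0 := fun q => (hd _).ne'
    unfold widen chop
    refine Continuous.add (continuous_const.add (Continuous.div ?_ ?_ h)) ?_ <;>
    · unfold leftEnd rightEnd; fun_prop
  · have h1 : chop |y| x ≤ chop |y| x' := max_le_max le_rfl (min_le_min h.le le_rfl)
    have h2 : chop |y| x' - chop |y| x ≤ x' - x := by
      have h3 : min x' (rightEnd |y|) ≤ min x (rightEnd |y|) + (x' - x) := by
        rw [← min_add_add_right]
        exact le_min (by linarith [min_le_left x' (rightEnd |y|)])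
          (by linarith [min_le_right x' (rightEnd |y|)])
      have h4 : chop |y| x' ≤ chop |y| x + (x' - x) := by
        unfold chop
        exact max_le (by linarith [le_max_left (leftEnd |y|) (min x (rightEnd |y|))])
          (by linarith [le_max_right (leftEnd |y|) (min x (rightEnd |y|))])
      linarith
    unfold widen
    rcases h1.eq_or_lt with h1 | h1
    · rw [h1]; linarith
    · have := div_lt_div_of_pos_right
        (by linarith : 12 * (chop |y| x - leftEnd |y|) < 12 * (chop |y| x' - leftEnd |y|)) (hd |y|)
      linarith
  · have hL := leftEnd_mem |y|
    have hR := rightEnd_mem |y|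
    have h1 : leftEnd |y| ≤ chop |y| x := le_max_left _ _
    have h2 : chop |y| x ≤ rightEnd |y| := max_le (by linarith) (min_le_right _ _)
    have h3 : 0 ≤ 12 * (chop |y| x - leftEnd |y|) / (rightEnd |y| - leftEnd |y|) :=
      div_nonneg (by linarith) (hd _).le
    have h4 : 12 * (chop |y| x - leftEnd |y|) / (rightEnd |y| - leftEnd |y|) ≤ 12 := by
      rw [div_le_iff₀ (hd _)]; linarith
    unfold widen
    rw [abs_le]
    constructor <;> linarith

theorem widen_image_wedgeShape : fiberX (fun y => widen |y|) '' half wedgeShape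
    = half fun x b => (|x| = 6 ∧ b ≤ 2) ∨ (|x| ≤ 6 ∧ b = 2) := by
  have hd : ∀ b, leftEnd b < rightEnd b := fun b => by
    linarith [(leftEnd_mem b).2, (rightEnd_mem b).1]
  have hl : ∀ b, widen b (leftEnd b) = -6 := fun b => by
    rw [widen, chop, min_eq_left (hd b).le, max_self]; simp
  have hr : ∀ b, widen b (rightEnd b) = 6 := fun b => by
    have := (sub_pos.2 (hd b)).ne'
    rw [widen, chop, min_self, max_eq_right (hd b).le]
    field_simp; ring
  have h2 : ∀ x, |x| ≤ 6 → widen 2 x = x := fun x h => by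
    obtain ⟨h1, h2⟩ := abs_le.1 h
    rw [widen, chop, leftEnd_of_ge (by norm_num), rightEnd_of_ge (by norm_num), min_eq_left h2,
      max_eq_right h1]
    ring
  apply fiberX_image_half
  · intro y x; rw [abs_abs]
  · rintro x b hb h
    rw [abs_of_nonneg hb]
    rcases h with ⟨h, rfl | rfl⟩ | ⟨h, rfl⟩
    · rw [hl]; exact Or.inl ⟨by norm_num, h⟩
    · rw [hr]; exact Or.inl ⟨by norm_num, h⟩
    · rw [h2 x h]; exact Or.inr ⟨h, rfl⟩
  · rintro x b hb h
    rw [abs_of_nonneg hb]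
    rcases h with ⟨h, h'⟩ | ⟨h, rfl⟩
    · rcases eq_or_eq_neg_of_abs_eq h with rfl | rfl
      · exact ⟨_, Or.inl ⟨h', Or.inr rfl⟩, hr b⟩
      · exact ⟨_, Or.inl ⟨h', Or.inl rfl⟩, hl b⟩
    · exact ⟨x, Or.inr ⟨h, rfl⟩, h2 x h⟩

theorem vTwist_zero : vTwist 0 = {p | |p.1| = 1 ∧ |p.2.1| ≤ 1 ∧ p.2.2 = 0} := by
  ext ⟨x, y, z⟩
  simp only [mem_vTwist, vPoint, Set.mem_ofPred_eq, Prod.mk.injEq, Int.cast_zero, zero_mul,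
    zero_div, Real.cos_zero, Real.sin_zero, mul_one, mul_zero, neg_zero]
  constructor
  · rintro ⟨t, ht, s, hs, rfl, rfl, rfl⟩
    exact ⟨by rcases hs with rfl | rfl <;> norm_num, abs_le.2 ht, rfl⟩
  · rintro ⟨h1, h2, h3⟩
    exact ⟨y, abs_le.1 h2, x, eq_or_eq_neg_of_abs_eq h1, rfl, rfl, h3⟩

theorem hTwist_zero : hTwist 0 = {p | |p.1| ≤ 1 ∧ |p.2.1| = 1 ∧ p.2.2 = 0} := by
  ext ⟨x, y, z⟩
  simp only [mem_hTwist, hPoint, Set.mem_ofPred_eq, Prod.mk.injEq, Int.cast_zero, zero_mul,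
    zero_div, Real.cos_zero, Real.sin_zero, mul_one, mul_zero, neg_zero]
  constructor
  · rintro ⟨t, ht, s, hs, rfl, rfl, rfl⟩
    exact ⟨abs_le.2 ht, by rcases hs with rfl | rfl <;> norm_num, rfl⟩
  · rintro ⟨h1, h2, h3⟩
    exact ⟨x, abs_le.1 h1, y, eq_or_eq_neg_of_abs_eq h2, rfl, rfl, h3⟩

theorem closure₂_vTwist_zero_hTwist_zero : closure₂ (vTwist 0) (hTwist 0) = half finShape := by
  have hb : ∀ (c : ℝ) (K : Set Space) (p : Space),
      p ∈ vBox c (-1) 1 '' K ↔ (p.1 - c, p.2.1, p.2.2) ∈ K := by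
    intro c K p
    have e : ∀ w : Space, vBox c (-1) 1 w = (c + w.1, w.2.1, w.2.2) := by
      intro w; simp only [vBox]; ext <;> norm_num
    simp only [Set.mem_image, e]
    constructor
    · rintro ⟨w, hw, rfl⟩; simpa using hw
    · intro h; exact ⟨_, h, by simp⟩
  rw [closure₂_eq, vTwist_zero, hTwist_zero]
  ext ⟨x, y, z⟩
  simp only [Set.mem_union, hb, Set.mem_ofPred_eq, quad, half, rowShape, finShape]
  constructor
  · rintro ((⟨h1, h2, h3⟩ | ⟨h1, h2, h3⟩) | ⟨h4, ⟨h1, h2⟩ | ⟨h1, h2⟩ | h1⟩)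
    · refine ⟨h3, Or.inr (Or.inl ⟨h2, ?_⟩)⟩
      rcases eq_or_eq_neg_of_abs_eq h1 with h | h
      exacts [Or.inr (by linarith), Or.inl (by linarith)]
    · obtain ⟨h4, h5⟩ := abs_le.1 h1
      exact ⟨h3, Or.inl ⟨h2, Or.inr ⟨by linarith, by linarith⟩⟩⟩
    · refine ⟨h4, Or.inl ⟨h1, ?_⟩⟩
      rcases h2 with h2 | ⟨h2, h3⟩
      · obtain ⟨h5, h6⟩ := abs_le.1 h2
        exact Or.inr ⟨by linarith, by linarith⟩
      · rcases le_total 0 x with hx | hx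
        · rw [abs_of_nonneg hx] at h2 h3; exact Or.inr ⟨by linarith, by linarith⟩
        · rw [abs_of_nonpos hx] at h2 h3; exact Or.inl ⟨by linarith, by linarith⟩
    · exact ⟨h4, Or.inr (Or.inr (Or.inl ⟨(eq_or_eq_neg_of_abs_eq h1).symm, h2⟩))⟩
    · exact ⟨h4, Or.inr (Or.inr (Or.inr h1))⟩
  · rintro ⟨h4, ⟨h1, ⟨h, h'⟩ | ⟨h, h'⟩⟩ | ⟨h1, h2⟩ | ⟨h1, h2⟩ | h1⟩
    · refine Or.inr ⟨h4, Or.inl ⟨h1, Or.inr ?_⟩⟩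
      rw [abs_of_nonpos (by linarith)]; constructor <;> linarith
    · rcases le_total x 2 with h2 | h2
      · exact Or.inr ⟨h4, Or.inl ⟨h1, Or.inl (abs_le.2 ⟨h, h2⟩)⟩⟩
      rcases le_total x 4 with h3 | h3
      · exact Or.inl (Or.inr ⟨abs_le.2 ⟨by linarith, by linarith⟩, h1, h4⟩)
      · refine Or.inr ⟨h4, Or.inl ⟨h1, Or.inr ?_⟩⟩
        rw [abs_of_nonneg (by linarith)]; exact ⟨h3, h'⟩
    · refine Or.inl (Or.inl ⟨?_, h1, h4⟩)
      rcases h2 with rfl | rfl <;> norm_num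
    · refine Or.inr ⟨h4, Or.inr (Or.inl ⟨?_, h2⟩)⟩
      rcases h1 with rfl | rfl <;> norm_num
    · exact Or.inr ⟨h4, Or.inr (Or.inr h1)⟩

theorem isUnknot_closure₂_vTwist_hTwist_zero : IsUnknot (closure₂ (vTwist 0) (hTwist 0)) := by
  have h1 := ambientIsotopic_raiseFin (half finShape)
  rw [raiseFin_image_finShape] at h1
  have h2 := ambientIsotopic_widen (half wedgeShape)
  rw [widen_image_wedgeShape] at h2
  rw [closure₂_vTwist_zero_hTwist_zero]
  exact isUnknot_rectangle.of_ambientIsotopic (h1.trans h2)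

/-- The reflection of space in the plane `x = 0`. -/
def reflectX : Space ≃ₜ Space := (Homeomorph.neg ℝ).prodCongr (Homeomorph.refl (ℝ × ℝ))

theorem isUnknot_closure₂_hTwist_vTwist_zero_zero :
    IsUnknot (closure₂ (hTwist 0) (vTwist 0)) := by
  have h := AmbientIsotopic.conj isUnknot_closure₂_vTwist_hTwist_zero reflectX
  have hr : ∀ q : Space, reflectX q = (-q.1, q.2) := fun _ => rfl
  have himg : ∀ K : Set Space, reflectX '' K = {p | (-p.1, p.2) ∈ K} := by
    intro K
    ext p
    constructor
    · rintro ⟨q, hq, rfl⟩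
      simpa [hr] using hq
    · intro hp
      exact ⟨_, hp, by simp [hr]⟩
  have hc : reflectX '' unitCircle = unitCircle := by
    rw [himg]; ext p; simp [unitCircle]
  have hbox : ∀ (c : ℝ) (K : Set Space), reflectX '' K = K →
      reflectX '' (vBox c (-1) 1 '' K) = vBox (-c) (-1) 1 '' K := by
    intro c K hK
    conv_rhs => rw [← hK]
    rw [Set.image_image, Set.image_image]
    congr 1
    funext w
    simp only [hr, vBox]
    ext <;> simp
    ring
  have h1 : reflectX '' vTwist 0 = vTwist 0 := by
    rw [himg, vTwist_zero]; ext p; simp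
  have h2 : reflectX '' hTwist 0 = hTwist 0 := by
    rw [himg, hTwist_zero]; ext p; simp
  have h3 : reflectX '' quad rowShape = quad rowShape := by
    rw [himg]; ext p; simp [quad]
  rw [hc, closure₂_eq, Set.image_union, Set.image_union, hbox _ _ h1, hbox _ _ h2, h3, neg_neg,
    Set.union_comm (vBox 3 (-1) 1 '' _), ← closure₂_eq] at h
  exact h

end Tangles

/-! ### Rational tangles -/

namespace Tangles

variable {X Y T S : Set Space} {e h : ℝ}

theorem hTwist_subset_cube (n : ℤ) : hTwist n ⊆ cube := by
  rintro _ ⟨t, ht, s, hs, rfl⟩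
  have hs1 : |s| ≤ 1 := by rcases hs with rfl | rfl <;> simp
  refine ⟨abs_le.2 ht, ?_, ?_⟩
  · rw [abs_mul]
    exact mul_le_one₀ hs1 (abs_nonneg _) (Real.abs_cos_le_one _)
  · rw [abs_neg, abs_mul]
    exact mul_le_one₀ hs1 (abs_nonneg _) (Real.abs_sin_le_one _)

theorem mirror_subset_cube (hT : T ⊆ cube) : mirror T ⊆ cube := by
  rintro _ ⟨p, hp, rfl⟩
  obtain ⟨h1, h2, h3⟩ := hT hp
  exact ⟨h1, h2, by rwa [abs_neg]⟩

theorem vTwist_subset_cube (n : ℤ) : vTwist n ⊆ cube := by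
  refine mirror_subset_cube ?_
  rintro _ ⟨p, hp, rfl⟩
  obtain ⟨h1, h2, h3⟩ := hTwist_subset_cube n hp
  exact ⟨by rwa [abs_neg], h1, h3⟩

theorem add_subset_cube (hT : T ⊆ cube) (hS : S ⊆ cube) : add T S ⊆ cube := by
  rintro _ (⟨p, hp, rfl⟩ | ⟨p, hp, rfl⟩)
  · obtain ⟨h1, h2, h3⟩ := hT hp
    obtain ⟨h4, h5⟩ := abs_le.1 h1
    exact ⟨abs_le.2 ⟨by dsimp only; linarith, by dsimp only; linarith⟩, h2, h3⟩
  · obtain ⟨h1, h2, h3⟩ := hS hp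
    obtain ⟨h4, h5⟩ := abs_le.1 h1
    exact ⟨abs_le.2 ⟨by dsimp only; linarith, by dsimp only; linarith⟩, h2, h3⟩

theorem star_subset_cube (hT : T ⊆ cube) (hS : S ⊆ cube) : star T S ⊆ cube := by
  rintro _ (⟨p, hp, rfl⟩ | ⟨p, hp, rfl⟩)
  · obtain ⟨h1, h2, h3⟩ := hT hp
    obtain ⟨h4, h5⟩ := abs_le.1 h2
    exact ⟨h1, abs_le.2 ⟨by dsimp only; linarith, by dsimp only; linarith⟩, h3⟩
  · obtain ⟨h1, h2, h3⟩ := hS hp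
    obtain ⟨h4, h5⟩ := abs_le.1 h2
    exact ⟨h1, abs_le.2 ⟨by dsimp only; linarith, by dsimp only; linarith⟩, h3⟩

theorem rational_subset_cube : ∀ l : List ℤ, rational l ⊆ cube
  | [] => vTwist_subset_cube 0
  | [a] => hTwist_subset_cube a
  | [a, b] => add_subset_cube (hTwist_subset_cube a) (vTwist_subset_cube b)
  | a :: b :: c :: l => add_subset_cube (hTwist_subset_cube a)
      (star_subset_cube (rational_subset_cube (c :: l)) (vTwist_subset_cube b))

theorem mirror_hTwist (n : ℤ) : mirror (hTwist n) = hTwist (-n) := by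
  have := image_hTwist_congr (f := fun p : Space => ((p.1, p.2.1, -p.2.2) : Space)) (g := id)
    (n := n) (m := -n) (Or.inl rfl) fun t ht s hs => by
      have : ((-n : ℤ) : ℝ) * Real.pi * (t + 1) / 2 = -(n * Real.pi * (t + 1) / 2) := by
        push_cast; ring
      simp [hPoint, neg_mul, neg_div]
  rwa [Set.image_id] at this

theorem mirror_vTwist (n : ℤ) : mirror (vTwist n) = vTwist (-n) := by
  have := image_vTwist_congr (f := fun p : Space => ((p.1, p.2.1, -p.2.2) : Space)) (g := id)
    (n := n) (m := -n) (Or.inl rfl) fun t ht s hs => by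
      simp [vPoint, neg_mul, neg_div]
  rwa [Set.image_id] at this

theorem mirror_add (T S : Set Space) : mirror (add T S) = add (mirror T) (mirror S) := by
  simp only [mirror, add, Set.image_union, Set.image_image]

theorem mirror_star (T S : Set Space) : mirror (star T S) = star (mirror T) (mirror S) := by
  simp only [mirror, star, Set.image_union, Set.image_image]

theorem flip_image_hTwist (n : ℤ) (he : e = 1 ∨ e = -1) (hh : h = 1 ∨ h = -1) :
    flip e h '' hTwist n = hTwist n := by
  rcases he with rfl | rfl
  · have := image_hTwist_congr (f := flip 1 h) (g := id) (n := n) (m := n) hh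
      fun t ht s hs => by simp [flip, hPoint, mul_assoc]
    rwa [Set.image_id] at this
  · -- The parameter `t` is replaced by `-t`, which turns the angle `φ` into `nπ - φ`.
    have hc := cos_int_mul_pi_eq n
    have hP : ∀ t s, flip (-1) h (hPoint n t s)
        = hPoint n (-t) (h * Real.cos (n * Real.pi) * s) := by
      intro t s
      have h1 : n * Real.pi * (-t + 1) / 2 = n * Real.pi - n * Real.pi * (t + 1) / 2 := by ring
      have h2 : Real.cos (n * Real.pi) * Real.cos (n * Real.pi) = 1 := by
        rcases hc with h | h <;> rw [h] <;> norm_num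
      simp only [flip, hPoint, h1, Real.cos_sub, Real.sin_sub, Real.sin_int_mul_pi]
      ext
      · simp
      · linear_combination -(h * s * Real.cos (n * Real.pi * (t + 1) / 2)) * h2
      · linear_combination -(h * s * Real.sin (n * Real.pi * (t + 1) / 2)) * h2
    have hm := fun t (ht : t ∈ Set.Icc (-1 : ℝ) 1) =>
      (⟨by linarith [ht.2], by linarith [ht.1]⟩ : -t ∈ Set.Icc (-1 : ℝ) 1)
    have hs' := sign_mul hh hc
    ext p
    constructor
    · rintro ⟨_, ⟨t, ht, s, hs, rfl⟩, rfl⟩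
      exact ⟨-t, hm t ht, _, sign_mul hs' hs, hP t s⟩
    · rintro ⟨t, ht, s, hs, rfl⟩
      refine ⟨_, ⟨-t, hm t ht, _, sign_mul hs' hs, rfl⟩, ?_⟩
      refine (hP _ _).trans ?_
      rw [sign_mul_cancel hs', neg_neg]; rfl

theorem flip_image_vTwist (n : ℤ) (he : e = 1 ∨ e = -1) (hh : h = 1 ∨ h = -1) :
    flip e h '' vTwist n = vTwist n := by
  rw [vTwist, mirror, rot]
  conv_rhs => rw [← flip_image_hTwist n hh he]
  simp only [Set.image_image, flip]
  refine Set.image_congr fun p _ => ?_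
  ext <;> simp [mul_comm]

theorem flip_image_flip {e' h' : ℝ} (X : Set Space) :
    flip e h '' (flip e' h' '' X) = flip (e * e') (h * h') '' X := by
  rw [Set.image_image]
  refine Set.image_congr fun p _ => ?_
  simp only [flip]
  ext <;> ring

theorem flip_one_image_add (T S : Set Space) (h : ℝ) :
    flip 1 h '' add T S = add (flip 1 h '' T) (flip 1 h '' S) := by
  simp only [add, flip, Set.image_union, Set.image_image, one_mul]

theorem flip_neg_one_image_add (T S : Set Space) (h : ℝ) :
    flip (-1) h '' add T S = add (flip (-1) h '' S) (flip (-1) h '' T) := by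
  rw [add, Set.image_union, Set.union_comm, add]
  simp only [flip, Set.image_image]
  congr 1 <;>
  · refine Set.image_congr fun p _ => ?_
    ext <;> simp
    ring

theorem flip_image_star_one (T S : Set Space) (e : ℝ) :
    flip e 1 '' star T S = star (flip e 1 '' T) (flip e 1 '' S) := by
  simp only [star, flip, Set.image_union, Set.image_image, one_mul]

theorem flip_image_star_neg_one (T S : Set Space) (e : ℝ) :
    flip e (-1) '' star T S = star (flip e (-1) '' S) (flip e (-1) '' T) := by
  rw [star, Set.image_union, Set.union_comm, star]
  simp only [flip, Set.image_image]
  congr 1 <;>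
  · refine Set.image_congr fun p _ => ?_
    ext <;> simp
    ring

/-- The closure of `X` and `Y` is the unknot, and it remains so if `X` is turned by an element of
the Klein four-group.  The half turns are carried along since a flype turns the tangle that it
passes over. -/
def FlipUnknot (X Y : Set Space) : Prop :=
  ∀ e h : ℝ, (e = 1 ∨ e = -1) → (h = 1 ∨ h = -1) → IsUnknot (closure₂ (flip e h '' X) Y)

theorem FlipUnknot.hTwist_add (a : ℤ) (hX : X ⊆ cube) (hY : Y ⊆ cube) (hu : FlipUnknot X Y) :
    FlipUnknot (add (hTwist a) X) (add (hTwist (-a)) Y) := by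
  rintro e h (rfl | rfl) hh
  · rw [flip_one_image_add, flip_image_hTwist a (Or.inl rfl) hh]
    refine isUnknot_closure₂_flype a (flip_image_subset (Or.inl rfl) hh hX) hY ?_
    rw [flip_image_flip]
    exact hu _ _ (by norm_num) (sign_mul (cos_int_mul_pi_eq a) hh)
  · rw [flip_neg_one_image_add, flip_image_hTwist a (Or.inr rfl) hh]
    exact isUnknot_closure₂_cancel a (flip_image_subset (Or.inr rfl) hh hX) hY
      (hu _ _ (Or.inr rfl) hh)

theorem FlipUnknot.star_vTwist (b : ℤ) (hX : X ⊆ cube) (hY : Y ⊆ cube) (hu : FlipUnknot X Y) :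
    FlipUnknot (star X (vTwist b)) (star Y (vTwist (-b))) := by
  have hu' : ∀ e h : ℝ, (e = 1 ∨ e = -1) → (h = 1 ∨ h = -1) →
      IsUnknot (bendClosure (flip e h '' X) Y) := fun e h he hh =>
    (hu e h he hh).of_ambientIsotopic
      (ambientIsotopic_closure₂_bendClosure (flip_image_subset he hh hX) hY).symm
  intro e h he hh
  have hX' := flip_image_subset he hh hX
  refine IsUnknot.of_ambientIsotopic ?_ (ambientIsotopic_closure₂_bendClosure
    (flip_image_subset he hh (star_subset_cube hX (vTwist_subset_cube b)))
    (star_subset_cube hY (vTwist_subset_cube (-b))))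
  rcases hh with rfl | rfl
  · rw [flip_image_star_one, flip_image_vTwist b he (Or.inl rfl)]
    exact isUnknot_bendClosure_cancel b hX' hY (hu' _ _ he (Or.inl rfl))
  · rw [flip_image_star_neg_one, flip_image_vTwist b he (Or.inr rfl)]
    refine isUnknot_bendClosure_flype b hX' hY ?_
    rw [flip_image_flip]
    exact hu' _ _ (sign_mul (cos_int_mul_pi_eq b) he) (by norm_num)

theorem FlipUnknot.of_add_zero (hX : X ⊆ cube) (hY : Y ⊆ cube)
    (hu : FlipUnknot X (add Y (hTwist 0))) : FlipUnknot X Y := fun e h he hh =>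
  isUnknot_closure₂_of_add_zero (flip_image_subset he hh hX) hY (hu e h he hh)

theorem FlipUnknot.of_zero_star (hX : X ⊆ cube) (hY : Y ⊆ cube)
    (hu : FlipUnknot X (star (vTwist 0) Y)) : FlipUnknot X Y := by
  intro e h he hh
  have hX' := flip_image_subset he hh hX
  refine IsUnknot.of_ambientIsotopic ?_ (ambientIsotopic_closure₂_bendClosure hX' hY)
  refine isUnknot_bendClosure_of_zero_star hX' hY ?_
  exact (hu e h he hh).of_ambientIsotopic (ambientIsotopic_closure₂_bendClosure hX'
    (star_subset_cube (vTwist_subset_cube 0) hY)).symm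

theorem flipUnknot_hTwist (a : ℤ) : FlipUnknot (hTwist a) (vTwist 0) := by
  intro e h he hh
  rw [flip_image_hTwist a he hh]
  exact isUnknot_closure₂_hTwist_vTwist_zero a isUnknot_closure₂_hTwist_vTwist_zero_zero

theorem flipUnknot_vTwist (b : ℤ) : FlipUnknot (vTwist b) (hTwist 0) := by
  intro e h he hh
  rw [flip_image_vTwist b he hh]
  have hi := ambientIsotopic_closure₂_bendClosure (vTwist_subset_cube b) (hTwist_subset_cube 0)
  have hi0 := ambientIsotopic_closure₂_bendClosure (vTwist_subset_cube 0) (hTwist_subset_cube 0)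
  exact (isUnknot_bendClosure_vTwist_hTwist_zero b
    (isUnknot_closure₂_vTwist_hTwist_zero.of_ambientIsotopic hi0.symm)).of_ambientIsotopic hi

theorem flipUnknot_star_vTwist (b c : ℤ) :
    FlipUnknot (star (hTwist c) (vTwist b)) (vTwist (-b)) :=
  .of_zero_star (star_subset_cube (hTwist_subset_cube c) (vTwist_subset_cube b))
    (vTwist_subset_cube (-b))
    ((flipUnknot_hTwist c).star_vTwist b (hTwist_subset_cube c) (vTwist_subset_cube 0))

theorem mirror_rational_subset_cube (l : List ℤ) : mirror (rational l) ⊆ cube :=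
  mirror_subset_cube (rational_subset_cube l)

/-- Induction on the length in steps of two: the outer horizontal twists `a` and `-a` cancel, then
so do the vertical twists `b` and `-b`, and there remain the tails of the continued fractions. -/
theorem flipUnknot_rational : ∀ l : List ℤ, 2 ≤ l.length →
    FlipUnknot (rational l) (mirror (rational l.dropLast))
  | [], hl => by simp at hl
  | [_], hl => by simp at hl
  | [a, b], _ => by
    have h1 := add_subset_cube (hTwist_subset_cube a) (vTwist_subset_cube b)
    simp only [List.dropLast, rational, mirror_hTwist]
    exact .of_add_zero h1 (hTwist_subset_cube (-a)) ((flipUnknot_vTwist b).hTwist_add a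
      (vTwist_subset_cube b) (hTwist_subset_cube 0))
  | [a, b, c], _ => by
    simp only [List.dropLast, rational, mirror_hTwist, mirror_vTwist, mirror_add]
    exact (flipUnknot_star_vTwist b c).hTwist_add a
      (star_subset_cube (hTwist_subset_cube c) (vTwist_subset_cube b)) (vTwist_subset_cube (-b))
  | a :: b :: c :: d :: l, _ => by
    have ih := flipUnknot_rational (c :: d :: l) (by simp)
    have h1 := rational_subset_cube (c :: d :: l)
    have h2 := mirror_rational_subset_cube (c :: (d :: l).dropLast)
    rw [List.dropLast_cons_cons] at ih
    rw [List.dropLast_cons_cons, List.dropLast_cons_cons, List.dropLast_cons_cons, rational,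
      rational, mirror_add, mirror_star, mirror_hTwist, mirror_vTwist]
    exact (ih.star_vTwist b h1 h2).hTwist_add a (star_subset_cube h1 (vTwist_subset_cube b))
      (star_subset_cube h2 (vTwist_subset_cube (-b)))

theorem isUnknot_numerator_hTwist_add (a : ℤ) (hX : X ⊆ cube) (hY : Y ⊆ cube)
    (hu : FlipUnknot X Y) :
    IsUnknot (numerator (add (add (hTwist a) X) (add (hTwist (-a)) Y))) :=
  isUnknot_numerator_flype a hX hY (hu _ _ (Or.inl rfl) (cos_int_mul_pi_eq a))

theorem isUnknot_numerator_sub_dropLast : ∀ l : List ℤ, 2 ≤ l.length →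
    IsUnknot (numerator (sub (rational l) (rational l.dropLast)))
  | [], hl => by simp at hl
  | [_], hl => by simp at hl
  | [a, b], _ => by
    simp only [sub, List.dropLast, rational, mirror_hTwist]
    refine isUnknot_numerator_of_add_zero (-a)
      (add_subset_cube (hTwist_subset_cube a) (vTwist_subset_cube b)) (hTwist_subset_cube (-a)) ?_
    exact isUnknot_numerator_hTwist_add a (vTwist_subset_cube b) (hTwist_subset_cube 0)
      (flipUnknot_vTwist b)
  | [a, b, c], _ => by
    simp only [sub, List.dropLast, rational, mirror_hTwist, mirror_vTwist, mirror_add]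
    exact isUnknot_numerator_hTwist_add a
      (star_subset_cube (hTwist_subset_cube c) (vTwist_subset_cube b)) (vTwist_subset_cube (-b))
      (flipUnknot_star_vTwist b c)
  | a :: b :: c :: d :: l, _ => by
    have ih := flipUnknot_rational (c :: d :: l) (by simp)
    have h1 := rational_subset_cube (c :: d :: l)
    have h2 := mirror_rational_subset_cube (c :: (d :: l).dropLast)
    rw [List.dropLast_cons_cons] at ih
    rw [sub, List.dropLast_cons_cons, List.dropLast_cons_cons, List.dropLast_cons_cons, rational,
      rational, mirror_add, mirror_star, mirror_hTwist, mirror_vTwist]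
    exact isUnknot_numerator_hTwist_add a (star_subset_cube h1 (vTwist_subset_cube b))
      (star_subset_cube h2 (vTwist_subset_cube (-b))) (ih.star_vTwist b h1 h2)

end Tangles

theorem mainTheorem1 :
    (∀ a : List ℤ, 2 ≤ a.length →
      Tangles.IsUnknot
        (Tangles.numerator (Tangles.sub (Tangles.rational a) (Tangles.rational a.dropLast)))) ∧
    (∀ n : ℕ, 1 ≤ n → Tangles.IsUnknot (Tangles.dotKnot (n + 1) n)) := by
  refine ⟨Tangles.isUnknot_numerator_sub_dropLast, fun n hn => ?_⟩
  have h := Tangles.isUnknot_numerator_sub_dropLast (List.replicate (n + 1) 1) (by simp; omega)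
  rwa [List.dropLast_replicate, Nat.add_sub_cancel] at h
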